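/- **Problem (DDP-SC with swapping stations).** An instance consists of $n\ge 1$ deliveries, $r\ge 0$ swapping stations and a battery capacity $B$. Delivery $j$ has a closed time interval $I_j=[t^L_j,t^R_j]$ (launch and rendezvous time) and a cost $cost(I_j)\in(0,B]$. Station $\ell$ has a swapping interval $I^c_\ell=[t^A_\ell,t^D_\ell]$, and $t^A_1<t^D_1<t^A_2<t^D_2<\dots<t^A_r<t^D_r$. No $I_j$ is contained in a swapping interval, and no $I_j$ meets two of them. Two intervals conflict if they intersect; conflicting delivery intervals are allowed. Every drone starts with capacity $B$. A feasible assignment of a drone is a set of delivery intervals and swapping intervals such that no two of them conflict and the cost of each delivery is at most the battery remaining at its launch; a delivery reduces the battery by its cost, and a swap resets it to $B$. $OPT_{SC}$ is the least number of drones with feasible assignments such that every delivery is made by exactly one drone. Put $$\epsilon_{min}=\tfrac1B\min_j cost(I_j),\qquad \epsilon_{max}=\min\{\tfrac12,\tfrac1B\max_j cost(I_j)\},\qquad \psi=\frac{\epsilon_{max}-\epsilon_{min}}{1-\epsilon_{max}},$$ and let $\omega$ be the maximum number of pairwise conflicting delivery intervals. **Algorithm (Mod-Alg-DDP-SC).**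 1. Split the deliveries into $\widetilde{\mathcal I}_1,\dots,\widetilde{\mathcal I}_{r+1}$, where $\widetilde{\mathcal I}_\ell=\{I_j: t^D_{\ell-1}<t^L_j\le t^D_\ell\}$, with $t^D_0=-\infty$ and $t^D_{r+1}=+\infty$. 2. For $\ell\le r$ let $\mathcal I^{left}_\ell$ be the intervals of $\widetilde{\mathcal I}_\ell$ that contain $t^A_\ell$, let $\mathcal I^{right}_\ell$ be those that contain $t^D_\ell$ but not $t^A_\ell$, and let $\mathcal I^{ext}_\ell$ be the union of the two. Find a maximum matching $\mathcal M_\ell$ in the bipartite graph that joins $u\in\mathcal I^{left}_\ell$ and $v\in\mathcal I^{right}_\ell$ if they do not conflict and $cost(u)+cost(v)\le B$. Put $z_\ell=|\mathcal I^{ext}_\ell|-|\mathcal M_\ell|$. 3. For $\ell\le r$ colour $\widetilde{\mathcal I}_\ell$ with $\max\{\omega,z_\ell\}$ colours: first $\mathcal I^{ext}_\ell$, where matched intervals share a colour and the colours are otherwise distinct; then the other intervals in non-increasing order of rendezvous time, each with any colour not used by an already coloured conflicting interval. Colour $\widetilde{\mathcal I}_{r+1}$ properly with $\omega$ colours. 4.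 In each $\widetilde{\mathcal I}_\ell$ pack every colour class greedily into blocks of total cost at most $B$. The order is arbitrary, except that matched pairs come first. Each interval goes into any open block of its class in which it fits, and a new block is opened only if there is none. Let $\widetilde m_\ell$ be the number of blocks of $\widetilde{\mathcal I}_\ell$. 5. Use $\max_\ell\widetilde m_\ell+\max_\ell z_\ell$ drones (the second maximum is $0$ if $r=0$). For $\ell=1,\dots,r+1$ assign the blocks of $\widetilde{\mathcal I}_\ell$ to distinct drones that do not serve $\mathcal I^{ext}_{\ell-1}$ (with $\mathcal I^{ext}_0=\emptyset$); then, if $\ell\le r$, all drones used so far, except those serving $\mathcal I^{ext}_\ell$, swap their batteries at station $\ell$. **Theorem.** Mod-Alg-DDP-SC is a $(3+\psi)$-approximation algorithm for DDP-SC with swapping stations. That is, on every instance and for every choice left open in the steps above, the algorithm can be carried out to the end, all resulting assignments are feasible, every delivery is made by exactly one drone, and $$\max_\ell\widetilde m_\ell+\max_\ell z_\ell\;\le\;\Bigl(3+\frac{\epsilon_{max}-\epsilon_{min}}{1-\epsilon_{max}}\Bigr)\,OPT_{SC}.$$ Moreover, the algorithm can be implemented to run in $O(n^{2.273}+r)$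 elementary steps (unit-cost operations on numbers, pairs and linked lists, where real numbers are only added, subtracted and compared). -/

import Mathlib

namespace DDP

noncomputable section

open scoped Classical

/-- An instance with `n` deliveries and `r` swapping stations, together with the standing
assumptions of the model. Deliveries and stations are numbered from `0`. -/
structure Inst (n r : ℕ) where
  /-- the battery capacity `B` of every drone -/
  budget : ℝ
  launch : Fin n → ℝ
  rendezvous : Fin n → ℝ
  cost : Fin n → ℝ
  /-- arrival of the truck at a station -/
  arrival : Fin r → ℝ
  /-- departure of the truck from a station -/
  departure : Fin r → ℝ
  launch_le_rendezvous : ∀ j, launch j ≤ rendezvous j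
  cost_pos : ∀ j, 0 < cost j
  cost_le_budget : ∀ j, cost j ≤ budget
  arrival_lt_departure : ∀ k, arrival k < departure k
  departure_lt_arrival : ∀ k k', k < k' → departure k < arrival k'
  /-- no delivery interval is contained in a waiting interval -/
  not_subset_waiting : ∀ j k,
    ¬ Set.Icc (launch j) (rendezvous j) ⊆ Set.Icc (arrival k) (departure k)
  /-- no delivery interval meets two waiting intervals -/
  meets_at_most_one : ∀ j k k',
    (Set.Icc (launch j) (rendezvous j) ∩ Set.Icc (arrival k) (departure k)).Nonempty →
    (Set.Icc (launch j) (rendezvous j) ∩ Set.Icc (arrival k') (departure k')).Nonempty →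
    k = k'

namespace Inst

variable {n r : ℕ} (P : Inst n r)

/-- The delivery time interval of `j`. -/
def interval (j : Fin n) : Set ℝ := Set.Icc (P.launch j) (P.rendezvous j)

/-- The swapping time interval of station `k`. -/
def waiting (k : Fin r) : Set ℝ := Set.Icc (P.arrival k) (P.departure k)

/-- The interval graph: two deliveries are adjacent when their intervals are in conflict. -/
def conflictGraph : SimpleGraph (Fin n) where
  Adj i j := i ≠ j ∧ (P.interval i ∩ P.interval j).Nonempty
  symm := ⟨fun _ _ h => ⟨h.1.symm, by rw [Set.inter_comm]; exact h.2⟩⟩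
  loopless := ⟨fun _ h => h.1 rfl⟩

/-- The maximum clique size of the interval graph. -/
def omega : ℕ := P.conflictGraph.cliqueNum

/-! ### Feasible assignments and the optimum -/

/-- The remaining battery at time `t` of a drone that carries out the deliveries `S` and swaps its
battery at the stations `W`: the capacity minus the cost of the deliveries in `S` completed before
`t` and not followed by a swap completed before `t`. -/
def remaining (S : Finset (Fin n)) (W : Finset (Fin r)) (t : ℝ) : ℝ :=
  P.budget - ∑ i ∈ S.filter (fun i => P.rendezvous i < t ∧
    ∀ k ∈ W, ¬ (P.rendezvous i < P.arrival k ∧ P.departure k < t)), P.cost i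

/-- A drone can carry out the deliveries `S` and swap its battery at the stations `W`. -/
structure FeasibleAssignment (S : Finset (Fin n)) (W : Finset (Fin r)) : Prop where
  deliveries_compatible : ∀ i ∈ S, ∀ j ∈ S, i ≠ j → Disjoint (P.interval i) (P.interval j)
  swaps_compatible : ∀ j ∈ S, ∀ k ∈ W, Disjoint (P.interval j) (P.waiting k)
  within_budget : ∀ j ∈ S, P.cost j ≤ P.remaining S W (P.launch j)

/-- A solution with at most `m` drones, numbered `0, …, m - 1`: delivery `j` is carried out by the
drone `drone j`, and drone `d` swaps its battery at the stations `swaps d`. -/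
def FeasibleSolution (m : ℕ) (drone : Fin n → ℕ) (swaps : ℕ → Finset (Fin r)) : Prop :=
  (∀ j, drone j < m) ∧
    ∀ d < m, P.FeasibleAssignment (Finset.univ.filter fun j => drone j = d) (swaps d)

/-- The minimum number of drones. -/
def opt : ℕ := sInf {m | ∃ drone swaps, P.FeasibleSolution m drone swaps}

def epsMin : ℝ := (⨅ j, P.cost j) / P.budget

def epsMax : ℝ := min (1 / 2) ((⨆ j, P.cost j) / P.budget)

def psi : ℝ := (P.epsMax - P.epsMin) / (1 - P.epsMax)

/-! ### The algorithm Mod-Alg-DDP-SC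

The algorithm leaves several choices open (which maximum matching, which free colour, which used
drone with enough battery, the order in which deliveries are taken, which available drone). A run
is a record of all choices; the predicates below say that the choices obey the rules of the
algorithm. There are `r + 1` segments; station `k` closes the segment `k.castSucc` and opens the
segment `k.succ`. A choice is constrained by the rule for it whenever the rule can be obeyed at all,
so that a statement about all runs includes that the algorithm never gets stuck. -/

/-- The deliveries launched after the departure from the preceding station and not after
the departure from the next one. -/
def segment (l : Fin (r + 1)) : Finset (Fin n) :=
  Finset.univ.filter fun j =>
    (∀ k : Fin r, k.succ = l → P.departure k < P.launch j) ∧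
    (∀ k : Fin r, k.castSucc = l → P.launch j ≤ P.departure k)

def left (k : Fin r) : Finset (Fin n) :=
  (P.segment k.castSucc).filter fun j => P.arrival k ∈ P.interval j

def right (k : Fin r) : Finset (Fin n) :=
  (P.segment k.castSucc).filter fun j => P.departure k ∈ P.interval j ∧ j ∉ P.left k

def ext (k : Fin r) : Finset (Fin n) := P.left k ∪ P.right k

/-- The edges of the bipartite graph at station `k`. -/
def BipAdj (k : Fin r) (u v : Fin n) : Prop :=
  u ∈ P.left k ∧ v ∈ P.right k ∧ Disjoint (P.interval u) (P.interval v) ∧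
    P.cost u + P.cost v ≤ P.budget

/-- A matching of the bipartite graph, as a set of pairs `(u, v)`, `u` left and `v` right. -/
def IsMatching (k : Fin r) (M : Finset (Fin n × Fin n)) : Prop :=
  (∀ e ∈ M, P.BipAdj k e.1 e.2) ∧
    ∀ e ∈ M, ∀ f ∈ M, e.1 = f.1 ∨ e.2 = f.2 → e = f

def IsMaximumMatching (k : Fin r) (M : Finset (Fin n × Fin n)) : Prop :=
  P.IsMatching k M ∧ ∀ M', P.IsMatching k M' → M'.card ≤ M.card

end Inst

/-- The choices made in a run of the algorithm. -/
structure Choices (n r : ℕ) where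
  /-- the matching computed at each station -/
  matching : Fin r → Finset (Fin n × Fin n)
  /-- position of a delivery in the order in which the remaining deliveries are coloured -/
  colorRank : Fin n → ℕ
  /-- the colour of a delivery (within its segment) -/
  color : Fin n → ℕ
  /-- position of a delivery in the order in which its colour class is packed -/
  packRank : Fin n → ℕ
  /-- the index, within the colour class, of the block that receives the delivery -/
  block : Fin n → ℕ
  /-- the drone that receives the delivery -/
  drone : Fin n → ℕ

namespace Choices

variable {n r : ℕ} (c : Choices n r) (P : Inst n r)

/-- `z` at station `k`: the number of matched pairs and unmatched vertices. -/
def z (k : Fin r) : ℕ := (P.ext k).card - (c.matching k).card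

/-- Colour `a` may be given to `v` when it is among the `max ω z` colours and not used by an
already coloured neighbour of `v`. -/
def ColorAllowed (k : Fin r) (v : Fin n) (a : ℕ) : Prop :=
  a < max P.omega (c.z P k) ∧
    ∀ u ∈ P.segment k.castSucc, P.conflictGraph.Adj u v →
      (u ∈ P.ext k ∨ c.colorRank u < c.colorRank v) → c.color u ≠ a

/-- The colouring of the segment that ends at station `k`. -/
structure ColorsSegment (k : Fin r) : Prop where
  ext_lt : ∀ j ∈ P.ext k, c.color j < max P.omega (c.z P k)
  matched_eq : ∀ e ∈ c.matching k, c.color e.1 = c.color e.2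
  /-- apart from matched pairs, all colours on `ext` are distinct -/
  unmatched_ne : ∀ i ∈ P.ext k, ∀ j ∈ P.ext k, c.color i = c.color j →
    i = j ∨ (i, j) ∈ c.matching k ∨ (j, i) ∈ c.matching k
  /-- the remaining deliveries are taken in some order of non-increasing rendezvous times -/
  rank_injOn : Set.InjOn c.colorRank ↑(P.segment k.castSucc \ P.ext k)
  rank_order : ∀ i ∈ P.segment k.castSucc \ P.ext k, ∀ j ∈ P.segment k.castSucc \ P.ext k,
    P.rendezvous j < P.rendezvous i → c.colorRank i < c.colorRank j
  /-- each of them gets any free colour -/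
  greedy : ∀ v ∈ P.segment k.castSucc \ P.ext k,
    (∃ a, c.ColorAllowed P k v a) → c.ColorAllowed P k v (c.color v)

/-- `f` is a proper colouring of the last segment with the colours `0, …, ω - 1`. -/
def ProperLast (f : Fin n → ℕ) : Prop :=
  (∀ j ∈ P.segment (Fin.last r), f j < P.omega) ∧
    ∀ i ∈ P.segment (Fin.last r), ∀ j ∈ P.segment (Fin.last r),
      P.conflictGraph.Adj i j → f i ≠ f j

/-- The colouring of the last segment. -/
def ColorsLast : Prop := (∃ f, ProperLast P f) → ProperLast P c.color

/-- The deliveries of a segment that have a given colour. -/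
def colorClass (l : Fin (r + 1)) (a : ℕ) : Finset (Fin n) :=
  (P.segment l).filter fun j => c.color j = a

/-- The deliveries of segment `l` with the colour of `j` that are packed before `j`. -/
def earlier (l : Fin (r + 1)) (j : Fin n) : Finset (Fin n) :=
  (c.colorClass P l (c.color j)).filter fun i => c.packRank i < c.packRank j

/-- The blocks of this colour that are already open when `j` is packed. -/
def openBlocks (l : Fin (r + 1)) (j : Fin n) : Finset ℕ := (c.earlier P l j).image c.block

/-- The capacity left in block `b` when `j` is packed. -/
def capacityLeft (l : Fin (r + 1)) (j : Fin n) (b : ℕ) : ℝ :=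
  P.budget - ∑ i ∈ (c.earlier P l j).filter (fun i => c.block i = b), P.cost i

/-- The greedy packing of the colour classes of segment `l`: a delivery goes into any open
block that has enough capacity left, and opens the next block if there is none. -/
structure PacksSegment (l : Fin (r + 1)) : Prop where
  rank_injOn : ∀ a, Set.InjOn c.packRank ↑(c.colorClass P l a)
  fits : ∀ j ∈ P.segment l,
    (∃ b ∈ c.openBlocks P l j, P.cost j ≤ c.capacityLeft P l j b) →
      c.block j ∈ c.openBlocks P l j ∧ P.cost j ≤ c.capacityLeft P l j (c.block j)
  opens : ∀ j ∈ P.segment l,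
    (¬ ∃ b ∈ c.openBlocks P l j, P.cost j ≤ c.capacityLeft P l j b) →
      c.block j = (c.openBlocks P l j).card

/-- Matched pairs are packed before all other deliveries of their colour. -/
def MatchedFirst (k : Fin r) : Prop :=
  ∀ e ∈ c.matching k, ∀ j ∈ c.colorClass P k.castSucc (c.color e.1), j ≠ e.1 → j ≠ e.2 →
    c.packRank e.1 < c.packRank j ∧ c.packRank e.2 < c.packRank j

/-- The number of blocks of segment `l`; a block is given by its colour and its index. -/
def numBlocks (l : Fin (r + 1)) : ℕ :=
  ((P.segment l).image fun j => (c.color j, c.block j)).card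

/-- The number of drones used by the algorithm: the largest number of blocks of a segment plus
the largest `z`. -/
def numDrones : ℕ := Finset.univ.sup (c.numBlocks P) + Finset.univ.sup (c.z P)

/-- The drones that are assigned to the deliveries of `ext` at station `k`. -/
def extDrones (k : Fin r) : Finset ℕ := (P.ext k).image c.drone

/-- The drones that may receive blocks of segment `l`. -/
def available (l : Fin (r + 1)) : Finset ℕ :=
  (Finset.range (c.numDrones P)).filter fun d => ∀ k : Fin r, k.succ = l → d ∉ c.extDrones P k

/-- The blocks of segment `l` are assigned to distinct available drones. -/
def AssignsSegment (l : Fin (r + 1)) : Prop :=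
  c.numBlocks P l ≤ (c.available P l).card →
    (∀ j ∈ P.segment l, c.drone j ∈ c.available P l) ∧
    ∀ i ∈ P.segment l, ∀ j ∈ P.segment l,
      c.drone i = c.drone j ↔ c.color i = c.color j ∧ c.block i = c.block j

/-- The stations at which drone `d` swaps its battery: at each station, all drones used so
far do so, except those assigned to `ext` at this station. -/
def swaps (d : ℕ) : Finset (Fin r) :=
  Finset.univ.filter fun k =>
    (∃ l ≤ k.castSucc, ∃ j ∈ P.segment l, c.drone j = d) ∧ d ∉ c.extDrones P k

/-- The choices `c` form a run of Mod-Alg-DDP-SC on the instance `P`. -/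
structure IsRun : Prop where
  matching : ∀ k, P.IsMaximumMatching k (c.matching k)
  colors : ∀ k, c.ColorsSegment P k
  colors_last : c.ColorsLast P
  matched_first : ∀ k, c.MatchedFirst P k
  packs : ∀ l, c.PacksSegment P l
  assigns : ∀ l, c.AssignsSegment P l

end Choices

/-! ### A model of computation with a step count

Programs over immutable pairs and linked lists (passed by reference), natural numbers and real
numbers, with unit cost for every elementary operation; the only loop is the traversal of a list.
Reals can only be added, subtracted and compared. -/

inductive Prog : Type → Type → Type 1
  | id {α : Type} : Prog α α
  | comp {α β γ : Type} : Prog β γ → Prog α β → Prog α γ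
  | pair {α β γ : Type} : Prog α β → Prog α γ → Prog α (β × γ)
  | fst {α β : Type} : Prog (α × β) α
  | snd {α β : Type} : Prog (α × β) β
  | cond {α β : Type} : Prog α β → Prog α β → Prog (Bool × α) β
  | nil {α β : Type} : Prog α (List β)
  | cons {α : Type} : Prog (α × List α) (List α)
  | caseList {α β γ : Type} : Prog α β → Prog (α × γ × List γ) β → Prog (α × List γ) β
  /-- `fold p` maps `(s, [x₁, …, xₘ])` to `p (… p (p (s, x₁), x₂) …, xₘ)` -/
  | fold {α β : Type} : Prog (α × β) α → Prog (α × List β) α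
  | natZero {α : Type} : Prog α ℕ
  | natSucc : Prog ℕ ℕ
  | natAdd : Prog (ℕ × ℕ) ℕ
  | natSub : Prog (ℕ × ℕ) ℕ
  | natLe : Prog (ℕ × ℕ) Bool
  | realZero {α : Type} : Prog α ℝ
  | realAdd : Prog (ℝ × ℝ) ℝ
  | realSub : Prog (ℝ × ℝ) ℝ
  | realLe : Prog (ℝ × ℝ) Bool

/-- The value computed by a program, and the number of steps. -/
def Prog.exec {α β : Type} : Prog α β → α → β × ℕ
  | .id, x => (x, 1)
  | .comp q p, x => ((q.exec (p.exec x).1).1, (p.exec x).2 + (q.exec (p.exec x).1).2 + 1)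
  | .pair p q, x => (((p.exec x).1, (q.exec x).1), (p.exec x).2 + (q.exec x).2 + 1)
  | .fst, x => (x.1, 1)
  | .snd, x => (x.2, 1)
  | .cond p q, x =>
      if x.1 = true then ((p.exec x.2).1, (p.exec x.2).2 + 1)
      else ((q.exec x.2).1, (q.exec x.2).2 + 1)
  | .nil, _ => ([], 1)
  | .cons, x => (x.1 :: x.2, 1)
  | .caseList p q, x =>
      match x.2 with
      | [] => ((p.exec x.1).1, (p.exec x.1).2 + 1)
      | y :: ys => ((q.exec (x.1, y, ys)).1, (q.exec (x.1, y, ys)).2 + 1)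
  | .fold p, x =>
      x.2.foldl (fun s y => ((p.exec (s.1, y)).1, s.2 + (p.exec (s.1, y)).2 + 1)) (x.1, 1)
  | .natZero, _ => (0, 1)
  | .natSucc, x => (x + 1, 1)
  | .natAdd, x => (x.1 + x.2, 1)
  | .natSub, x => (x.1 - x.2, 1)
  | .natLe, x => (decide (x.1 ≤ x.2), 1)
  | .realZero, _ => (0, 1)
  | .realAdd, x => (x.1 + x.2, 1)
  | .realSub, x => (x.1 - x.2, 1)
  | .realLe, x => (decide (x.1 ≤ x.2), 1)

/-- Input: the budget, the list of `(launch, rendezvous, cost)`, one entry for each delivery, and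
the list of `(arrival, departure)`, one entry for each station. -/
abbrev Input : Type := ℝ × List (ℝ × ℝ × ℝ) × List (ℝ × ℝ)

def Inst.input {n r : ℕ} (P : Inst n r) : Input :=
  (P.budget, List.ofFn fun j => (P.launch j, P.rendezvous j, P.cost j),
    List.ofFn fun k => (P.arrival k, P.departure k))

/-- Output: the number of drones, the drone of each delivery, and for each station the list of the
drones that do not swap there (all other drones in use do). -/
abbrev Output : Type := ℕ × List ℕ × List (List ℕ)

/-- `o` is the result of the run `c`. -/
def Choices.IsOutput {n r : ℕ} (c : Choices n r) (P : Inst n r) (o : Output) : Prop :=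
  o.1 = c.numDrones P ∧ o.2.1 = List.ofFn c.drone ∧
    o.2.2.map List.toFinset = List.ofFn (c.extDrones P)

end

end DDP

/-! Approximation. The number of drones used is compared with any feasible solution on `m` drones.
Inside one segment no station lies between two deliveries, so a drone of that solution spends at
most `B` on the deliveries of the segment (`FeasibleAssignment.sum_cost_le`). Three bounds follow: a
segment costs at most `m * B` in total; the left-right pairs that share a drone form a matching,
whence `z ≤ m` (`FeasibleSolution.z_le`); and `ω ≤ m`. Hence at most `m` colours occur in a segment.
Let `y` be the least cost and `E` the minimum of `B / 2` and the greatest cost. If `y ≤ B / 2`, a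
colour class packed into `t + 1` blocks costs at least `t * (B - E) + y`, because the opener of a
block fits in no block opened before (`sum_loads_ge`). For `N` blocks in `p ≤ m` classes this gives
`(N - p) * (B - E) + p * y ≤ m * B`, that is `N ≤ (2 + ψ) * m` (`IsRun.numBlocks_le`). If `y > B /
2`, a drone makes at most one delivery per segment and `N ≤ m`. Adding `z ≤ m` yields the factor `3
+ ψ`.

Feasibility. A delivery outside `ext` ends before the truck arrives, so all its neighbours coloured
before it contain its rendezvous time; together with it they form a clique, and one of `ω` colours
is free. A matched pair is packed first and shares a block, so `ext` occupies at most `z` drones and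
enough drones remain for the next segment (`IsRun.assigned`). A drone that receives a block after an
earlier segment did not serve `ext` at the station in between, so it swapped there; its battery pays
for a single block, of cost at most `B` (`IsRun.feasible`).

Running time. An explicit program makes all choices by first fit. No general matching algorithm is
needed: whether `u` and `v` may be matched depends on the comparisons `rendezvous u < launch v` and
`cost u + cost v ≤ B`, and an exchange argument shows that a greedy choice is optimal
(`length_firstFitAll_add_card_le`). The functions are polymorphic in the labels of the deliveries:
they are verified on `Fin n`, executed on tuples of numbers, and commute with the passage between
the two. `Inst.exists_run` extracts a run from the output. A calculus of step counts (`Comp`) bounds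
the time by a multiple of `n ^ 2 + r + 1` (`comp_algorithm`). -/

namespace DDP

noncomputable section

open scoped Classical

/-! ### Geometry of segments, stations and conflicts -/

namespace Inst

variable {n r : ℕ} (P : Inst n r)

theorem mem_interval {j : Fin n} {t : ℝ} :
    t ∈ P.interval j ↔ P.launch j ≤ t ∧ t ≤ P.rendezvous j := Iff.rfl

theorem disjoint_interval_iff {i j : Fin n} :
    Disjoint (P.interval i) (P.interval j) ↔
      P.rendezvous i < P.launch j ∨ P.rendezvous j < P.launch i := by
  have hi := P.launch_le_rendezvous i
  have hj := P.launch_le_rendezvous j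
  constructor
  · intro h
    by_contra! hc
    exact Set.disjoint_left.mp h
      (show max (P.launch i) (P.launch j) ∈ P.interval i from ⟨le_max_left _ _, max_le hi hc.1⟩)
      ⟨le_max_right _ _, max_le hc.2 hj⟩
  · rintro (h | h) <;>
    · refine Set.disjoint_left.mpr fun t ht ht' => ?_
      have h1 := ht.1
      have h2 := ht.2
      have h3 := ht'.1
      have h4 := ht'.2
      linarith

theorem adj_iff {i j : Fin n} :
    P.conflictGraph.Adj i j ↔ i ≠ j ∧ ¬ Disjoint (P.interval i) (P.interval j) := by
  rw [Set.not_disjoint_iff_nonempty_inter]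
  rfl

theorem disjoint_waiting_iff {j : Fin n} {k : Fin r} :
    Disjoint (P.interval j) (P.waiting k) ↔
      P.rendezvous j < P.arrival k ∨ P.departure k < P.launch j := by
  have hi := P.launch_le_rendezvous j
  have hj := P.arrival_lt_departure k
  constructor
  · intro h
    by_contra! hc
    exact Set.disjoint_left.mp h
      (show max (P.launch j) (P.arrival k) ∈ P.interval j from ⟨le_max_left _ _, max_le hi hc.1⟩)
      ⟨le_max_right _ _, max_le hc.2 hj.le⟩
  · rintro (h | h) <;>
    · refine Set.disjoint_left.mpr fun t ht ht' => ?_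
      have h1 := ht.1
      have h2 := ht.2
      have h3 := ht'.1
      have h4 := ht'.2
      linarith

theorem meets_unique {j : Fin n} {k k' : Fin r} {t t' : ℝ} (h : t ∈ P.interval j)
    (hk : t ∈ P.waiting k) (h' : t' ∈ P.interval j) (hk' : t' ∈ P.waiting k') : k = k' :=
  P.meets_at_most_one j k k' ⟨t, h, hk⟩ ⟨t', h', hk'⟩

theorem departure_strictMono : StrictMono P.departure := fun k k' h =>
  (P.departure_lt_arrival k k' h).trans (P.arrival_lt_departure k')

theorem arrival_mem_waiting (k : Fin r) : P.arrival k ∈ P.waiting k :=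
  ⟨le_rfl, (P.arrival_lt_departure k).le⟩

theorem departure_mem_waiting (k : Fin r) : P.departure k ∈ P.waiting k :=
  ⟨(P.arrival_lt_departure k).le, le_rfl⟩

theorem mem_segment {l : Fin (r + 1)} {j : Fin n} :
    j ∈ P.segment l ↔ (∀ k : Fin r, k.succ = l → P.departure k < P.launch j) ∧
      (∀ k : Fin r, k.castSucc = l → P.launch j ≤ P.departure k) := by
  simp [segment]

theorem exists_mem_segment (j : Fin n) : ∃ l, j ∈ P.segment l := by
  -- The segments opened by a station left before the launch, and segment `0`; the largest of them
  -- is the one sought.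
  set s : Finset (Fin (r + 1)) :=
    insert 0 ((Finset.univ.filter fun k : Fin r => P.departure k < P.launch j).image Fin.succ)
  have hs : s.Nonempty := ⟨0, by simp [s]⟩
  refine ⟨s.max' hs, P.mem_segment.mpr ⟨fun k hk => ?_, fun k hk => ?_⟩⟩
  · have := s.max'_mem hs
    rw [← hk] at this
    simp only [s, Finset.mem_insert, Finset.mem_image, Finset.mem_filter, Finset.mem_univ,
      true_and, Fin.succ_inj, exists_eq_right] at this
    exact this.resolve_left (Fin.succ_ne_zero k)
  · by_contra! hlt
    have hmem : k.succ ∈ s := by simp [s, hlt]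
    have := s.le_max' _ hmem
    rw [← hk] at this
    exact absurd (Fin.castSucc_lt_succ (i := k)) (not_lt.mpr this)

/-- Station `k` closes the earlier segment and `k'` opens the later one; they coincide when the
segments are adjacent. All comparisons between different segments go through these two departures.
-/
theorem exists_station_of_segment_lt {l l' : Fin (r + 1)} (h : l < l') {i j : Fin n}
    (hi : i ∈ P.segment l) (hj : j ∈ P.segment l') :
    ∃ k k' : Fin r, k.castSucc = l ∧ k'.succ = l' ∧ k ≤ k' ∧ P.launch i ≤ P.departure k ∧
      P.departure k' < P.launch j := by
  have hl : (l : ℕ) < r := by have := l'.2; have : (l : ℕ) < l' := h; omega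
  have hl' : (l' : ℕ) - 1 < r := by have := l'.2; have : (l : ℕ) < l' := h; omega
  have e : (⟨l, hl⟩ : Fin r).castSucc = l := rfl
  have e' : (⟨(l' : ℕ) - 1, hl'⟩ : Fin r).succ = l' := by
    apply Fin.ext
    have : (l : ℕ) < l' := h
    simp only [Fin.val_succ]
    omega
  refine ⟨_, _, e, e', ?_, (P.mem_segment.mp hi).2 _ e, (P.mem_segment.mp hj).1 _ e'⟩
  have : (l : ℕ) < l' := h
  rw [Fin.mk_le_mk]
  omega

theorem segment_unique {l l' : Fin (r + 1)} {j : Fin n} (h : j ∈ P.segment l)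
    (h' : j ∈ P.segment l') : l = l' := by
  rcases lt_trichotomy l l' with hl | hl | hl
  · obtain ⟨k, k', -, -, hk, h1, h2⟩ := P.exists_station_of_segment_lt hl h h'
    exact absurd (P.departure_strictMono.monotone hk) (by linarith)
  · exact hl
  · obtain ⟨k, k', -, -, hk, h1, h2⟩ := P.exists_station_of_segment_lt hl h' h
    exact absurd (P.departure_strictMono.monotone hk) (by linarith)

/-- If `j` were launched by an earlier departure, it would meet two waiting intervals. This makes
the segment condition in `left` and `right` redundant. -/
theorem mem_segment_castSucc {k : Fin r} {j : Fin n} {t : ℝ} (h : t ∈ P.interval j)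
    (hk : t ∈ P.waiting k) (hl : P.launch j ≤ P.departure k) : j ∈ P.segment k.castSucc := by
  refine P.mem_segment.mpr ⟨fun k' hk' => ?_, fun k' hk' => ?_⟩
  · by_contra! hc
    have hlt : k' < k := by
      rw [Fin.lt_def]; have := congrArg Fin.val hk'; simp at this; omega
    refine hlt.ne (P.meets_unique (t := P.departure k') (t' := t) ⟨hc, ?_⟩
      (P.departure_mem_waiting k') h hk)
    have h1 := P.departure_lt_arrival k' k hlt
    have h2 := hk.1
    have h3 := h.2
    linarith
  · rw [Fin.castSucc_injective r hk']; exact hl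

theorem mem_left {k : Fin r} {j : Fin n} :
    j ∈ P.left k ↔ P.launch j ≤ P.arrival k ∧ P.arrival k ≤ P.rendezvous j := by
  simp only [left, Finset.mem_filter, mem_interval, and_iff_right_iff_imp]
  exact fun h => P.mem_segment_castSucc h (P.arrival_mem_waiting k)
    (h.1.trans (P.arrival_lt_departure k).le)

theorem mem_right {k : Fin r} {j : Fin n} :
    j ∈ P.right k ↔ P.arrival k < P.launch j ∧ P.launch j ≤ P.departure k ∧
      P.departure k ≤ P.rendezvous j := by
  have := P.arrival_lt_departure k
  simp only [right, Finset.mem_filter, mem_interval, mem_left]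
  constructor
  · rintro ⟨-, h, h'⟩
    refine ⟨?_, h⟩
    by_contra! hc
    exact h' ⟨hc, by linarith [h.2]⟩
  · rintro ⟨h, h'⟩
    exact ⟨P.mem_segment_castSucc h' (P.departure_mem_waiting k) h'.1, h', fun hc =>
      absurd hc.1 (not_le.mpr h)⟩

theorem mem_ext {k : Fin r} {j : Fin n} : j ∈ P.ext k ↔ j ∈ P.left k ∨ j ∈ P.right k := by
  simp [ext]

theorem ext_subset_segment (k : Fin r) : P.ext k ⊆ P.segment k.castSucc :=
  Finset.union_subset (Finset.filter_subset _ _) (Finset.filter_subset _ _)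

theorem disjoint_left_right (k : Fin r) : Disjoint (P.left k) (P.right k) :=
  Finset.disjoint_left.mpr fun j h h' => by
    have h1 := (P.mem_left.mp h).1
    have h2 := (P.mem_right.mp h').1
    linarith

/-- An interval that meets the waiting interval without being contained in it must cover one of its
two ends. -/
theorem ext_of_not_disjoint {k : Fin r} {j : Fin n}
    (h : ¬ Disjoint (P.interval j) (P.waiting k)) : j ∈ P.ext k := by
  rw [disjoint_waiting_iff] at h
  push Not at h
  rw [mem_ext, mem_left, mem_right]
  by_cases h1 : P.launch j ≤ P.arrival k
  · exact Or.inl ⟨h1, h.1⟩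
  · push Not at h1
    refine Or.inr ⟨h1, h.2, ?_⟩
    by_contra! hc
    exact P.not_subset_waiting j k (Set.Icc_subset_Icc h1.le hc.le)

theorem rendezvous_lt_arrival {k : Fin r} {j : Fin n} (h : j ∈ P.segment k.castSucc)
    (h' : j ∉ P.ext k) : P.rendezvous j < P.arrival k := by
  have hd : Disjoint (P.interval j) (P.waiting k) := by
    by_contra hc
    exact h' (P.ext_of_not_disjoint hc)
  rw [disjoint_waiting_iff] at hd
  exact hd.resolve_right (not_lt.mpr ((P.mem_segment.mp h).2 k rfl))

theorem not_disjoint_of_mem {i j : Fin n} {t : ℝ} (hi : t ∈ P.interval i)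
    (hj : t ∈ P.interval j) : ¬ Disjoint (P.interval i) (P.interval j) :=
  fun h => Set.disjoint_left.mp h hi hj

theorem arrival_mem_of_left {k : Fin r} {j : Fin n} (h : j ∈ P.left k) :
    P.arrival k ∈ P.interval j := P.mem_left.mp h

theorem departure_mem_of_right {k : Fin r} {j : Fin n} (h : j ∈ P.right k) :
    P.departure k ∈ P.interval j := (P.mem_right.mp h).2

theorem card_le_omega {s : Finset (Fin n)}
    (h : ∀ i ∈ s, ∀ j ∈ s, i ≠ j → ¬ Disjoint (P.interval i) (P.interval j)) :
    s.card ≤ P.omega := by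
  refine SimpleGraph.IsClique.card_le_cliqueNum (G := P.conflictGraph) (t := s) (tc := ?_)
  intro i hi j hj hij
  exact P.adj_iff.mpr ⟨hij, h i hi j hj hij⟩

/-- All these neighbours contain the rendezvous time of `v`, so together with `v` they form a
clique. The strict inequality leaves a free colour among `ω`. -/
theorem card_lt_omega_of_rendezvous {s : Finset (Fin n)} {v : Fin n}
    (h : ∀ u ∈ s, P.conflictGraph.Adj u v ∧ P.rendezvous v ≤ P.rendezvous u) :
    s.card < P.omega := by
  have hv : v ∉ s := fun hv => (P.adj_iff.mp (h v hv).1).1 rfl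
  have key : ∀ u ∈ insert v s, P.rendezvous v ∈ P.interval u := by
    intro u hu
    rcases Finset.mem_insert.mp hu with rfl | hu
    · exact ⟨P.launch_le_rendezvous u, le_rfl⟩
    · obtain ⟨h1, h2⟩ := h u hu
      have h3 := (P.adj_iff.mp h1).2
      rw [disjoint_interval_iff] at h3
      push Not at h3
      exact ⟨h3.2, h2⟩
  have := P.card_le_omega (s := insert v s)
    fun i hi j hj _ => P.not_disjoint_of_mem (key i hi) (key j hj)
  rw [Finset.card_insert_of_notMem hv] at this
  omega

theorem budget_pos (j : Fin n) : 0 < P.budget := (P.cost_pos j).trans_le (P.cost_le_budget j)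

end Inst

/-- Fewer than `m` forbidden values leave a free one below `m`. -/
theorem exists_lt_forall_ne {ι : Type*} {s : Finset ι} {m : ℕ} (f : ι → ℕ) (h : s.card < m) :
    ∃ a < m, ∀ u ∈ s, f u ≠ a := by
  have hc : (s.image f).card < (Finset.range m).card := by
    rw [Finset.card_range]
    exact Finset.card_image_le.trans_lt h
  obtain ⟨a, ha, ha'⟩ := Finset.exists_mem_notMem_of_card_lt_card hc
  exact ⟨a, Finset.mem_range.mp ha, fun u hu he => ha' (Finset.mem_image.mpr ⟨u, hu, he⟩)⟩

theorem eq_range_of_downward_closed {s : Finset ℕ} (h : ∀ b ∈ s, ∀ a < b, a ∈ s) :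
    s = Finset.range s.card := by
  refine Finset.eq_of_subset_of_card_le (fun b hb => ?_) (by simp)
  have : Finset.range (b + 1) ⊆ s := fun a ha => by
    rcases Nat.lt_succ_iff_lt_or_eq.mp (Finset.mem_range.mp ha) with h' | rfl
    exacts [h b hb a h', hb]
  have := Finset.card_le_card this
  rw [Finset.card_range] at this
  exact Finset.mem_range.mpr this

/-! ### The colouring step -/

namespace Choices

variable {n r : ℕ} {c : Choices n r} {P : Inst n r}

/-- Discharges the guard in `ColorsLast`: the rule for the last segment can be obeyed. Colouring
goes from late to early rendezvous times. -/
theorem exists_proper (P : Inst n r) (s : Finset (Fin n)) :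
    ∃ f : Fin n → ℕ, (∀ j ∈ s, f j < P.omega) ∧
      ∀ i ∈ s, ∀ j ∈ s, P.conflictGraph.Adj i j → f i ≠ f j := by
  induction s using Finset.induction_on_min_value P.rendezvous with
  | empty => exact ⟨fun _ => 0, by simp, by simp⟩
  | insert v s hv hmin ih =>
    obtain ⟨f, hf1, hf2⟩ := ih
    obtain ⟨a, ha, ha'⟩ := exists_lt_forall_ne f
      (P.card_lt_omega_of_rendezvous (s := s.filter fun u => P.conflictGraph.Adj u v) (v := v)
        fun u hu => ⟨(Finset.mem_filter.mp hu).2, hmin u (Finset.mem_filter.mp hu).1⟩)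
    have hne : ∀ u ∈ s, u ≠ v := fun u hu he => hv (he ▸ hu)
    have hfv : ∀ u ∈ s, P.conflictGraph.Adj u v → f u ≠ a := fun u hu h =>
      ha' u (Finset.mem_filter.mpr ⟨hu, h⟩)
    refine ⟨Function.update f v a, ?_, ?_⟩
    · intro j hj
      rcases Finset.mem_insert.mp hj with rfl | hj
      · simpa using ha
      · rw [Function.update_of_ne (hne j hj)]; exact hf1 j hj
    · intro i hi j hj hij
      rcases Finset.mem_insert.mp hi with hiv | his <;>
        rcases Finset.mem_insert.mp hj with hjv | hjs
      · exact absurd (hiv.trans hjv.symm) hij.ne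
      · rw [hiv, Function.update_self, Function.update_of_ne (hne j hjs)]
        exact (hfv j hjs (hiv ▸ hij.symm)).symm
      · rw [hjv, Function.update_self, Function.update_of_ne (hne i his)]
        exact hfv i his (hjv ▸ hij)
      · rw [Function.update_of_ne (hne i his), Function.update_of_ne (hne j hjs)]
        exact hf2 i his j hjs hij

theorem IsRun.properLast (hc : c.IsRun P) : ProperLast P c.color :=
  hc.colors_last (exists_proper P _)

/-- The greedy rule is never stuck. The neighbours coloured before `v` end no earlier than `v`:
those in `ext` because `v` ends before the arrival, the others by the order of colouring. There are
fewer than `ω` of them. -/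
theorem ColorsSegment.colorAllowed {k : Fin r} (h : c.ColorsSegment P k) {v : Fin n}
    (hv : v ∈ P.segment k.castSucc) (hv' : v ∉ P.ext k) : c.ColorAllowed P k v (c.color v) := by
  have hvm : v ∈ P.segment k.castSucc \ P.ext k := Finset.mem_sdiff.mpr ⟨hv, hv'⟩
  refine h.greedy v hvm ?_
  have key : ((P.segment k.castSucc).filter fun u => P.conflictGraph.Adj u v ∧
      (u ∈ P.ext k ∨ c.colorRank u < c.colorRank v)).card < P.omega := by
    refine P.card_lt_omega_of_rendezvous (v := v) fun u hu => ?_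
    obtain ⟨hu, huv, hr⟩ := Finset.mem_filter.mp hu
    refine ⟨huv, ?_⟩
    have h1 := P.rendezvous_lt_arrival hv hv'
    by_cases hue : u ∈ P.ext k
    · rcases P.mem_ext.mp hue with h2 | h2
      · exact h1.le.trans (P.mem_left.mp h2).2
      · have h3 := P.mem_right.mp h2
        have h4 := P.launch_le_rendezvous u
        have h5 := P.arrival_lt_departure k
        linarith
    · by_contra! hlt
      have := h.rank_order v hvm u (Finset.mem_sdiff.mpr ⟨hu, hue⟩) hlt
      rcases hr with hr | hr
      · exact hue hr
      · omega
  obtain ⟨a, ha, ha'⟩ := exists_lt_forall_ne c.color key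
  refine ⟨a, lt_of_lt_of_le ha (le_max_left _ _), fun u hu huv hr => ?_⟩
  exact ha' u (Finset.mem_filter.mpr ⟨hu, huv, hr⟩)

theorem IsRun.color_lt (hc : c.IsRun P) {k : Fin r} {j : Fin n} (hj : j ∈ P.segment k.castSucc) :
    c.color j < max P.omega (c.z P k) := by
  by_cases hj' : j ∈ P.ext k
  · exact (hc.colors k).ext_lt j hj'
  · exact ((hc.colors k).colorAllowed hj hj').1

theorem IsRun.disjoint_of_color_eq (hc : c.IsRun P) {l : Fin (r + 1)} {i j : Fin n}
    (hi : i ∈ P.segment l) (hj : j ∈ P.segment l) (hij : i ≠ j) (he : c.color i = c.color j) :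
    Disjoint (P.interval i) (P.interval j) := by
  by_contra hd
  have hadj : P.conflictGraph.Adj i j := P.adj_iff.mpr ⟨hij, hd⟩
  induction l using Fin.lastCases with
  | last => exact hc.properLast.2 i hi j hj hadj he
  | cast k =>
    have hcol := hc.colors k
    by_cases hi' : i ∈ P.ext k <;> by_cases hj' : j ∈ P.ext k
    · rcases hcol.unmatched_ne i hi' j hj' he with h | h | h
      · exact hij h
      · exact hd ((hc.matching k).1.1 _ h).2.2.1
      · exact hd ((hc.matching k).1.1 _ h).2.2.1.symm
    · exact (hcol.colorAllowed hj hj').2 i hi hadj (Or.inl hi') he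
    · exact (hcol.colorAllowed hi hi').2 j hj hadj.symm (Or.inl hj') he.symm
    · have hne : c.colorRank i ≠ c.colorRank j := fun h => hij
        (hcol.rank_injOn (by simp [hi, hi']) (by simp [hj, hj']) h)
      rcases lt_or_gt_of_ne hne with h | h
      · exact (hcol.colorAllowed hj hj').2 i hi hadj (Or.inr h) he
      · exact (hcol.colorAllowed hi hi').2 j hj hadj.symm (Or.inr h) he.symm

/-! ### Packing -/

theorem mem_colorClass {l : Fin (r + 1)} {a : ℕ} {j : Fin n} :
    j ∈ c.colorClass P l a ↔ j ∈ P.segment l ∧ c.color j = a := by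
  simp [colorClass]

theorem mem_earlier {l : Fin (r + 1)} {i j : Fin n} :
    i ∈ c.earlier P l j ↔
      (i ∈ P.segment l ∧ c.color i = c.color j) ∧ c.packRank i < c.packRank j := by
  simp [earlier, mem_colorClass]

theorem earlier_trans {l : Fin (r + 1)} {i i' j : Fin n} (h : i' ∈ c.earlier P l i)
    (h' : i ∈ c.earlier P l j) : i' ∈ c.earlier P l j := by
  rw [mem_earlier] at *
  exact ⟨⟨h.1.1, h.1.2.trans h'.1.2⟩, h.2.trans h'.2⟩

theorem mem_openBlocks {l : Fin (r + 1)} {j : Fin n} {b : ℕ} :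
    b ∈ c.openBlocks P l j ↔ ∃ i ∈ c.earlier P l j, c.block i = b := by
  simp [openBlocks]

/-- Block indices are used without gaps, since a new block takes the number of open blocks as its
index. The induction along the packing order proves this together with the identification of
`openBlocks` with an initial segment. -/
theorem PacksSegment.exists_earlier {l : Fin (r + 1)} (h : c.PacksSegment P l) {j : Fin n}
    (hj : j ∈ P.segment l) {b : ℕ} (hb : b < c.block j) :
    ∃ i ∈ c.earlier P l j, c.block i = b := by
  induction hm : c.packRank j using Nat.strong_induction_on generalizing j b with
  | _ m ih =>
    subst hm
    by_cases hf : ∃ b ∈ c.openBlocks P l j, P.cost j ≤ c.capacityLeft P l j b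
    · obtain ⟨i, hi, hib⟩ := mem_openBlocks.mp (h.fits j hj hf).1
      have hi' := mem_earlier.mp hi
      obtain ⟨i', hi'', hb'⟩ := ih _ hi'.2 hi'.1.1 (by rw [hib]; exact hb) rfl
      exact ⟨i', earlier_trans hi'' hi, hb'⟩
    · have ho := h.opens j hj hf
      have hr := eq_range_of_downward_closed (s := c.openBlocks P l j) (by
        intro b hb a hab
        obtain ⟨i, hi, rfl⟩ := mem_openBlocks.mp hb
        have hi' := mem_earlier.mp hi
        obtain ⟨i', hi'', hb'⟩ := ih _ hi'.2 hi'.1.1 hab rfl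
        exact mem_openBlocks.mpr ⟨i', earlier_trans hi'' hi, hb'⟩)
      rw [← mem_openBlocks, hr, ← ho]
      exact Finset.mem_range.mpr hb

theorem PacksSegment.openBlocks_eq {l : Fin (r + 1)} (h : c.PacksSegment P l) (j : Fin n) :
    c.openBlocks P l j = Finset.range (c.openBlocks P l j).card := by
  refine eq_range_of_downward_closed fun b hb a hab => ?_
  obtain ⟨i, hi, rfl⟩ := mem_openBlocks.mp hb
  obtain ⟨i', hi', h'⟩ := h.exists_earlier (mem_earlier.mp hi).1.1 hab
  exact mem_openBlocks.mpr ⟨i', earlier_trans hi' hi, h'⟩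

/-- The deliveries in block `b` of colour `a`. -/
def blockSet (c : Choices n r) (P : Inst n r) (l : Fin (r + 1)) (a b : ℕ) : Finset (Fin n) :=
  (c.colorClass P l a).filter fun i => c.block i = b

theorem mem_blockSet {l : Fin (r + 1)} {a b : ℕ} {j : Fin n} :
    j ∈ c.blockSet P l a b ↔ (j ∈ P.segment l ∧ c.color j = a) ∧ c.block j = b := by
  simp [blockSet, mem_colorClass]

theorem PacksSegment.cost_le_capacityLeft {l : Fin (r + 1)} (h : c.PacksSegment P l) {j : Fin n}
    (hj : j ∈ P.segment l) : P.cost j ≤ c.capacityLeft P l j (c.block j) := by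
  by_cases hf : ∃ b ∈ c.openBlocks P l j, P.cost j ≤ c.capacityLeft P l j b
  · exact (h.fits j hj hf).2
  · have ho := h.opens j hj hf
    have hno : c.block j ∉ c.openBlocks P l j := by
      rw [h.openBlocks_eq, ← ho]; simp
    have : (c.earlier P l j).filter (fun i => c.block i = c.block j) = ∅ := by
      refine Finset.filter_eq_empty_iff.mpr fun i hi he => hno ?_
      exact mem_openBlocks.mpr ⟨i, hi, he⟩
    rw [capacityLeft, this, Finset.sum_empty, sub_zero]
    exact P.cost_le_budget j

/-- Capacity is checked at the last delivery packed into the block. -/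
theorem PacksSegment.sum_blockSet_le {l : Fin (r + 1)} (h : c.PacksSegment P l) {a b : ℕ}
    (hne : (c.blockSet P l a b).Nonempty) : ∑ i ∈ c.blockSet P l a b, P.cost i ≤ P.budget := by
  obtain ⟨j, hj, hmax⟩ := Finset.exists_max_image _ c.packRank hne
  have hj' := mem_blockSet.mp hj
  have key : c.blockSet P l a b =
      insert j ((c.earlier P l j).filter fun i => c.block i = c.block j) := by
    ext i
    rw [Finset.mem_insert, Finset.mem_filter, mem_earlier]
    constructor
    · intro hi
      have hi' := mem_blockSet.mp hi
      by_cases hij : i = j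
      · exact Or.inl hij
      · refine Or.inr ⟨⟨⟨hi'.1.1, hi'.1.2.trans hj'.1.2.symm⟩, ?_⟩, hi'.2.trans hj'.2.symm⟩
        refine lt_of_le_of_ne (hmax i hi) fun he => hij ?_
        exact h.rank_injOn a (mem_colorClass.mpr hi'.1) (mem_colorClass.mpr hj'.1) he
    · rintro (rfl | ⟨⟨hi, -⟩, hb⟩)
      · exact hj
      · exact mem_blockSet.mpr ⟨⟨hi.1, hi.2.trans hj'.1.2⟩, hb.trans hj'.2⟩
  rw [key, Finset.sum_insert]
  · have := h.cost_le_capacityLeft hj'.1.1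
    rw [capacityLeft] at this
    linarith
  · simp [mem_earlier]

/-- When `j` is packed, the only open block of its class holds just `i`, and `j` fits into it; the
rule forbids opening another one. -/
theorem PacksSegment.block_eq_of_first {l : Fin (r + 1)} (h : c.PacksSegment P l) {i j : Fin n}
    (hi : i ∈ P.segment l) (hj : j ∈ P.segment l) (hc : c.color i = c.color j)
    (hcost : P.cost i + P.cost j ≤ P.budget) (hlt : c.packRank i < c.packRank j)
    (hfirst : ∀ v ∈ c.colorClass P l (c.color i), v ≠ i → v ≠ j →
      c.packRank j < c.packRank v) : c.block i = c.block j := by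
  have hej : c.earlier P l j = {i} := by
    ext v
    rw [mem_earlier, Finset.mem_singleton]
    constructor
    · rintro ⟨hv, hr⟩
      by_contra hvi
      have hvj : v ≠ j := by rintro rfl; exact lt_irrefl _ hr
      have := hfirst v (mem_colorClass.mpr ⟨hv.1, hv.2.trans hc.symm⟩) hvi hvj
      omega
    · rintro rfl
      exact ⟨⟨hi, hc⟩, hlt⟩
  have ho : c.openBlocks P l j = {c.block i} := by simp [openBlocks, hej]
  have := (h.fits j hj ⟨c.block i, by simp [ho], by
    simp only [capacityLeft, hej, Finset.filter_singleton, if_true, Finset.sum_singleton]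
    linarith⟩).1
  rw [ho, Finset.mem_singleton] at this
  exact this.symm

theorem block_matched {k : Fin r} (hm : P.IsMatching k (c.matching k))
    (hcol : c.ColorsSegment P k) (hp : c.PacksSegment P k.castSucc) (hf : c.MatchedFirst P k)
    {e : Fin n × Fin n} (he : e ∈ c.matching k) :
    c.color e.1 = c.color e.2 ∧ c.block e.1 = c.block e.2 := by
  obtain ⟨h1, h2, hd, hcost⟩ := hm.1 e he
  have s1 : e.1 ∈ P.segment k.castSucc := (Finset.mem_filter.mp h1).1
  have s2 : e.2 ∈ P.segment k.castSucc := (Finset.mem_filter.mp h2).1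
  have hcol := hcol.matched_eq e he
  refine ⟨hcol, ?_⟩
  have hne : e.1 ≠ e.2 := fun h =>
    Finset.disjoint_left.mp (P.disjoint_left_right k) h1 (h ▸ h2)
  have hr : c.packRank e.1 ≠ c.packRank e.2 := fun h => hne
    (hp.rank_injOn _ (mem_colorClass.mpr ⟨s1, rfl⟩) (mem_colorClass.mpr ⟨s2, hcol.symm⟩) h)
  rcases lt_or_gt_of_ne hr with h | h
  · exact hp.block_eq_of_first s1 s2 hcol hcost h fun v hv hv1 hv2 => (hf e he v hv hv1 hv2).2
  · refine (hp.block_eq_of_first s2 s1 hcol.symm (by linarith) h fun v hv hv2 hv1 =>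
      (hf e he v ?_ hv1 hv2).1).symm
    rwa [hcol]

/-! ### Assignment of the blocks to drones -/

/-- The conclusion of the assignment rule. -/
def Assigned (c : Choices n r) (P : Inst n r) (l : Fin (r + 1)) : Prop :=
  (∀ j ∈ P.segment l, c.drone j ∈ c.available P l) ∧
    ∀ i ∈ P.segment l, ∀ j ∈ P.segment l,
      c.drone i = c.drone j ↔ c.color i = c.color j ∧ c.block i = c.block j

/-- Removing the right ends of the matching loses no value of `f`, since the left partner takes the
same value and is itself not a right end. -/
theorem card_image_le_of_matching {k : Fin r} {M : Finset (Fin n × Fin n)}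
    (hM : P.IsMatching k M) (f : Fin n → ℕ) (hf : ∀ e ∈ M, f e.1 = f e.2) :
    ((P.ext k).image f).card ≤ (P.ext k).card - M.card := by
  have hsub : M.image Prod.snd ⊆ P.ext k := by
    intro v hv
    obtain ⟨e, he, rfl⟩ := Finset.mem_image.mp hv
    exact P.mem_ext.mpr (Or.inr (hM.1 e he).2.1)
  have hcard : (M.image Prod.snd).card = M.card :=
    Finset.card_image_of_injOn fun e he e' he' h => hM.2 e he e' he' (Or.inr h)
  have : (P.ext k).image f ⊆ (P.ext k \ M.image Prod.snd).image f := by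
    intro d hd
    obtain ⟨j, hj, rfl⟩ := Finset.mem_image.mp hd
    by_cases hjm : j ∈ M.image Prod.snd
    · obtain ⟨e, he, rfl⟩ := Finset.mem_image.mp hjm
      refine Finset.mem_image.mpr ⟨e.1, Finset.mem_sdiff.mpr
        ⟨P.mem_ext.mpr (Or.inl (hM.1 e he).1), ?_⟩, hf e he⟩
      intro h
      obtain ⟨e', he', h'⟩ := Finset.mem_image.mp h
      exact Finset.disjoint_left.mp (P.disjoint_left_right k) (hM.1 e he).1
        (h' ▸ (hM.1 e' he').2.1)
    · exact Finset.mem_image.mpr ⟨j, Finset.mem_sdiff.mpr ⟨hj, hjm⟩, rfl⟩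
  refine (Finset.card_le_card this).trans (Finset.card_image_le.trans ?_)
  rw [Finset.card_sdiff_of_subset hsub, hcard]

theorem card_extDrones_le {k : Fin r} (hm : P.IsMatching k (c.matching k))
    (hcol : c.ColorsSegment P k) (hp : c.PacksSegment P k.castSucc) (hf : c.MatchedFirst P k)
    (h : c.Assigned P k.castSucc) : (c.extDrones P k).card ≤ c.z P k := by
  refine card_image_le_of_matching hm c.drone fun e he => ?_
  obtain ⟨h1, h2, -⟩ := hm.1 e he
  exact (h.2 _ (Finset.mem_filter.mp h1).1 _ (Finset.mem_filter.mp h2).1).mpr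
    (block_matched hm hcol hp hf he)

theorem available_zero (c : Choices n r) (P : Inst n r) :
    c.available P 0 = Finset.range (c.numDrones P) :=
  Finset.filter_true_of_mem fun _ _ k hk => absurd hk (Fin.succ_ne_zero k)

theorem available_succ (c : Choices n r) (P : Inst n r) (k : Fin r) :
    c.available P k.succ = Finset.range (c.numDrones P) \ c.extDrones P k := by
  ext d
  simp only [available, Finset.mem_filter, Finset.mem_sdiff, Fin.succ_inj, forall_eq]

theorem numBlocks_le_card_available_zero (c : Choices n r) (P : Inst n r) :
    c.numBlocks P 0 ≤ (c.available P 0).card := by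
  have hm : c.numBlocks P 0 ≤ Finset.univ.sup (c.numBlocks P) := Finset.le_sup (Finset.mem_univ _)
  rw [available_zero, Finset.card_range, numDrones]
  omega

/-- This is where the sum of the two maxima is needed: one pays for the blocks, the other for the
drones blocked by `ext`. -/
theorem numBlocks_le_card_available_succ {k : Fin r} (h : (c.extDrones P k).card ≤ c.z P k) :
    c.numBlocks P k.succ ≤ (c.available P k.succ).card := by
  have hm : c.numBlocks P k.succ ≤ Finset.univ.sup (c.numBlocks P) :=
    Finset.le_sup (Finset.mem_univ _)
  have h2 : c.z P k ≤ Finset.univ.sup (c.z P) := Finset.le_sup (Finset.mem_univ k)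
  have h3 := Finset.le_card_sdiff (c.extDrones P k) (Finset.range (c.numDrones P))
  rw [← available_succ, Finset.card_range] at h3
  have h4 : c.numDrones P = Finset.univ.sup (c.numBlocks P) + Finset.univ.sup (c.z P) := rfl
  omega

/-- The assignment rule is guarded by a count of available drones. The guard for a segment follows
from the conclusion for the preceding one, which bounds the drones that serve `ext`. -/
theorem IsRun.assigned (hc : c.IsRun P) (l : Fin (r + 1)) : c.Assigned P l := by
  induction l using Fin.induction with
  | zero => exact hc.assigns 0 (numBlocks_le_card_available_zero c P)
  | succ k ih =>
    exact hc.assigns k.succ (numBlocks_le_card_available_succ (card_extDrones_le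
      (hc.matching k).1 (hc.colors k) (hc.packs _) (hc.matched_first k) ih))

/-- If the intervals met, `i` would contain the departures from `k` and from `k'`. Then the stations
coincide, `i` lies in `ext`, and its drone was not available for the segment of `j`. -/
theorem IsRun.eq_segment_succ (hc : c.IsRun P) {l l' : Fin (r + 1)} (hl : l < l') {i j : Fin n}
    (hi : i ∈ P.segment l) (hj : j ∈ P.segment l') (hd : c.drone i = c.drone j) :
    Disjoint (P.interval i) (P.interval j) := by
  obtain ⟨k, k', hk, hk', hkk, h1, h2⟩ := P.exists_station_of_segment_lt hl hi hj
  have h0 := P.launch_le_rendezvous j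
  by_contra hcon
  rw [Inst.disjoint_interval_iff] at hcon
  push Not at hcon
  have hdk : P.departure k ≤ P.departure k' := P.departure_strictMono.monotone hkk
  have hki : P.departure k ∈ P.interval i := ⟨h1, by linarith⟩
  have hki' : P.departure k' ∈ P.interval i := ⟨by linarith, by linarith⟩
  have : k = k' := P.meets_unique hki (P.departure_mem_waiting k) hki' (P.departure_mem_waiting k')
  subst this
  have hext : i ∈ P.ext k := P.ext_of_not_disjoint
    (Set.not_disjoint_iff.mpr ⟨_, hki, P.departure_mem_waiting k⟩)
  have := ((hc.assigned l').1 j hj)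
  rw [available, Finset.mem_filter] at this
  exact this.2 k hk' (Finset.mem_image.mpr ⟨i, hext, hd⟩)

theorem IsRun.disjoint_of_drone_eq (hc : c.IsRun P) {i j : Fin n} (hij : i ≠ j)
    (hd : c.drone i = c.drone j) : Disjoint (P.interval i) (P.interval j) := by
  obtain ⟨l, hi⟩ := P.exists_mem_segment i
  obtain ⟨l', hj⟩ := P.exists_mem_segment j
  rcases lt_trichotomy l l' with hl | rfl | hl
  · exact hc.eq_segment_succ hl hi hj hd
  · exact hc.disjoint_of_color_eq hi hj hij (((hc.assigned l).2 i hi j hj).mp hd).1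
  · exact (hc.eq_segment_succ hl hj hi hd.symm).symm

theorem disjoint_waiting_of_swaps {j : Fin n} {k : Fin r} (hk : k ∈ c.swaps P (c.drone j)) :
    Disjoint (P.interval j) (P.waiting k) := by
  by_contra h
  rw [swaps, Finset.mem_filter] at hk
  exact hk.2.2 (Finset.mem_image.mpr ⟨j, P.ext_of_not_disjoint h, rfl⟩)

/-- For the battery it suffices that every delivery still charged at the launch of `j` lies in the
block of `j`: later segments have not begun, and earlier ones are followed by a completed swap. -/
theorem IsRun.feasible (hc : c.IsRun P) :
    P.FeasibleSolution (c.numDrones P) c.drone (c.swaps P) := by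
  refine ⟨fun j => ?_, fun d _ => ⟨?_, ?_, ?_⟩⟩
  · obtain ⟨l, hl⟩ := P.exists_mem_segment j
    have := (hc.assigned l).1 j hl
    rw [available, Finset.mem_filter] at this
    exact Finset.mem_range.mp this.1
  · intro i hi j hj hij
    exact hc.disjoint_of_drone_eq hij
      ((Finset.mem_filter.mp hi).2.trans (Finset.mem_filter.mp hj).2.symm)
  · intro j hj k hk
    refine disjoint_waiting_of_swaps (c := c) ?_
    rwa [(Finset.mem_filter.mp hj).2]
  · intro j hj
    obtain ⟨-, hjd⟩ := Finset.mem_filter.mp hj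
    obtain ⟨l, hl⟩ := P.exists_mem_segment j
    have hsum := (hc.packs l).sum_blockSet_le (a := c.color j) (b := c.block j)
      ⟨j, mem_blockSet.mpr ⟨⟨hl, rfl⟩, rfl⟩⟩
    rw [← Finset.add_sum_erase _ _ (mem_blockSet.mpr ⟨⟨hl, rfl⟩, rfl⟩ :
      j ∈ c.blockSet P l (c.color j) (c.block j))] at hsum
    rw [Inst.remaining, le_sub_iff_add_le]
    refine le_trans ?_ hsum
    refine add_le_add le_rfl (Finset.sum_le_sum_of_subset_of_nonneg ?_
      fun i _ _ => (P.cost_pos i).le)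
    intro i hi
    simp only [Finset.mem_filter, Finset.mem_univ, true_and] at hi
    obtain ⟨hid, hij, hno⟩ := hi
    have h0 := P.launch_le_rendezvous i
    obtain ⟨l', hl'⟩ := P.exists_mem_segment i
    have hne : i ≠ j := by
      rintro rfl
      linarith
    rcases lt_trichotomy l' l with h | h | h
    · exfalso
      obtain ⟨k, k', hk, hk', hkk, h1, h2⟩ := P.exists_station_of_segment_lt h hl' hl
      have hav := (hc.assigned l).1 j hl
      rw [available, Finset.mem_filter] at hav
      -- Station `k'` opens the segment of `j`. The drone has been used before and, being available
      -- for that segment, does not serve `ext` at `k'`; so it swaps there.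
      have hsw : k' ∈ c.swaps P d := by
        rw [swaps, Finset.mem_filter]
        refine ⟨Finset.mem_univ _, ⟨l', ?_, i, hl', hid⟩, hjd ▸ hav.2 k' hk'⟩
        rw [← hk]
        exact hkk
      refine hno k' hsw ⟨?_, h2⟩
      have hdis := disjoint_waiting_of_swaps (c := c) (j := i) (k := k') (by rwa [hid])
      rw [Inst.disjoint_waiting_iff] at hdis
      refine hdis.resolve_right (not_lt.mpr ?_)
      exact h1.trans (P.departure_strictMono.monotone hkk)
    · subst h
      refine Finset.mem_erase.mpr ⟨hne, mem_blockSet.mpr ?_⟩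
      have := ((hc.assigned l').2 i hl' j hl).mp (hid.trans hjd.symm)
      exact ⟨⟨hl', this.1⟩, this.2⟩
    · exfalso
      obtain ⟨k, k', hk, hk', hkk, h1, h2⟩ := P.exists_station_of_segment_lt h hl hl'
      have := P.departure_strictMono.monotone hkk
      linarith

end Choices

/-! ### Lower bounds for the optimum -/

namespace Inst

variable {n r : ℕ} (P : Inst n r)

theorem no_station_within_segment {l : Fin (r + 1)} {i j : Fin n} (hi : i ∈ P.segment l)
    (hj : j ∈ P.segment l) (k : Fin r) :
    ¬ (P.rendezvous i < P.arrival k ∧ P.departure k < P.launch j) := by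
  rintro ⟨h1, h2⟩
  have h3 := P.launch_le_rendezvous i
  have h4 := P.arrival_lt_departure k
  rcases lt_or_ge (k : ℕ) l with h | h
  · have hl : (l : ℕ) - 1 < r := by have := l.2; omega
    have e : (⟨(l : ℕ) - 1, hl⟩ : Fin r).succ = l := by
      apply Fin.ext
      simp only [Fin.val_succ]
      omega
    have hk : k ≤ ⟨(l : ℕ) - 1, hl⟩ := by rw [Fin.le_def]; simp only; omega
    have h5 := (P.mem_segment.mp hi).1 _ e
    have h6 := P.departure_strictMono.monotone hk
    linarith
  · have hl : (l : ℕ) < r := by have := k.2; omega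
    have e : (⟨l, hl⟩ : Fin r).castSucc = l := rfl
    have hk : ⟨l, hl⟩ ≤ k := by rw [Fin.le_def]; simp only; omega
    have h5 := (P.mem_segment.mp hj).2 _ e
    have h6 := P.departure_strictMono.monotone hk
    linarith

/-- At the launch of the last delivery of `A` all the others are completed and no swap has
intervened, so the battery has paid for all of them. -/
theorem FeasibleAssignment.sum_cost_le {S : Finset (Fin n)} {W : Finset (Fin r)}
    (h : P.FeasibleAssignment S W) {A : Finset (Fin n)} (hA : A ⊆ S) {l : Fin (r + 1)}
    (hl : A ⊆ P.segment l) (hne : A.Nonempty) : ∑ i ∈ A, P.cost i ≤ P.budget := by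
  obtain ⟨j, hj, hmax⟩ := Finset.exists_max_image _ P.launch hne
  have hb := h.within_budget j (hA hj)
  rw [remaining, le_sub_iff_add_le] at hb
  rw [← Finset.add_sum_erase _ _ hj]
  refine le_trans (add_le_add le_rfl (Finset.sum_le_sum_of_subset_of_nonneg ?_
      fun i _ _ => (P.cost_pos i).le)) hb
  intro i hi
  obtain ⟨hij, hi⟩ := Finset.mem_erase.mp hi
  refine Finset.mem_filter.mpr ⟨hA hi, ?_, fun k _ =>
    P.no_station_within_segment (hl hi) (hl hj) k⟩
  have hd := h.deliveries_compatible i (hA hi) j (hA hj) hij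
  rw [disjoint_interval_iff] at hd
  refine hd.resolve_right fun hlt => ?_
  have h1 := hmax i hi
  have h2 := P.launch_le_rendezvous j
  linarith

namespace FeasibleSolution

variable {P} {m : ℕ} {drone : Fin n → ℕ} {swaps : ℕ → Finset (Fin r)}

theorem sum_cost_le (h : P.FeasibleSolution m drone swaps) {d : ℕ} {A : Finset (Fin n)}
    (hA : ∀ i ∈ A, drone i = d) {l : Fin (r + 1)} (hl : A ⊆ P.segment l) (hne : A.Nonempty) :
    ∑ i ∈ A, P.cost i ≤ P.budget := by
  obtain ⟨j, hj⟩ := hne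
  exact (h.2 d (hA j hj ▸ h.1 j)).sum_cost_le P
    (fun i hi => Finset.mem_filter.mpr ⟨Finset.mem_univ _, hA i hi⟩) hl ⟨j, hj⟩

theorem disjoint_interval (h : P.FeasibleSolution m drone swaps) {i j : Fin n} (hij : i ≠ j)
    (hd : drone i = drone j) : Disjoint (P.interval i) (P.interval j) :=
  (h.2 _ (h.1 i)).deliveries_compatible i (by simp) j (by simp [hd]) hij

theorem card_le_of_injOn (h : P.FeasibleSolution m drone swaps) {s : Finset (Fin n)}
    (hs : ∀ i ∈ s, ∀ j ∈ s, drone i = drone j → i = j) : s.card ≤ m := by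
  rw [← Finset.card_range m]
  exact Finset.card_le_card_of_injOn drone (fun i _ => by simpa using h.1 i)
    fun i hi j hj => hs i hi j hj

theorem omega_le (h : P.FeasibleSolution m drone swaps) : P.omega ≤ m := by
  obtain ⟨s, hs⟩ := P.conflictGraph.exists_isNClique_cliqueNum
  rw [omega, ← hs.card_eq]
  refine h.card_le_of_injOn fun i hi j hj hd => ?_
  by_contra hij
  exact (P.adj_iff.mp (hs.isClique hi hj hij)).2 (h.disjoint_interval hij hd)

/-- The solution itself yields a matching `M`: left-right pairs served by one drone. Its size is at
most that of a maximum matching. -/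
theorem z_le (h : P.FeasibleSolution m drone swaps) {c : Choices n r} {k : Fin r}
    (hM : P.IsMaximumMatching k (c.matching k)) : c.z P k ≤ m := by
  set M := (P.left k ×ˢ P.right k).filter fun e => drone e.1 = drone e.2
  have hmem : ∀ e, e ∈ M ↔ (e.1 ∈ P.left k ∧ e.2 ∈ P.right k) ∧ drone e.1 = drone e.2 := by
    intro e
    simp [M]
  have hll : ∀ i ∈ P.left k, ∀ j ∈ P.left k, drone i = drone j → i = j := by
    intro i hi j hj hd
    by_contra hij
    exact P.not_disjoint_of_mem (P.arrival_mem_of_left hi) (P.arrival_mem_of_left hj)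
      (h.disjoint_interval hij hd)
  have hrr : ∀ i ∈ P.right k, ∀ j ∈ P.right k, drone i = drone j → i = j := by
    intro i hi j hj hd
    by_contra hij
    exact P.not_disjoint_of_mem (P.departure_mem_of_right hi) (P.departure_mem_of_right hj)
      (h.disjoint_interval hij hd)
  have hne : ∀ i ∈ P.left k, ∀ j ∈ P.right k, i ≠ j := fun i hi j hj he =>
    Finset.disjoint_left.mp (P.disjoint_left_right k) hi (he ▸ hj)
  have hMm : P.IsMatching k M := by
    refine ⟨fun e he => ?_, fun e he f hf hef => ?_⟩
    · obtain ⟨⟨h1, h2⟩, hd⟩ := (hmem e).mp he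
      refine ⟨h1, h2, h.disjoint_interval (hne _ h1 _ h2) hd, ?_⟩
      rw [← Finset.sum_pair (hne _ h1 _ h2) (f := P.cost)]
      refine h.sum_cost_le (d := drone e.2) (l := k.castSucc) ?_ ?_ (by simp)
      · simp [hd]
      · intro i hi
        rcases Finset.mem_insert.mp hi with rfl | hi
        · exact P.ext_subset_segment k (P.mem_ext.mpr (Or.inl h1))
        · rw [Finset.mem_singleton.mp hi]
          exact P.ext_subset_segment k (P.mem_ext.mpr (Or.inr h2))
    · obtain ⟨⟨h1, h2⟩, hd⟩ := (hmem e).mp he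
      obtain ⟨⟨h1', h2'⟩, hd'⟩ := (hmem f).mp hf
      rcases hef with hef | hef
      · exact Prod.ext hef (hrr _ h2 _ h2' (hd.symm.trans (hef ▸ hd')))
      · exact Prod.ext (hll _ h1 _ h1' (hd.trans (hef ▸ hd'.symm))) hef
  have h1 := hM.2 M hMm
  -- Without the right ends of `M`, the deliveries of `ext` are on distinct drones: two left ones
  -- share the arrival time, two right ones the departure time, and a mixed pair on one drone
  -- belongs to `M`.
  have h2 : (P.ext k \ M.image Prod.snd).card ≤ m := by
    refine h.card_le_of_injOn fun i hi j hj hd => ?_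
    obtain ⟨hi, hi'⟩ := Finset.mem_sdiff.mp hi
    obtain ⟨hj, hj'⟩ := Finset.mem_sdiff.mp hj
    rcases P.mem_ext.mp hi with hi | hi <;> rcases P.mem_ext.mp hj with hj | hj
    · exact hll i hi j hj hd
    · exact absurd (Finset.mem_image.mpr ⟨(i, j), (hmem _).mpr ⟨⟨hi, hj⟩, hd⟩, rfl⟩) hj'
    · exact absurd (Finset.mem_image.mpr ⟨(j, i), (hmem _).mpr ⟨⟨hj, hi⟩, hd.symm⟩, rfl⟩) hi'
    · exact hrr i hi j hj hd
  have h3 := Finset.le_card_sdiff (M.image Prod.snd) (P.ext k)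
  have h4 : (M.image Prod.snd).card ≤ M.card := Finset.card_image_le
  rw [Choices.z]
  omega

theorem sum_segment_le (h : P.FeasibleSolution m drone swaps) (l : Fin (r + 1))
    (hB : 0 ≤ P.budget) : ∑ j ∈ P.segment l, P.cost j ≤ m * P.budget := by
  rw [← Finset.sum_fiberwise_of_maps_to (t := Finset.range m) (g := drone)
    fun i _ => Finset.mem_range.mpr (h.1 i)]
  refine (Finset.sum_le_card_nsmul _ _ P.budget fun d _ => ?_).trans (by simp)
  rcases ((P.segment l).filter fun j => drone j = d).eq_empty_or_nonempty with he | hne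
  · rw [he]; simpa using hB
  · exact h.sum_cost_le (d := d) (fun i hi => (Finset.mem_filter.mp hi).2)
      (Finset.filter_subset _ _) hne

theorem card_segment_le (h : P.FeasibleSolution m drone swaps) (l : Fin (r + 1))
    (hbig : ∀ j, P.budget < 2 * P.cost j) : (P.segment l).card ≤ m := by
  refine h.card_le_of_injOn fun i hi j hj hd => ?_
  by_contra hij
  have := h.sum_cost_le (A := {i, j}) (d := drone j) (l := l) (by simp [hd])
    (by intro v hv; rcases Finset.mem_insert.mp hv with rfl | hv
        · exact hi
        · rwa [Finset.mem_singleton.mp hv]) (by simp)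
  rw [Finset.sum_pair hij] at this
  have h1 := hbig i
  have h2 := hbig j
  linarith

end FeasibleSolution

theorem iInf_cost_le (j : Fin n) : ⨅ j, P.cost j ≤ P.cost j :=
  ciInf_le (Set.finite_range _).bddBelow j

theorem le_iSup_cost (j : Fin n) : P.cost j ≤ ⨆ j, P.cost j :=
  le_ciSup (Set.finite_range _).bddAbove j

end Inst

/-! ### The number of blocks -/

namespace Choices

variable {n r : ℕ} {c : Choices n r} {P : Inst n r}

theorem PacksSegment.image_block {l : Fin (r + 1)} (h : c.PacksSegment P l) (a : ℕ) :
    (c.colorClass P l a).image c.block =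
      Finset.range ((c.colorClass P l a).image c.block).card := by
  refine eq_range_of_downward_closed fun b hb b' hb' => ?_
  obtain ⟨j, hj, rfl⟩ := Finset.mem_image.mp hb
  obtain ⟨hj, hja⟩ := mem_colorClass.mp hj
  obtain ⟨i, hi, hib⟩ := h.exists_earlier hj hb'
  have hi := (mem_earlier.mp hi).1
  exact Finset.mem_image.mpr ⟨i, mem_colorClass.mpr ⟨hi.1, hi.2.trans hja⟩, hib⟩

/-- The first delivery packed into block `b` did not fit into any block of lower index. Loads only
grow afterwards, so the inequality holds for the final loads. -/
theorem PacksSegment.exists_opener {l : Fin (r + 1)} (h : c.PacksSegment P l) {a b : ℕ}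
    (hb : (c.blockSet P l a b).Nonempty) :
    ∃ j ∈ c.blockSet P l a b, ∀ b' < b,
      P.budget < P.cost j + ∑ i ∈ c.blockSet P l a b', P.cost i := by
  obtain ⟨j, hj, hmin⟩ := Finset.exists_min_image _ c.packRank hb
  refine ⟨j, hj, fun b' hb' => ?_⟩
  obtain ⟨⟨hjs, hja⟩, hjb⟩ := mem_blockSet.mp hj
  have hnot : c.block j ∉ c.openBlocks P l j := by
    intro hm
    obtain ⟨i, hi, hib⟩ := mem_openBlocks.mp hm
    have hi' := mem_earlier.mp hi
    have := hmin i (mem_blockSet.mpr ⟨⟨hi'.1.1, hi'.1.2.trans hja⟩, hib.trans hjb⟩)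
    omega
  have hno : ¬ ∃ b ∈ c.openBlocks P l j, P.cost j ≤ c.capacityLeft P l j b :=
    fun hf => hnot (h.fits j hjs hf).1
  push Not at hno
  obtain ⟨i, hi, hib⟩ := h.exists_earlier hjs (hjb.symm ▸ hb' : b' < c.block j)
  have h1 := hno b' (mem_openBlocks.mpr ⟨i, hi, hib⟩)
  rw [capacityLeft] at h1
  have h2 : ∑ i ∈ (c.earlier P l j).filter (fun i => c.block i = b'), P.cost i ≤
      ∑ i ∈ c.blockSet P l a b', P.cost i := by
    refine Finset.sum_le_sum_of_subset_of_nonneg (fun i hi => ?_) fun i _ _ => (P.cost_pos i).le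
    obtain ⟨hi, hib⟩ := Finset.mem_filter.mp hi
    have hi := (mem_earlier.mp hi).1
    exact mem_blockSet.mpr ⟨⟨hi.1, hi.2.trans hja⟩, hib⟩
  linarith

/-- Loads `L 0, …, L t` of blocks, the last of which contains an item of cost `x` that fits in no
other block. -/
theorem sum_loads_ge {B E x y : ℝ} {t : ℕ} {L : ℕ → ℝ}
    (hxE : x ≤ E ∨ E = B / 2) (hy : y ≤ B / 2) (hyx : y ≤ x) (hxL : x ≤ L t)
    (hx : ∀ b < t, B < x + L b) (hpair : ∀ b < t, ∀ b' < b, B < L b + L b') :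
    t * (B - E) + y ≤ ∑ b ∈ Finset.range (t + 1), L b := by
  rw [Finset.sum_range_succ]
  -- If `x ≤ E`, each of the first `t` loads exceeds `B - E`, and the last load is at least `x ≥ y`.
  by_cases hxe : x ≤ E
  · have : ∑ b ∈ Finset.range t, L b ≥ t * (B - E) := by
      have := Finset.card_nsmul_le_sum (Finset.range t) L (B - E) fun b hb => by
        have := hx b (Finset.mem_range.mp hb)
        linarith
      simpa using this
    linarith
  · have hEB := hxE.resolve_left hxe
    push Not at hxe
    by_cases hall : ∀ b < t, B / 2 ≤ L b
    · have : ∑ b ∈ Finset.range t, L b ≥ t * (B - E) := by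
        have := Finset.card_nsmul_le_sum (Finset.range t) L (B - E) fun b hb => by
          have := hall b (Finset.mem_range.mp hb)
          linarith
        simpa using this
      linarith
    -- A load below `B / 2` occurs at most once among the first `t`, since two loads exceed `B`
    -- together. With the last block it exceeds `B`, which covers both `B / 2` and `y`; the other `t
    -- - 1` loads exceed `B / 2`.
    · push Not at hall
      obtain ⟨b₀, hb₀, hlt⟩ := hall
      have hmem : b₀ ∈ Finset.range t := Finset.mem_range.mpr hb₀
      rw [← Finset.add_sum_erase _ _ hmem]
      have := Finset.card_nsmul_le_sum ((Finset.range t).erase b₀) L (B / 2) fun b hb => by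
        obtain ⟨hbb, hb⟩ := Finset.mem_erase.mp hb
        rcases lt_or_gt_of_ne hbb with h | h
        · have := hpair b₀ hb₀ b h
          linarith
        · have := hpair b (Finset.mem_range.mp hb) b₀ h
          linarith
      rw [Finset.card_erase_of_mem hmem, Finset.card_range, nsmul_eq_mul,
        Nat.cast_sub (by omega : 1 ≤ t)] at this
      have h1 := hx b₀ hb₀
      push_cast at this
      rw [hEB]
      linarith

theorem PacksSegment.sum_class_ge {l : Fin (r + 1)} (h : c.PacksSegment P l) {a : ℕ}
    (hne : (c.colorClass P l a).Nonempty) {E : ℝ}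
    (hmax : (∀ j, P.cost j ≤ E) ∨ E = P.budget / 2) (hmin : ⨅ j, P.cost j ≤ P.budget / 2) :
    ((((c.colorClass P l a).image c.block).card : ℝ) - 1) * (P.budget - E) + ⨅ j, P.cost j ≤
      ∑ j ∈ c.colorClass P l a, P.cost j := by
  have himg := h.image_block a
  set N := ((c.colorClass P l a).image c.block).card with hN
  have hpos : 0 < N := Finset.card_pos.mpr (hne.image _)
  obtain ⟨t, ht⟩ : ∃ t, N = t + 1 := ⟨N - 1, by omega⟩
  rw [ht] at himg ⊢
  rw [← Finset.sum_fiberwise_of_maps_to (t := Finset.range (t + 1)) (g := c.block)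
    fun i hi => himg ▸ Finset.mem_image_of_mem _ hi]
  have hblock : ∀ b < t + 1, (c.blockSet P l a b).Nonempty := by
    intro b hb
    have : b ∈ (c.colorClass P l a).image c.block := by rw [himg]; exact Finset.mem_range.mpr hb
    obtain ⟨j, hj, hjb⟩ := Finset.mem_image.mp this
    exact ⟨j, mem_blockSet.mpr ⟨mem_colorClass.mp hj, hjb⟩⟩
  have hle : ∀ b, ∀ j ∈ c.blockSet P l a b, P.cost j ≤ ∑ i ∈ c.blockSet P l a b, P.cost i :=
    fun b j hj => Finset.single_le_sum (fun i _ => (P.cost_pos i).le) hj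
  obtain ⟨j, hj, hj'⟩ := h.exists_opener (hblock t (Nat.lt_succ_self t))
  have := sum_loads_ge (B := P.budget) (E := E) (x := P.cost j) (y := ⨅ j, P.cost j) (t := t)
    (L := fun b => ∑ i ∈ c.blockSet P l a b, P.cost i) (hmax.imp (fun h => h j) id)
    hmin (P.iInf_cost_le j) (hle t j hj) hj' (fun b hb b' hb' => by
      obtain ⟨i, hi, hi'⟩ := h.exists_opener (hblock b (by omega))
      have h1 := hi' b' hb'
      have h2 := hle b i hi
      linarith)
  push_cast
  rw [add_sub_cancel_right]
  exact this

theorem numBlocks_eq_sum (c : Choices n r) (P : Inst n r) (l : Fin (r + 1)) :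
    c.numBlocks P l = ∑ a ∈ (P.segment l).image c.color,
      ((c.colorClass P l a).image c.block).card := by
  rw [numBlocks, Finset.card_eq_sum_card_fiberwise (f := Prod.fst)
    (t := (P.segment l).image c.color)]
  · refine Finset.sum_congr rfl fun a _ => ?_
    refine Finset.card_bij' (fun x _ => x.2) (fun b _ => (a, b)) ?_ ?_ ?_ ?_
    · rintro ⟨x, b⟩ hx
      obtain ⟨hx, hxa⟩ := Finset.mem_filter.mp hx
      obtain ⟨j, hj, he⟩ := Finset.mem_image.mp hx
      rw [Prod.mk.injEq] at he
      exact Finset.mem_image.mpr ⟨j, mem_colorClass.mpr ⟨hj, he.1.trans hxa⟩, he.2⟩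
    · intro b hb
      obtain ⟨j, hj, he⟩ := Finset.mem_image.mp hb
      obtain ⟨hj, hja⟩ := mem_colorClass.mp hj
      exact Finset.mem_filter.mpr ⟨Finset.mem_image.mpr ⟨j, hj, by rw [hja, he]⟩, rfl⟩
    · rintro ⟨x, b⟩ hx
      exact Prod.ext (Finset.mem_filter.mp hx).2.symm rfl
    · intro b _
      rfl
  · rintro ⟨x, b⟩ hx
    obtain ⟨j, hj, he⟩ := Finset.mem_image.mp hx
    rw [Prod.mk.injEq] at he
    exact Finset.mem_image.mpr ⟨j, hj, he.1⟩

theorem IsRun.card_colors_le (hc : c.IsRun P) {m : ℕ} {drone : Fin n → ℕ}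
    {swaps : ℕ → Finset (Fin r)} (h : P.FeasibleSolution m drone swaps) (l : Fin (r + 1)) :
    ((P.segment l).image c.color).card ≤ m := by
  rw [← Finset.card_range m]
  refine Finset.card_le_card fun a ha => ?_
  obtain ⟨j, hj, rfl⟩ := Finset.mem_image.mp ha
  refine Finset.mem_range.mpr ?_
  have h1 := h.omega_le
  induction l using Fin.lastCases with
  | last => exact (hc.properLast.1 j hj).trans_le h1
  | cast k =>
    have h2 := hc.color_lt hj
    have h3 := h.z_le (hc.matching k)
    omega

/-- The lower bound on the cost of each class is summed over the classes and compared with the total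
cost of the segment. This needs a least cost of at most half the budget; the other case is a plain
count of deliveries. -/
theorem IsRun.numBlocks_le (hc : c.IsRun P) (hn : 0 < n) {m : ℕ} {drone : Fin n → ℕ}
    {swaps : ℕ → Finset (Fin r)} (h : P.FeasibleSolution m drone swaps) (l : Fin (r + 1)) :
    (c.numBlocks P l : ℝ) ≤ (2 + P.psi) * m := by
  have : Nonempty (Fin n) := ⟨⟨0, hn⟩⟩
  have hB := P.budget_pos ⟨0, hn⟩
  have hm : (0 : ℝ) ≤ m := Nat.cast_nonneg m
  set y := ⨅ j, P.cost j with hy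
  set x := ⨆ j, P.cost j with hx
  have hyB : y ≤ P.budget := (P.iInf_cost_le ⟨0, hn⟩).trans (P.cost_le_budget _)
  set E := min (P.budget / 2) x with hE
  have hEB : E ≤ P.budget / 2 := min_le_left _ _
  have hEd : 0 < P.budget - E := by linarith
  -- The factor `B` cancels, so that the estimate can be made with costs in place of ratios.
  have hpsi : P.psi = (E - y) / (P.budget - E) := by
    have h1 : P.epsMax = E / P.budget := by
      rw [Inst.epsMax, hE, ← min_div_div_right hB.le]
      congr 1
      field_simp
    have h2 : 1 - E / P.budget = (P.budget - E) / P.budget := by field_simp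
    rw [Inst.psi, h1, Inst.epsMin, ← hy, h2, ← sub_div, div_div_div_cancel_right₀ hB.ne']
  rcases le_or_gt y (P.budget / 2) with hsmall | hbig
  · have hmax : (∀ j, P.cost j ≤ E) ∨ E = P.budget / 2 := by
      rcases le_total x (P.budget / 2) with h' | h'
      · exact Or.inl fun j => by rw [hE, min_eq_right h']; exact P.le_iSup_cost j
      · exact Or.inr (min_eq_left h')
    set p := ((P.segment l).image c.color).card with hp
    have hpm : (p : ℝ) ≤ m := by exact_mod_cast hc.card_colors_le h l
    have hsum := h.sum_segment_le l hB.le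
    rw [← Finset.sum_fiberwise_of_maps_to (t := (P.segment l).image c.color) (g := c.color)
      fun i hi => Finset.mem_image_of_mem _ hi] at hsum
    have hclass := Finset.sum_le_sum (s := (P.segment l).image c.color) fun a ha =>
      (hc.packs l).sum_class_ge (a := a) (E := E) (by
        obtain ⟨j, hj, he⟩ := Finset.mem_image.mp ha
        exact ⟨j, mem_colorClass.mpr ⟨hj, he⟩⟩) hmax hsmall
    have key : ((c.numBlocks P l : ℝ) - p) * (P.budget - E) + p * y ≤ m * P.budget := by
      refine le_trans (le_of_eq ?_) (hclass.trans hsum)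
      rw [Finset.sum_add_distrib, ← Finset.sum_mul, Finset.sum_sub_distrib, numBlocks_eq_sum]
      push_cast
      simp [hp, hy]
    -- Both `E` and `y` are at most `B / 2`, so the coefficient is nonnegative and `p` may be
    -- replaced by `m`.
    have hpp : p * (P.budget - E - y) ≤ m * (P.budget - E - y) :=
      mul_le_mul_of_nonneg_right hpm (by linarith)
    rw [hpsi, show (2 + (E - y) / (P.budget - E)) * (m : ℝ) =
      (m * (2 * (P.budget - E) + (E - y))) / (P.budget - E) by field_simp, le_div_iff₀ hEd]
    linarith
  -- Here all costs exceed `B / 2`. The factor may be smaller than `2`, but `ψ ≥ -1` because `y ≤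
  -- B`.
  · have h1 : c.numBlocks P l ≤ m := Finset.card_image_le.trans
      (h.card_segment_le l fun j => by have := P.iInf_cost_le j; linarith)
    have h2 : (c.numBlocks P l : ℝ) ≤ m := by exact_mod_cast h1
    have hxy : y ≤ x := (P.iInf_cost_le ⟨0, hn⟩).trans (P.le_iSup_cost _)
    have hEe : E = P.budget / 2 := min_eq_left (by linarith)
    have h3 : (1 : ℝ) ≤ 2 + P.psi := by
      have : -1 ≤ P.psi := by
        rw [hpsi, le_div_iff₀ hEd]
        linarith
      linarith
    nlinarith

theorem IsRun.numDrones_le (hc : c.IsRun P) (hn : 0 < n) :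
    (c.numDrones P : ℝ) ≤ (3 + P.psi) * P.opt := by
  -- The optimum is attained because the run itself shows that the set of feasible drone numbers is
  -- nonempty.
  obtain ⟨drone, swaps, h⟩ : ∃ drone swaps, P.FeasibleSolution P.opt drone swaps :=
    Nat.sInf_mem (s := {m | ∃ drone swaps, P.FeasibleSolution m drone swaps})
      ⟨_, _, _, hc.feasible⟩
  obtain ⟨l, -, hl⟩ := Finset.exists_mem_eq_sup (Finset.univ : Finset (Fin (r + 1)))
    Finset.univ_nonempty (c.numBlocks P)
  have h1 := hc.numBlocks_le hn h l
  have h2 : Finset.univ.sup (c.z P) ≤ P.opt := Finset.sup_le fun k _ => h.z_le (hc.matching k)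
  have h3 : ((Finset.univ.sup (c.z P) : ℕ) : ℝ) ≤ P.opt := by exact_mod_cast h2
  rw [numDrones, hl]
  push_cast
  linarith

end Choices

/-! ### First-fit insertion into lists of groups -/

section FirstFit

variable {α β : Type}

/-- Put `v` into the first group that accepts it, or into a new group at the end. -/
def firstFit (ok : α → List α → Bool) (v : α) : List (List α) → List (List α)
  | [] => [[v]]
  | g :: gs => bif ok v g then (v :: g) :: gs else g :: firstFit ok v gs

/-- Insert the elements of a list by first fit, the last element first. -/
def firstFitAll (ok : α → List α → Bool) (init : List (List α)) : List α → List (List α)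
  | [] => init
  | v :: l => firstFit ok v (firstFitAll ok init l)

/-- The index of the first group that contains `j`. -/
def groupIndex (gs : List (List α)) (j : α) : ℕ := gs.findIdx fun g => decide (j ∈ g)

/-- The position of `j` in a list that is traversed from the end. -/
def rankIn (l : List α) (j : α) : ℕ := l.reverse.idxOf j

theorem firstFit_map (f : α → β) (ok : β → List β → Bool) (v : α) (gs : List (List α)) :
    firstFit ok (f v) (gs.map (List.map f)) =
      (firstFit (fun u g => ok (f u) (g.map f)) v gs).map (List.map f) := by
  induction gs with
  | nil => rfl
  | cons g gs ih =>
    simp only [List.map_cons, firstFit]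
    cases ok (f v) (g.map f) <;> simp [ih]

theorem firstFitAll_map (f : α → β) (ok : β → List β → Bool) (init : List (List α))
    (l : List α) :
    firstFitAll ok (init.map (List.map f)) (l.map f) =
      (firstFitAll (fun u g => ok (f u) (g.map f)) init l).map (List.map f) := by
  induction l with
  | nil => rfl
  | cons v l ih => simp only [List.map_cons, firstFitAll, ih, firstFit_map]

variable {ok : α → List α → Bool}

theorem firstFit_perm (ok : α → List α → Bool) (v : α) (gs : List (List α)) :
    (firstFit ok v gs).flatten.Perm (v :: gs.flatten) := by
  induction gs with
  | nil => simp [firstFit]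
  | cons g gs ih =>
    rw [firstFit]
    cases ok v g
    · simp only [cond_false, List.flatten_cons]
      exact (ih.append_left g).trans List.perm_middle
    · simp

theorem firstFitAll_perm (ok : α → List α → Bool) (init : List (List α)) (l : List α) :
    (firstFitAll ok init l).flatten.Perm (l ++ init.flatten) := by
  induction l with
  | nil => rfl
  | cons v l ih => exact (firstFit_perm ok v _).trans (ih.cons v)

theorem length_firstFit_le (ok : α → List α → Bool) (v : α) (gs : List (List α)) :
    (firstFit ok v gs).length ≤ gs.length + 1 := by
  induction gs with
  | nil => simp [firstFit]
  | cons g gs ih =>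
    rw [firstFit]
    cases ok v g <;> simp [ih]

theorem length_firstFitAll_le (ok : α → List α → Bool) (init : List (List α)) (l : List α) :
    (firstFitAll ok init l).length ≤ init.length + l.length := by
  induction l with
  | nil => rfl
  | cons v l ih =>
    have := length_firstFit_le ok v (firstFitAll ok init l)
    simp only [firstFitAll, List.length_cons]
    omega

theorem firstFitAll_append (ok : α → List α → Bool) (init : List (List α)) (l l' : List α) :
    firstFitAll ok init (l ++ l') = firstFitAll ok (firstFitAll ok init l') l := by
  induction l with
  | nil => rfl
  | cons v l ih => simp only [List.cons_append, firstFitAll, ih]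

theorem firstFit_forall {Q : List α → Prop} {v : α} (h1 : Q [v])
    (h2 : ∀ g, ok v g = true → Q g → Q (v :: g)) {gs : List (List α)} (h : ∀ g ∈ gs, Q g) :
    ∀ g ∈ firstFit ok v gs, Q g := by
  induction gs with
  | nil => simpa [firstFit] using h1
  | cons g gs ih =>
    rw [firstFit]
    simp only [List.mem_cons, forall_eq_or_imp] at h
    cases hok : ok v g
    · simp only [cond_false, List.mem_cons, forall_eq_or_imp]
      exact ⟨h.1, ih h.2⟩
    · simp only [cond_true, List.mem_cons, forall_eq_or_imp]
      exact ⟨h2 g hok h.1, h.2⟩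

theorem firstFitAll_forall {Q : List α → Prop} {l : List α} (h1 : ∀ v ∈ l, Q [v])
    (h2 : ∀ v ∈ l, ∀ g, ok v g = true → Q g → Q (v :: g)) {init : List (List α)}
    (h : ∀ g ∈ init, Q g) : ∀ g ∈ firstFitAll ok init l, Q g := by
  induction l with
  | nil => exact h
  | cons v l ih =>
    simp only [List.mem_cons, forall_eq_or_imp] at h1 h2
    exact firstFit_forall h1.1 h2.1 (ih h1.2 h2.2)

theorem firstFitAll_ne_nil {init : List (List α)} (h : ∀ g ∈ init, g ≠ []) (l : List α) :
    ∀ g ∈ firstFitAll ok init l, g ≠ [] :=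
  firstFitAll_forall (by simp) (by simp) h

theorem mem_getD_of_mem_flatten {gs : List (List α)} {j : α} (h : j ∈ gs.flatten) :
    j ∈ gs.getD (groupIndex gs j) [] := by
  obtain ⟨g, hg, hj⟩ := List.mem_flatten.mp h
  have hlt : groupIndex gs j < gs.length :=
    List.findIdx_lt_length_of_exists ⟨g, hg, by simpa using hj⟩
  rw [List.getD_eq_getElem _ _ hlt]
  exact of_decide_eq_true (List.findIdx_getElem (p := fun g => decide (j ∈ g)) (w := hlt))

theorem mem_flatten_of_mem_getD {gs : List (List α)} {j : α} {i : ℕ} (h : j ∈ gs.getD i []) :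
    j ∈ gs.flatten := by
  rcases lt_or_ge i gs.length with hi | hi
  · rw [List.getD_eq_getElem _ _ hi] at h
    exact List.mem_flatten.mpr ⟨_, List.getElem_mem hi, h⟩
  · rw [List.getD_eq_default _ _ hi] at h
    simp at h

theorem groupIndex_eq_of_mem {gs : List (List α)} (hn : gs.flatten.Nodup) {j : α} {i : ℕ}
    (h : j ∈ gs.getD i []) : groupIndex gs j = i := by
  induction gs generalizing i with
  | nil => simp at h
  | cons g gs ih =>
    rw [List.flatten_cons, List.nodup_append] at hn
    cases i with
    | zero =>
      have hj : j ∈ g := by simpa using h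
      simp [groupIndex, List.findIdx_cons, hj]
    | succ i =>
      have h' : j ∈ gs.getD i [] := by simpa using h
      have hj : j ∉ g := fun hj => hn.2.2 j hj j (mem_flatten_of_mem_getD h') rfl
      have := ih hn.2.1 h'
      rw [groupIndex] at this
      simp [groupIndex, List.findIdx_cons, hj, this]

theorem mem_getD_iff {gs : List (List α)} (hn : gs.flatten.Nodup) {j : α} {i : ℕ} :
    j ∈ gs.getD i [] ↔ j ∈ gs.flatten ∧ groupIndex gs j = i :=
  ⟨fun h => ⟨mem_flatten_of_mem_getD h, groupIndex_eq_of_mem hn h⟩,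
    fun h => h.2 ▸ mem_getD_of_mem_flatten h.1⟩

/-- Later insertions never move an element, so its final label is the one received on insertion. -/
theorem groupIndex_firstFit_of_ne {v w : α} (hvw : w ≠ v) {gs : List (List α)}
    (hw : w ∈ gs.flatten) : groupIndex (firstFit ok v gs) w = groupIndex gs w := by
  induction gs with
  | nil => simp at hw
  | cons g gs ih =>
    rw [firstFit]
    cases ok v g
    · by_cases hg : w ∈ g
      · simp [groupIndex, List.findIdx_cons, hg]
      · have := ih (by simpa [hg] using hw)
        rw [groupIndex, groupIndex] at this
        simp [groupIndex, List.findIdx_cons, hg, this]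
    · simp [groupIndex, List.findIdx_cons, hvw]

theorem groupIndex_firstFitAll {w : α} {l : List α} (hw : w ∉ l) {init : List (List α)}
    (hw' : w ∈ init.flatten) :
    groupIndex (firstFitAll ok init l) w = groupIndex init w := by
  induction l with
  | nil => rfl
  | cons v l ih =>
    simp only [List.mem_cons, not_or] at hw
    rw [firstFitAll, groupIndex_firstFit_of_ne hw.1, ih hw.2]
    exact (firstFitAll_perm ok init l).mem_iff.mpr (List.mem_append_right _ hw')

theorem groupIndex_firstFit_self {v : α} {gs : List (List α)} (hv : v ∉ gs.flatten) :
    groupIndex (firstFit ok v gs) v ≤ gs.length ∧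
      (∀ i < groupIndex (firstFit ok v gs) v, ok v (gs.getD i []) = false) ∧
      (groupIndex (firstFit ok v gs) v < gs.length →
        ok v (gs.getD (groupIndex (firstFit ok v gs) v) []) = true) := by
  induction gs with
  | nil => simp [firstFit, groupIndex, List.findIdx_cons]
  | cons g gs ih =>
    simp only [List.flatten_cons, List.mem_append, not_or] at hv
    obtain ⟨h1, h2, h3⟩ := ih hv.2
    rw [firstFit]
    cases hok : ok v g
    · have e : groupIndex (g :: firstFit ok v gs) v = groupIndex (firstFit ok v gs) v + 1 := by
        simp [groupIndex, List.findIdx_cons, hv.1]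
      rw [cond_false, e]
      refine ⟨by simpa using h1, fun i hi => ?_, fun hi => ?_⟩
      · cases i with
        | zero => simpa using hok
        | succ i => simpa using h2 i (by omega)
      · simpa using h3 (by simpa using hi)
    · have e : groupIndex ((v :: g) :: gs) v = 0 := by
        simp [groupIndex, List.findIdx_cons]
      rw [cond_true, e]
      exact ⟨Nat.zero_le _, by simp, fun _ => by simpa using hok⟩

/-- Groups grow at the head, so read from the end a group lists its elements in the order of
insertion. This is what puts matched pairs first in the packing order. -/
theorem getD_suffix_firstFit (ok : α → List α → Bool) (v : α) (gs : List (List α)) (i : ℕ) :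
    gs.getD i [] <:+ (firstFit ok v gs).getD i [] := by
  induction gs generalizing i with
  | nil => simp
  | cons g gs ih =>
    rw [firstFit]
    cases ok v g <;> cases i <;> simp
    simpa using ih _

theorem getD_suffix_firstFitAll (ok : α → List α → Bool) (init : List (List α)) (l : List α)
    (i : ℕ) : init.getD i [] <:+ (firstFitAll ok init l).getD i [] := by
  induction l with
  | nil => exact List.suffix_rfl
  | cons v l ih => exact ih.trans (getD_suffix_firstFit ok v _ i)

/-- The state of first fit just before the insertion of `v`. -/
theorem firstFitAll_spec {init : List (List α)} {l₁ l₂ : List α} {v : α}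
    (hn : ((l₁ ++ v :: l₂) ++ init.flatten).Nodup) {S : List (List α)}
    (hS : S = firstFitAll ok init l₂) {lab : α → ℕ}
    (hlab : lab = groupIndex (firstFitAll ok init (l₁ ++ v :: l₂))) :
    lab v ≤ S.length ∧ (∀ i < lab v, ok v (S.getD i []) = false) ∧
      (lab v < S.length → ok v (S.getD (lab v) []) = true) ∧
      ∀ i u, u ∈ S.getD i [] ↔ (u ∈ l₂ ∨ u ∈ init.flatten) ∧ lab u = i := by
  have hn' := hn
  rw [List.append_assoc, List.cons_append, List.nodup_append, List.nodup_cons] at hn'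
  obtain ⟨-, ⟨hv, hn2⟩, hdis⟩ := hn'
  have hperm := firstFitAll_perm ok init l₂
  rw [← hS] at hperm
  have hvS : v ∉ S.flatten := fun h => hv (hperm.mem_iff.mp h)
  have hlv : lab v = groupIndex (firstFit ok v S) v := by
    rw [hlab, firstFitAll_append, groupIndex_firstFitAll, firstFitAll, hS]
    · exact fun h => hdis v h v List.mem_cons_self rfl
    · exact (firstFit_perm ok v _).mem_iff.mpr List.mem_cons_self
  have hlu : ∀ u ∈ S.flatten, lab u = groupIndex S u := by
    intro u hu
    have hu' := hperm.mem_iff.mp hu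
    rw [hlab, firstFitAll_append, groupIndex_firstFitAll, firstFitAll, ← hS,
      groupIndex_firstFit_of_ne _ hu]
    · rintro rfl; exact hvS hu
    · exact fun h => hdis u h u (List.mem_cons_of_mem _ hu') rfl
    · refine (firstFit_perm ok v _).mem_iff.mpr (List.mem_cons_of_mem _ ?_)
      rwa [← hS]
  obtain ⟨h1, h2, h3⟩ := groupIndex_firstFit_self (ok := ok) hvS
  rw [← hlv] at h1 h2 h3
  refine ⟨h1, h2, h3, fun i u => ?_⟩
  rw [mem_getD_iff (hperm.nodup_iff.mpr hn2), hperm.mem_iff, List.mem_append]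
  constructor
  · rintro ⟨hu, rfl⟩
    exact ⟨hu, hlu u (hperm.mem_iff.mpr (List.mem_append.mpr hu))⟩
  · rintro ⟨hu, rfl⟩
    exact ⟨hu, (hlu u (hperm.mem_iff.mpr (List.mem_append.mpr hu))).symm⟩

theorem rankIn_injOn {l : List α} : Set.InjOn (rankIn l) {j | j ∈ l} := by
  intro i hi j hj h
  exact (List.idxOf_inj (by simpa using hi)).mp h

theorem rankIn_append_right {l₁ l₂ : List α} {i : α} (hi : i ∈ l₂) :
    rankIn (l₁ ++ l₂) i = rankIn l₂ i := by
  rw [rankIn, rankIn, List.reverse_append, List.idxOf_append_of_mem (by simpa using hi)]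

theorem rankIn_lt_length {l : List α} {i : α} (hi : i ∈ l) : rankIn l i < l.length := by
  rw [rankIn, ← List.length_reverse]
  exact List.idxOf_lt_length_iff.mpr (by simpa using hi)

theorem length_le_rankIn {l₁ l₂ : List α} {i : α} (hi : i ∉ l₂) :
    l₂.length ≤ rankIn (l₁ ++ l₂) i := by
  rw [rankIn, List.reverse_append, List.idxOf_append_of_notMem (by simpa using hi)]
  simp

theorem rankIn_lt_iff {l₁ l₂ : List α} {i j : α} (hn : (l₁ ++ j :: l₂).Nodup) :
    rankIn (l₁ ++ j :: l₂) i < rankIn (l₁ ++ j :: l₂) j ↔ i ∈ l₂ := by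
  have hj : j ∉ l₂ := (List.nodup_cons.mp (List.nodup_append.mp hn).2.1).1
  have e : l₁ ++ j :: l₂ = (l₁ ++ [j]) ++ l₂ := by simp
  have hj1 : rankIn (l₁ ++ j :: l₂) j = l₂.length := by
    refine le_antisymm ?_ (by rw [e]; exact length_le_rankIn hj)
    rw [rankIn_append_right List.mem_cons_self]
    have := rankIn_lt_length (l := j :: l₂) List.mem_cons_self
    rw [List.length_cons] at this
    omega
  rw [hj1, e]
  constructor
  · intro h
    by_contra hi
    have := length_le_rankIn (l₁ := l₁ ++ [j]) hi
    omega
  · intro h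
    rw [rankIn_append_right h]
    exact rankIn_lt_length h

end FirstFit

/-! ### First fit as a maximum matching algorithm -/

section GreedyMatching

variable {α : Type} {ok : α → List α → Bool}

theorem firstFit_cases (ok : α → List α → Bool) (v : α) (gs : List (List α)) :
    (∃ gs₁ g gs₂, gs = gs₁ ++ g :: gs₂ ∧ (∀ g' ∈ gs₁, ok v g' = false) ∧ ok v g = true ∧
      firstFit ok v gs = gs₁ ++ (v :: g) :: gs₂) ∨
    ((∀ g ∈ gs, ok v g = false) ∧ firstFit ok v gs = gs ++ [[v]]) := by
  induction gs with
  | nil => exact Or.inr ⟨by simp, rfl⟩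
  | cons g gs ih =>
    cases hok : ok v g
    · rcases ih with ⟨gs₁, g', gs₂, rfl, h1, h2, h3⟩ | ⟨h1, h2⟩
      · refine Or.inl ⟨g :: gs₁, g', gs₂, rfl, ?_, h2, by simp [firstFit, hok, h3]⟩
        simpa [hok] using h1
      · exact Or.inr ⟨by simpa [hok] using h1, by simp [firstFit, hok, h2]⟩
    · exact Or.inl ⟨[], g, gs, rfl, by simp, hok, by simp [firstFit, hok]⟩

/-- Applied to the right deliveries, which conflict pairwise. Insertion starts at the end of the
list, which reverses the order. -/
theorem firstFitAll_singletons {l : List α}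
    (h : ∀ u ∈ l, ∀ v ∈ l, ok u [v] = false) :
    firstFitAll ok [] l = l.reverse.map fun v => [v] := by
  induction l with
  | nil => rfl
  | cons u l ih =>
    have h' : ∀ u ∈ l, ∀ v ∈ l, ok u [v] = false := fun u hu v hv =>
      h u (List.mem_cons_of_mem _ hu) v (List.mem_cons_of_mem _ hv)
    rw [firstFitAll, ih h']
    rcases firstFit_cases ok u (l.reverse.map fun v => [v]) with
      ⟨gs₁, g, gs₂, he, -, h2, -⟩ | ⟨-, h2⟩
    · have hg : g ∈ l.reverse.map fun v => [v] := by rw [he]; simp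
      obtain ⟨v, hv, rfl⟩ := List.mem_map.mp hg
      rw [h u List.mem_cons_self v (List.mem_cons_of_mem _ (by simpa using hv))] at h2
      exact absurd h2 (by simp)
    · rw [h2]; simp

/-- Exchange step: a matching can be changed so that `u₀`, `v₀` become free, at the price of one
edge, when every other partner of `v₀` accepts every partner of `u₀`. -/
theorem exists_matching_avoiding {M : Finset (α × α)} {u₀ v₀ : α}
    (hinj : ∀ e ∈ M, ∀ f ∈ M, e.1 = f.1 ∨ e.2 = f.2 → e = f) :
    ∃ M' : Finset (α × α), M.card ≤ M'.card + 1 ∧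
      (∀ e ∈ M', ∀ f ∈ M', e.1 = f.1 ∨ e.2 = f.2 → e = f) ∧
      ∀ e ∈ M', e.1 ≠ u₀ ∧ e.2 ≠ v₀ ∧ (e ∈ M ∨ ((u₀, e.2) ∈ M ∧ (e.1, v₀) ∈ M)) := by
  set M₀ := M.filter fun e => ¬ (e.1 = u₀ ∨ e.2 = v₀) with hM₀
  set D := M.filter fun e => e.1 = u₀ ∨ e.2 = v₀ with hD
  have hcard : D.card + M₀.card = M.card := Finset.card_filter_add_card_filter_not _
  have hmem : ∀ e ∈ M₀, e ∈ M ∧ e.1 ≠ u₀ ∧ e.2 ≠ v₀ := by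
    intro e he
    obtain ⟨h1, h2⟩ := Finset.mem_filter.mp he
    push Not at h2
    exact ⟨h1, h2⟩
  rcases le_or_gt D.card 1 with h1 | h1
  · exact ⟨M₀, by omega, fun e he f hf => hinj e (hmem e he).1 f (hmem f hf).1,
      fun e he => ⟨(hmem e he).2.1, (hmem e he).2.2, Or.inl (hmem e he).1⟩⟩
  -- Two edges are lost, one at `u₀` and one at `v₀`; joining their other ends regains one.
  · have key : ∃ u₁ v₁, (u₀, v₁) ∈ M ∧ (u₁, v₀) ∈ M ∧ u₁ ≠ u₀ ∧ v₁ ≠ v₀ := by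
      obtain ⟨⟨x, y⟩, he, ⟨x', y'⟩, hf, hef⟩ := Finset.one_lt_card.mp h1
      obtain ⟨hM, he'⟩ := Finset.mem_filter.mp he
      obtain ⟨hN, hf'⟩ := Finset.mem_filter.mp hf
      have hx : x ≠ x' := fun h => hef (hinj _ hM _ hN (Or.inl h))
      have hy : y ≠ y' := fun h => hef (hinj _ hM _ hN (Or.inr h))
      simp only at he' hf'
      rcases he' with rfl | rfl <;> rcases hf' with rfl | rfl
      · exact absurd rfl hx
      · exact ⟨x', y, hM, hN, hx.symm, hy⟩
      · exact ⟨x, y', hN, hM, hx, hy.symm⟩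
      · exact absurd rfl hy
    obtain ⟨u₁, v₁, h2, h3, hu, hv⟩ := key
    have hDle : D.card ≤ 2 := by
      refine (Finset.card_le_card (t := {(u₀, v₁), (u₁, v₀)}) fun e he => ?_).trans
        Finset.card_le_two
      obtain ⟨he, he'⟩ := Finset.mem_filter.mp he
      rw [Finset.mem_insert, Finset.mem_singleton]
      exact he'.imp (fun h => hinj _ he _ h2 (Or.inl h)) fun h => hinj _ he _ h3 (Or.inr h)
    have hne : ∀ e ∈ M₀, e.1 ≠ u₁ ∧ e.2 ≠ v₁ := by
      intro e he
      obtain ⟨h4, h5, h6⟩ := hmem e he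
      refine ⟨fun h => h6 ?_, fun h => h5 ?_⟩
      · rw [hinj e h4 _ h3 (Or.inl h)]
      · rw [hinj e h4 _ h2 (Or.inr h)]
    refine ⟨insert (u₁, v₁) M₀, ?_, ?_, ?_⟩
    · rw [Finset.card_insert_of_notMem fun h => (hne _ h).1 rfl]
      omega
    · intro e he f hf hef
      rcases Finset.mem_insert.mp he with he' | he' <;>
        rcases Finset.mem_insert.mp hf with hf' | hf'
      · rw [he', hf']
      · subst he'
        exact absurd hef (not_or.mpr ⟨(hne f hf').1.symm, (hne f hf').2.symm⟩)
      · subst hf'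
        exact absurd hef (not_or.mpr (hne e he'))
      · exact hinj e (hmem e he').1 f (hmem f hf').1 hef
    · intro e he
      rcases Finset.mem_insert.mp he with rfl | he
      · exact ⟨hu, hv, Or.inr ⟨h2, h3⟩⟩
      · exact ⟨(hmem e he).2.1, (hmem e he).2.2, Or.inl (hmem e he).1⟩

/-- First fit computes a maximum matching between `l` and the singletons of `init` when an element
`u` of `l` accepts `v` iff `a u < b v` and `x u + x v ≤ B`: the elements of `l` are taken by
non-increasing `a`, those of `init` by non-increasing `x`. -/
theorem length_firstFitAll_add_card_le {Lf Rt : α → Prop} {a b x : α → ℝ} {B : ℝ}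
    (hLR : ∀ v, Lf v → ¬ Rt v)
    (hok : ∀ u v, Lf u → Rt v → (ok u [v] = true ↔ a u < b v ∧ x u + x v ≤ B))
    (hno : ∀ u g, Lf u → (∃ w ∈ g, Lf w) → ok u g = false)
    {l : List α} (hl : ∀ u ∈ l, Lf u) (hsort : l.Pairwise fun u v => a u ≤ a v)
    {init : List (List α)} (hinit : ∀ g ∈ init, (∃ v, Rt v ∧ g = [v]) ∨ ∃ w ∈ g, Lf w)
    (hpair : init.Pairwise fun g g' => ∀ v v', Rt v → Rt v' → g = [v] → g' = [v'] → x v' ≤ x v)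
    {M : Finset (α × α)} (hinj : ∀ e ∈ M, ∀ f ∈ M, e.1 = f.1 ∨ e.2 = f.2 → e = f)
    (hM : ∀ e ∈ M, e.1 ∈ l ∧ Rt e.2 ∧ [e.2] ∈ init ∧ a e.1 < b e.2 ∧ x e.1 + x e.2 ≤ B) :
    (firstFitAll ok init l).length + M.card ≤ init.length + l.length := by
  induction l using List.reverseRecOn generalizing init M with
  | nil =>
    have : M = ∅ := Finset.eq_empty_of_forall_notMem fun e he => by simpa using (hM e he).1
    simp [this, firstFitAll]
  | append_singleton l u₀ ih =>
    rw [firstFitAll_append, firstFitAll, firstFitAll, List.length_append, List.length_singleton]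
    have hl' : ∀ u ∈ l, Lf u := fun u hu => hl u (List.mem_append_left _ hu)
    have hu₀ : Lf u₀ := hl u₀ (by simp)
    rw [List.pairwise_append] at hsort
    rcases firstFit_cases ok u₀ init with ⟨gs₁, g, gs₂, he, h1, h2, h3⟩ | ⟨h1, h2⟩
    · obtain ⟨v₀, hv₀, rfl⟩ : ∃ v, Rt v ∧ g = [v] := by
        refine (hinit g (by simp [he])).resolve_right fun hw => ?_
        rw [hno u₀ g hu₀ hw] at h2
        exact absurd h2 (by simp)
      obtain ⟨M', hcard, hinj', hM'⟩ := exists_matching_avoiding (u₀ := u₀) (v₀ := v₀) hinj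
      have hacc := (hok u₀ v₀ hu₀ hv₀).mp h2
      rw [he, List.pairwise_append, List.pairwise_cons] at hpair
      obtain ⟨hp1, ⟨hp2, hp3⟩, hp4⟩ := hpair
      -- Groups before that of `v₀` were rejected and singletons after it have smaller `x`, so `v₀`
      -- is the largest element that `u₀` accepts.
      have hbest : ∀ v, Rt v → [v] ∈ init → a u₀ < b v → x u₀ + x v ≤ B → x v ≤ x v₀ := by
        intro v hv hvi hab hx
        rw [he, List.mem_append, List.mem_cons] at hvi
        rcases hvi with hvi | hvi | hvi
        · have := h1 _ hvi
          rw [(hok u₀ v hu₀ hv).mpr ⟨hab, hx⟩] at this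
          exact absurd this (by simp)
        · rw [List.singleton_inj] at hvi
          rw [hvi]
        · exact hp2 _ hvi v₀ v hv₀ hv rfl rfl
      have := ih (init := gs₁ ++ (u₀ :: [v₀]) :: gs₂) (M := M') hl' hsort.1 ?_ ?_ hinj' ?_
      · rw [h3, he]
        simp only [List.length_append, List.length_cons] at this ⊢
        omega
      · intro g hg
        rw [List.mem_append, List.mem_cons] at hg
        rcases hg with hg | rfl | hg
        · exact hinit g (by simp [he, hg])
        · exact Or.inr ⟨u₀, by simp, hu₀⟩
        · exact hinit g (by simp [he, hg])
      · rw [List.pairwise_append, List.pairwise_cons]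
        refine ⟨hp1, ⟨fun g _ v v' _ _ h => absurd h (by simp), hp3⟩, fun g hg g' hg' => ?_⟩
        rcases List.mem_cons.mp hg' with rfl | hg'
        · exact fun v v' _ _ _ h => absurd h (by simp)
        · exact hp4 g hg g' (List.mem_cons_of_mem _ hg')
      · intro e hem
        obtain ⟨h4, h5, h6⟩ := hM' e hem
        have hin : ∀ v, [v] ∈ init → v ≠ v₀ → [v] ∈ gs₁ ++ (u₀ :: [v₀]) :: gs₂ := by
          intro v hv hne
          rw [he] at hv
          simpa [hne] using hv
        have hll : ∀ u, u ∈ l ++ [u₀] → u ≠ u₀ → u ∈ l := by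
          intro u hu hne
          simpa [hne] using hu
        rcases h6 with h6 | ⟨h6, h7⟩
        · obtain ⟨q1, q2, q3, q4⟩ := hM e h6
          exact ⟨hll _ q1 h4, q2, hin _ q3 h5, q4⟩
        · obtain ⟨q1, q2, q3, q4, q5⟩ := hM _ h6
          obtain ⟨s1, s2, s3, s4, s5⟩ := hM _ h7
          simp only at q1 q2 q3 q4 q5 s1 s2 s3 s4 s5
          -- The new edge is admissible: `a e.1 ≤ a u₀ < b e.2` because `u₀` is taken first, and `x
          -- e.1 + x e.2 ≤ x e.1 + x v₀ ≤ B`.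
          have hle := hbest e.2 q2 q3 q4 q5
          have hle' := hsort.2.2 e.1 (hll _ s1 h4) u₀ (by simp)
          exact ⟨hll _ s1 h4, q2, hin _ q3 h5, by linarith, by linarith⟩
    -- No singleton is accepted, so `u₀` is unmatched in `M` as well. Its new group is inert, since
    -- a left element rejects every group that contains a left element.
    · have := ih (init := init ++ [[u₀]]) (M := M) hl' hsort.1 ?_ ?_ hinj ?_
      · rw [h2]
        simp only [List.length_append, List.length_cons, List.length_nil] at this ⊢
        omega
      · intro g hg
        rcases List.mem_append.mp hg with hg | hg
        · exact hinit g hg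
        · exact Or.inr ⟨u₀, by simp [List.mem_singleton.mp hg], hu₀⟩
      · rw [List.pairwise_append]
        refine ⟨hpair, by simp, fun g _ g' hg' v v' _ hv' _ h => ?_⟩
        rw [List.mem_singleton.mp hg', List.singleton_inj] at h
        exact absurd (h ▸ hv') (hLR u₀ hu₀)
      · intro e hem
        obtain ⟨q1, q2, q3, q4⟩ := hM e hem
        refine ⟨?_, q2, by simp [q3], q4⟩
        rcases List.mem_append.mp q1 with q1 | q1
        · exact q1
        · rw [List.mem_singleton.mp q1] at q4
          have := h1 _ q3
          rw [(hok u₀ e.2 hu₀ q2).mpr q4] at this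
          exact absurd this (by simp)

end GreedyMatching

/-! ### The treatment of one segment -/

/-- The index, the launch time, the rendezvous time and the cost of a delivery. -/
abbrev Item : Type := ℕ × ℝ × ℝ × ℝ

/-- The end of a segment: whether there is a station, its arrival and its departure time. -/
abbrev Stop : Type := Bool × ℝ × ℝ

def apart (x y : Item) : Bool := !decide (y.2.1 ≤ x.2.2.1) || !decide (x.2.1 ≤ y.2.2.1)

def okColor (x : Item) (g : List Item) : Bool := g.all (apart x)

def load (g : List Item) : ℝ := (g.map fun y => y.2.2.2).sum

def okPack (B : ℝ) (x : Item) (g : List Item) : Bool := decide (x.2.2.2 + load g ≤ B)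

def okMatch (B : ℝ) (x : Item) (g : List Item) : Bool := okColor x g && okPack B x g

def isLeft (s : Stop) (x : Item) : Bool :=
  s.1 && (decide (x.2.1 ≤ s.2.1) && decide (s.2.1 ≤ x.2.2.1))

/-- That the launch is not after the departure is left out, as it holds throughout the segment. -/
def isRight (s : Stop) (x : Item) : Bool :=
  s.1 && (!decide (x.2.1 ≤ s.2.1) && decide (s.2.2 ≤ x.2.2.1))

def isExt (s : Stop) (x : Item) : Bool := isLeft s x || isRight s x

def inSegment (s : Stop) (x : Item) : Bool := !s.1 || decide (x.2.1 ≤ s.2.2)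

theorem apart_iff {x y : Item} :
    apart x y = true ↔ x.2.2.1 < y.2.1 ∨ y.2.2.1 < x.2.1 := by
  simp [apart]

theorem isLeft_iff {s : Stop} {x : Item} :
    isLeft s x = true ↔ s.1 = true ∧ x.2.1 ≤ s.2.1 ∧ s.2.1 ≤ x.2.2.1 := by
  simp [isLeft]

theorem isRight_iff {s : Stop} {x : Item} :
    isRight s x = true ↔ s.1 = true ∧ s.2.1 < x.2.1 ∧ s.2.2 ≤ x.2.2.1 := by
  simp [isRight]

theorem inSegment_iff {s : Stop} {x : Item} :
    inSegment s x = true ↔ (s.1 = true → x.2.1 ≤ s.2.2) := by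
  cases h : s.1 <;> simp [inSegment, h]

section Algorithm

variable {α : Type} (ρ : α → Item) (B : ℝ) (s : Stop)

def sortBy (key : α → ℝ) (l : List α) : List α := l.insertionSort fun a b => key a ≤ key b

/-- Insertion starts at the end: right deliveries by decreasing cost, then left deliveries by
decreasing rendezvous time if `L` is sorted by rendezvous times. This is the order required by the
greedy matching. -/
def extList (L : List α) : List α :=
  L.filter (fun j => isLeft s (ρ j)) ++
    sortBy (fun j => (ρ j).2.2.2) (L.filter fun j => isRight s (ρ j))

def restList (L : List α) : List α := L.filter fun j => !isExt s (ρ j)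

def matchGroups (L : List α) : List (List α) :=
  firstFitAll (fun j g => okMatch B (ρ j) (g.map ρ)) [] (extList ρ s L)

def colorGroups (L : List α) : List (List α) :=
  firstFitAll (fun j g => okColor (ρ j) (g.map ρ)) (matchGroups ρ B s L) (restList ρ s L)

def packGroup (g : List α) : List (List α) :=
  firstFitAll (fun j b => okPack B (ρ j) (b.map ρ)) [] g

def segmentBlocks (L : List α) : List (List α) :=
  (colorGroups ρ B s L).flatMap (packGroup ρ B)

end Algorithm

theorem sortBy_perm {α : Type} (key : α → ℝ) (l : List α) : (sortBy key l).Perm l :=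
  List.perm_insertionSort _ _

theorem sortBy_pairwise {α : Type} (key : α → ℝ) (l : List α) :
    (sortBy key l).Pairwise fun a b => key a ≤ key b := by
  have : Std.Total fun a b : α => key a ≤ key b := ⟨fun a b => le_total _ _⟩
  have : IsTrans α fun a b : α => key a ≤ key b := ⟨fun a b c => le_trans⟩
  exact List.pairwise_insertionSort _ _

namespace Inst

variable {n r : ℕ} (P : Inst n r)

/-- The key counts downwards to agree with `enumerate`. -/
def item (j : Fin n) : Item := (n - 1 - j, P.launch j, P.rendezvous j, P.cost j)

/-- With the flag `false`, nothing is left or right and everything is in the segment; the two zeros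
do not influence any test. -/
def stopOf (l : Fin (r + 1)) : Stop :=
  if h : (l : ℕ) < r then (true, P.arrival ⟨l, h⟩, P.departure ⟨l, h⟩) else (false, 0, 0)

theorem stopOf_castSucc (k : Fin r) :
    P.stopOf k.castSucc = (true, P.arrival k, P.departure k) := by
  simp [stopOf]

theorem stopOf_last : P.stopOf (Fin.last r) = (false, 0, 0) := by
  simp [stopOf]

theorem apart_item (i j : Fin n) :
    apart (P.item i) (P.item j) = true ↔ Disjoint (P.interval i) (P.interval j) := by
  rw [disjoint_interval_iff, apart_iff]
  rfl

theorem okColor_item (v : Fin n) (g : List (Fin n)) :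
    okColor (P.item v) (g.map P.item) = true ↔
      ∀ w ∈ g, Disjoint (P.interval v) (P.interval w) := by
  simp [okColor, List.all_eq_true, apart_item]

theorem load_item (g : List (Fin n)) : load (g.map P.item) = (g.map P.cost).sum := by
  simp [load, item, Function.comp_def]

theorem okPack_item (v : Fin n) (g : List (Fin n)) :
    okPack P.budget (P.item v) (g.map P.item) = true ↔
      P.cost v + (g.map P.cost).sum ≤ P.budget := by
  rw [okPack, load_item, decide_eq_true_iff]
  rfl

theorem okMatch_item (v : Fin n) (g : List (Fin n)) :
    okMatch P.budget (P.item v) (g.map P.item) = true ↔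
      (∀ w ∈ g, Disjoint (P.interval v) (P.interval w)) ∧
        P.cost v + (g.map P.cost).sum ≤ P.budget := by
  rw [okMatch, Bool.and_eq_true, okColor_item, okPack_item]

/-- `L` lists the deliveries of segment `l` by non-decreasing rendezvous times. -/
structure Lists (l : Fin (r + 1)) (L : List (Fin n)) : Prop where
  nodup : L.Nodup
  mem_iff : ∀ j, j ∈ L ↔ j ∈ P.segment l
  sorted : L.Pairwise fun i j => P.rendezvous i ≤ P.rendezvous j

namespace Lists

variable {P} {l : Fin (r + 1)} {k : Fin r} {L : List (Fin n)}

theorem isLeft_item_iff {j : Fin n} :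
    isLeft (P.stopOf k.castSucc) (P.item j) = true ↔ j ∈ P.left k := by
  rw [stopOf_castSucc, mem_left, isLeft_iff]
  simp [item]

theorem isRight_item_iff (h : P.Lists k.castSucc L) {j : Fin n} (hj : j ∈ L) :
    isRight (P.stopOf k.castSucc) (P.item j) = true ↔ j ∈ P.right k := by
  have := (P.mem_segment.mp ((h.mem_iff j).mp hj)).2 k rfl
  rw [stopOf_castSucc, mem_right, DDP.isRight_iff]
  simp [item, this]

theorem isExt_iff (h : P.Lists k.castSucc L) {j : Fin n} (hj : j ∈ L) :
    isExt (P.stopOf k.castSucc) (P.item j) = true ↔ j ∈ P.ext k := by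
  rw [isExt, Bool.or_eq_true, isLeft_item_iff, h.isRight_item_iff hj, mem_ext]

theorem mem_lefts (h : P.Lists k.castSucc L) {j : Fin n} :
    j ∈ L.filter (fun j => isLeft (P.stopOf k.castSucc) (P.item j)) ↔ j ∈ P.left k := by
  rw [List.mem_filter, isLeft_item_iff, h.mem_iff, and_iff_right_iff_imp]
  exact fun hj => (Finset.mem_filter.mp hj).1

theorem mem_rights (h : P.Lists k.castSucc L) {j : Fin n} :
    j ∈ sortBy (fun j => (P.item j).2.2.2)
      (L.filter fun j => isRight (P.stopOf k.castSucc) (P.item j)) ↔ j ∈ P.right k := by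
  rw [(sortBy_perm _ _).mem_iff, List.mem_filter]
  constructor
  · exact fun hj => (h.isRight_item_iff hj.1).mp hj.2
  · intro hj
    have hjL := (h.mem_iff j).mpr (Finset.mem_filter.mp hj).1
    exact ⟨hjL, (h.isRight_item_iff hjL).mpr hj⟩

theorem mem_extList (h : P.Lists k.castSucc L) {j : Fin n} :
    j ∈ extList P.item (P.stopOf k.castSucc) L ↔ j ∈ P.ext k := by
  rw [extList, List.mem_append, h.mem_lefts, h.mem_rights, mem_ext]

theorem nodup_extList (h : P.Lists k.castSucc L) :
    (extList P.item (P.stopOf k.castSucc) L).Nodup := by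
  rw [extList, List.nodup_append]
  refine ⟨h.nodup.filter _, (sortBy_perm _ _).nodup_iff.mpr (h.nodup.filter _), ?_⟩
  rintro i hi j hj rfl
  exact Finset.disjoint_left.mp (P.disjoint_left_right k) (h.mem_lefts.mp hi) (h.mem_rights.mp hj)

theorem extList_last (L : List (Fin n)) : extList P.item (P.stopOf (Fin.last r)) L = [] := by
  have h1 : ∀ j, isLeft (P.stopOf (Fin.last r)) (P.item j) = false := by
    simp [stopOf_last, isLeft]
  have h2 : ∀ j, isRight (P.stopOf (Fin.last r)) (P.item j) = false := by
    simp [stopOf_last, isRight]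
  simp [extList, h1, h2, sortBy]

theorem restList_last (L : List (Fin n)) : restList P.item (P.stopOf (Fin.last r)) L = L := by
  simp [restList, stopOf_last, isExt, isLeft, isRight]

theorem mem_restList (h : P.Lists k.castSucc L) {j : Fin n} :
    j ∈ restList P.item (P.stopOf k.castSucc) L ↔ j ∈ P.segment k.castSucc ∧ j ∉ P.ext k := by
  rw [restList, List.mem_filter, h.mem_iff]
  refine and_congr_right fun hj => ?_
  rw [← h.isExt_iff ((h.mem_iff j).mpr hj)]
  simp

theorem matchGroups_perm :
    (matchGroups P.item P.budget (P.stopOf k.castSucc) L).flatten.Perm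
      (extList P.item (P.stopOf k.castSucc) L) := by
  simpa [matchGroups] using
    firstFitAll_perm (fun j g => okMatch P.budget (P.item j) (g.map P.item)) []
      (extList P.item (P.stopOf k.castSucc) L)

theorem mem_matchGroups (h : P.Lists k.castSucc L) {j : Fin n} :
    j ∈ (matchGroups P.item P.budget (P.stopOf k.castSucc) L).flatten ↔ j ∈ P.ext k := by
  rw [matchGroups_perm.mem_iff, h.mem_extList]

theorem nodup_matchGroups (h : P.Lists k.castSucc L) :
    (matchGroups P.item P.budget (P.stopOf k.castSucc) L).flatten.Nodup :=
  matchGroups_perm.nodup_iff.mpr h.nodup_extList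

theorem nodup_restList (h : P.Lists l L) : (restList P.item (P.stopOf l) L).Nodup :=
  h.nodup.filter _

theorem nodup_all (h : P.Lists l L) :
    (restList P.item (P.stopOf l) L ++
      (matchGroups P.item P.budget (P.stopOf l) L).flatten).Nodup := by
  induction l using Fin.lastCases with
  | last =>
    rw [matchGroups, extList_last, restList_last]
    simpa [firstFitAll] using h.nodup
  | cast k =>
    rw [List.nodup_append]
    refine ⟨h.nodup_restList, h.nodup_matchGroups, ?_⟩
    rintro i hi j hj rfl
    exact (h.mem_restList.mp hi).2 (h.mem_matchGroups.mp hj)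

theorem colorGroups_perm (h : P.Lists l L) :
    (colorGroups P.item P.budget (P.stopOf l) L).flatten.Perm L := by
  refine (firstFitAll_perm _ _ _).trans ((List.perm_ext_iff_of_nodup h.nodup_all h.nodup).mpr
    fun j => ?_)
  rw [List.mem_append]
  induction l using Fin.lastCases with
  | last =>
    rw [matchGroups, extList_last, restList_last]
    simp [firstFitAll]
  | cast k =>
    rw [h.mem_restList, h.mem_matchGroups, h.mem_iff]
    have := P.ext_subset_segment k
    constructor
    · rintro (hj | hj)
      exacts [hj.1, this hj]
    · intro hj
      by_cases hj' : j ∈ P.ext k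
      exacts [Or.inr hj', Or.inl ⟨hj, hj'⟩]

theorem nodup_colorGroups (h : P.Lists l L) :
    (colorGroups P.item P.budget (P.stopOf l) L).flatten.Nodup :=
  h.colorGroups_perm.nodup_iff.mpr h.nodup

theorem mem_colorGroups (h : P.Lists l L) {j : Fin n} {a : ℕ} :
    j ∈ (colorGroups P.item P.budget (P.stopOf l) L).getD a [] ↔
      j ∈ P.segment l ∧ groupIndex (colorGroups P.item P.budget (P.stopOf l) L) j = a := by
  rw [mem_getD_iff h.nodup_colorGroups, h.colorGroups_perm.mem_iff, h.mem_iff]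

theorem groupIndex_ext (h : P.Lists k.castSucc L) {j : Fin n} (hj : j ∈ P.ext k) :
    groupIndex (colorGroups P.item P.budget (P.stopOf k.castSucc) L) j =
      groupIndex (matchGroups P.item P.budget (P.stopOf k.castSucc) L) j :=
  groupIndex_firstFitAll (fun hr => (h.mem_restList.mp hr).2 hj) (h.mem_matchGroups.mpr hj)

/-! #### The matching -/

theorem matchGroups_spec (g : List (Fin n))
    (hg : g ∈ matchGroups P.item P.budget (P.stopOf l) L) :
    (g.Pairwise fun i j => Disjoint (P.interval i) (P.interval j)) ∧
      (g.map P.cost).sum ≤ P.budget := by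
  refine firstFitAll_forall (Q := fun g => (g.Pairwise fun i j =>
    Disjoint (P.interval i) (P.interval j)) ∧ (g.map P.cost).sum ≤ P.budget)
    (fun v _ => ?_) (fun v _ g hok hg => ?_) (by simp) g hg
  · simpa using P.cost_le_budget v
  · rw [okMatch_item] at hok
    rw [List.pairwise_cons, List.map_cons, List.sum_cons]
    exact ⟨⟨hok.1, hg.1⟩, hok.2⟩

theorem matched_spec (h : P.Lists k.castSucc L) {u v : Fin n} (huv : u ≠ v) (hu : u ∈ P.ext k)
    (hv : v ∈ P.ext k)
    (he : groupIndex (matchGroups P.item P.budget (P.stopOf k.castSucc) L) u =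
      groupIndex (matchGroups P.item P.budget (P.stopOf k.castSucc) L) v) :
    Disjoint (P.interval u) (P.interval v) ∧ P.cost u + P.cost v ≤ P.budget := by
  set G := matchGroups P.item P.budget (P.stopOf k.castSucc) L with hG
  have hu' := mem_getD_of_mem_flatten (h.mem_matchGroups.mpr hu)
  have hv' := mem_getD_of_mem_flatten (h.mem_matchGroups.mpr hv)
  rw [← hG] at hu' hv'
  rw [← he] at hv'
  have hlt : groupIndex G u < G.length := by
    by_contra hc
    rw [List.getD_eq_default _ _ (not_lt.mp hc)] at hu'
    simp at hu'
  rw [List.getD_eq_getElem _ _ hlt] at hu' hv'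
  have hmem : G[groupIndex G u] ∈ G := List.getElem_mem hlt
  obtain ⟨h1, h2⟩ := matchGroups_spec _ hmem
  refine ⟨?_, ?_⟩
  · have : Std.Symm fun i j => Disjoint (P.interval i) (P.interval j) := ⟨fun _ _ h => h.symm⟩
    exact h1.forall hu' hv' huv
  · refine le_trans ?_ h2
    have hnd : (G[groupIndex G u]).Nodup :=
      (List.nodup_flatten.mp h.nodup_matchGroups).1 _ hmem
    rw [← List.sum_toFinset _ hnd, ← Finset.sum_pair huv]
    refine Finset.sum_le_sum_of_subset_of_nonneg (fun i hi => ?_) fun i _ _ => (P.cost_pos i).le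
    rcases Finset.mem_insert.mp hi with rfl | hi
    · simpa using hu'
    · rw [Finset.mem_singleton.mp hi]; simpa using hv'

end Lists

end Inst

/-! ### The matching read off from the groups is maximum -/

namespace Inst

variable {n r : ℕ} (P : Inst n r)

/-- The pairs of deliveries that are put into one group. -/
def pairing (k : Fin r) (L : List (Fin n)) : Finset (Fin n × Fin n) :=
  (P.left k ×ˢ P.right k).filter fun e =>
    groupIndex (matchGroups P.item P.budget (P.stopOf k.castSucc) L) e.1 =
      groupIndex (matchGroups P.item P.budget (P.stopOf k.castSucc) L) e.2

variable {P}

theorem mem_pairing {k : Fin r} {L : List (Fin n)} {e : Fin n × Fin n} :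
    e ∈ P.pairing k L ↔ (e.1 ∈ P.left k ∧ e.2 ∈ P.right k) ∧
      groupIndex (matchGroups P.item P.budget (P.stopOf k.castSucc) L) e.1 =
        groupIndex (matchGroups P.item P.budget (P.stopOf k.castSucc) L) e.2 := by
  simp [pairing]

namespace Lists

variable {l : Fin (r + 1)} {k : Fin r} {L : List (Fin n)}

theorem left_injOn (h : P.Lists k.castSucc L) {u v : Fin n} (hu : u ∈ P.left k)
    (hv : v ∈ P.left k)
    (he : groupIndex (matchGroups P.item P.budget (P.stopOf k.castSucc) L) u =
      groupIndex (matchGroups P.item P.budget (P.stopOf k.castSucc) L) v) : u = v := by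
  by_contra huv
  exact P.not_disjoint_of_mem (P.arrival_mem_of_left hu) (P.arrival_mem_of_left hv)
    (h.matched_spec huv (P.mem_ext.mpr (Or.inl hu)) (P.mem_ext.mpr (Or.inl hv)) he).1

theorem right_injOn (h : P.Lists k.castSucc L) {u v : Fin n} (hu : u ∈ P.right k)
    (hv : v ∈ P.right k)
    (he : groupIndex (matchGroups P.item P.budget (P.stopOf k.castSucc) L) u =
      groupIndex (matchGroups P.item P.budget (P.stopOf k.castSucc) L) v) : u = v := by
  by_contra huv
  exact P.not_disjoint_of_mem (P.departure_mem_of_right hu) (P.departure_mem_of_right hv)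
    (h.matched_spec huv (P.mem_ext.mpr (Or.inr hu)) (P.mem_ext.mpr (Or.inr hv)) he).1

theorem isMatching_pairing (h : P.Lists k.castSucc L) : P.IsMatching k (P.pairing k L) := by
  refine ⟨fun e he => ?_, fun e he f hf hef => ?_⟩
  · obtain ⟨⟨h1, h2⟩, h3⟩ := mem_pairing.mp he
    have hne : e.1 ≠ e.2 := fun h =>
      Finset.disjoint_left.mp (P.disjoint_left_right k) h1 (h ▸ h2)
    exact ⟨h1, h2, h.matched_spec hne (P.mem_ext.mpr (Or.inl h1)) (P.mem_ext.mpr (Or.inr h2)) h3⟩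
  · obtain ⟨⟨h1, h2⟩, h3⟩ := mem_pairing.mp he
    obtain ⟨⟨h1', h2'⟩, h3'⟩ := mem_pairing.mp hf
    rcases hef with hef | hef
    · exact Prod.ext hef (h.right_injOn h2 h2' (h3.symm.trans (hef ▸ h3')))
    · exact Prod.ext (h.left_injOn h1 h1' (h3.trans (hef ▸ h3'.symm))) hef

/-- With `M` arbitrary this says that first fit merges at least as many pairs as any matching has.
It instantiates the greedy theorem with `a` the rendezvous time, `b` the launch time and `x` the
cost. -/
theorem length_add_card_le (h : P.Lists k.castSucc L) {M : Finset (Fin n × Fin n)}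
    (hM : P.IsMatching k M) :
    (matchGroups P.item P.budget (P.stopOf k.castSucc) L).length + M.card ≤ (P.ext k).card := by
  have hcard : (P.ext k).card = (extList P.item (P.stopOf k.castSucc) L).length := by
    rw [← List.toFinset_card_of_nodup h.nodup_extList]
    congr 1
    ext j
    rw [List.mem_toFinset, h.mem_extList]
  have hlefts := fun j => h.mem_lefts (j := j)
  have hrights := fun j => h.mem_rights (j := j)
  rw [hcard, matchGroups]
  unfold extList
  set X := L.filter (fun j => isLeft (P.stopOf k.castSucc) (P.item j)) with hX
  set Y := sortBy (fun j => (P.item j).2.2.2)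
      (L.filter fun j => isRight (P.stopOf k.castSucc) (P.item j)) with hY
  have hsing : firstFitAll (fun j g => okMatch P.budget (P.item j) (g.map P.item)) [] Y =
      Y.reverse.map fun v => [v] := by
    refine firstFitAll_singletons fun u hu v hv => ?_
    rw [Bool.eq_false_iff, Ne, okMatch_item]
    rintro ⟨hd, -⟩
    exact P.not_disjoint_of_mem (P.departure_mem_of_right ((hrights u).mp hu))
      (P.departure_mem_of_right ((hrights v).mp hv)) (hd v (by simp))
  rw [firstFitAll_append, hsing, List.length_append]
  have := length_firstFitAll_add_card_le
    (ok := fun j g => okMatch P.budget (P.item j) (g.map P.item)) (Lf := fun j => j ∈ P.left k)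
    (Rt := fun j => j ∈ P.right k) (a := P.rendezvous) (b := P.launch) (x := P.cost)
    (B := P.budget) (l := X) (init := Y.reverse.map fun v => [v]) (M := M)
    (fun v hv hv' => Finset.disjoint_left.mp (P.disjoint_left_right k) hv hv') ?_ ?_
    (fun u hu => (hlefts u).mp hu) ?_ ?_ ?_ hM.2 ?_
  · simp only [List.length_map, List.length_reverse] at this
    omega
  · intro u v hu hv
    rw [okMatch_item]
    simp only [List.mem_singleton, forall_eq, List.map_cons, List.map_nil,
      List.sum_cons, List.sum_nil, add_zero, disjoint_interval_iff]
    -- A left delivery is launched by the arrival and a right one ends after it, so disjointness can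
    -- only mean that the left one ends first.
    refine and_congr_left fun _ => or_iff_left ?_
    have h1 := P.mem_left.mp hu
    have h2 := P.mem_right.mp hv
    have h3 := P.launch_le_rendezvous v
    rw [not_lt]
    linarith
  · rintro u g hu ⟨w, hw, hw'⟩
    rw [Bool.eq_false_iff, Ne, okMatch_item]
    rintro ⟨hd, -⟩
    exact P.not_disjoint_of_mem (P.arrival_mem_of_left hu) (P.arrival_mem_of_left hw') (hd w hw)
  · exact h.sorted.sublist List.filter_sublist
  · intro g hg
    obtain ⟨v, hv, rfl⟩ := List.mem_map.mp hg
    exact Or.inl ⟨v, (hrights v).mp (by simpa using hv), rfl⟩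
  · rw [List.pairwise_map, List.pairwise_reverse]
    refine (sortBy_pairwise _ _).imp ?_
    intro i j hij v v' _ _ hv hv'
    rw [List.singleton_inj] at hv hv'
    subst hv hv'
    exact hij
  · intro e he
    obtain ⟨h1, h2, h3, h4⟩ := hM.1 e he
    refine ⟨(hlefts _).mpr h1, h2, ?_, ?_, h4⟩
    · exact List.mem_map.mpr ⟨e.2, by simpa using (hrights _).mpr h2, rfl⟩
    · rw [disjoint_interval_iff] at h3
      refine h3.resolve_right ?_
      have h1 := P.mem_left.mp h1
      have h2 := P.mem_right.mp h2
      have h3 := P.launch_le_rendezvous e.2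
      rw [not_lt]
      linarith

theorem groupIndex_lt (h : P.Lists k.castSucc L) {j : Fin n} (hj : j ∈ P.ext k) :
    groupIndex (matchGroups P.item P.budget (P.stopOf k.castSucc) L) j <
      (matchGroups P.item P.budget (P.stopOf k.castSucc) L).length := by
  have := mem_getD_of_mem_flatten (h.mem_matchGroups.mpr hj)
  by_contra hc
  rw [List.getD_eq_default _ _ (not_lt.mp hc)] at this
  simp at this

theorem pair_of_groupIndex_eq (h : P.Lists k.castSucc L) {i j : Fin n} (hi : i ∈ P.ext k)
    (hj : j ∈ P.ext k)
    (he : groupIndex (matchGroups P.item P.budget (P.stopOf k.castSucc) L) i =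
      groupIndex (matchGroups P.item P.budget (P.stopOf k.castSucc) L) j) :
    i = j ∨ (i, j) ∈ P.pairing k L ∨ (j, i) ∈ P.pairing k L := by
  rcases P.mem_ext.mp hi with hi | hi <;> rcases P.mem_ext.mp hj with hj | hj
  · exact Or.inl (h.left_injOn hi hj he)
  · exact Or.inr (Or.inl (mem_pairing.mpr ⟨⟨hi, hj⟩, he⟩))
  · exact Or.inr (Or.inr (mem_pairing.mpr ⟨⟨hj, hi⟩, he.symm⟩))
  · exact Or.inl (h.right_injOn hi hj he)

/-- A group holds at most one left and one right delivery, so after removal of the matched right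
ends the rest lies in distinct groups. -/
theorem card_le_length_add (h : P.Lists k.castSucc L) :
    (P.ext k).card ≤
      (matchGroups P.item P.budget (P.stopOf k.castSucc) L).length + (P.pairing k L).card := by
  have h1 : (P.ext k \ (P.pairing k L).image Prod.snd).card ≤
      (matchGroups P.item P.budget (P.stopOf k.castSucc) L).length := by
    rw [← Finset.card_range (matchGroups P.item P.budget (P.stopOf k.castSucc) L).length]
    refine Finset.card_le_card_of_injOn
      (groupIndex (matchGroups P.item P.budget (P.stopOf k.castSucc) L))
      (fun j hj => ?_) fun i hi j hj he => ?_
    · simpa using h.groupIndex_lt (Finset.mem_sdiff.mp hj).1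
    · obtain ⟨hi, hi'⟩ := Finset.mem_sdiff.mp hi
      obtain ⟨hj, hj'⟩ := Finset.mem_sdiff.mp hj
      rcases h.pair_of_groupIndex_eq hi hj he with h | h | h
      · exact h
      · exact absurd (Finset.mem_image.mpr ⟨_, h, rfl⟩) hj'
      · exact absurd (Finset.mem_image.mpr ⟨_, h, rfl⟩) hi'
  have h2 := Finset.le_card_sdiff ((P.pairing k L).image Prod.snd) (P.ext k)
  have h3 : ((P.pairing k L).image Prod.snd).card ≤ (P.pairing k L).card := Finset.card_image_le
  omega

theorem isMaximumMatching (h : P.Lists k.castSucc L) :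
    P.IsMaximumMatching k (P.pairing k L) := by
  refine ⟨h.isMatching_pairing, fun M hM => ?_⟩
  have h1 := h.length_add_card_le hM
  have h2 := h.card_le_length_add
  omega

theorem length_matchGroups (h : P.Lists k.castSucc L) :
    (matchGroups P.item P.budget (P.stopOf k.castSucc) L).length =
      (P.ext k).card - (P.pairing k L).card := by
  have h1 := h.length_add_card_le h.isMatching_pairing
  have h2 := h.card_le_length_add
  omega

end Lists

end Inst

/-! ### First fit obeys the rules for colouring and packing -/

namespace Choices

variable {n r : ℕ} {c : Choices n r} {P : Inst n r} {l : Fin (r + 1)} {k : Fin r}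
  {L : List (Fin n)}

/-- The choices `c` follow the first-fit algorithm in segment `l`. -/
structure Follows (c : Choices n r) (P : Inst n r) (l : Fin (r + 1)) (L : List (Fin n)) : Prop where
  color_eq : ∀ j ∈ P.segment l,
    c.color j = groupIndex (colorGroups P.item P.budget (P.stopOf l) L) j
  colorRank_eq : ∀ j ∈ P.segment l,
    c.colorRank j = rankIn (restList P.item (P.stopOf l) L) j
  packRank_eq : ∀ j ∈ P.segment l, c.packRank j =
    rankIn ((colorGroups P.item P.budget (P.stopOf l) L).getD (c.color j) []) j
  block_eq : ∀ j ∈ P.segment l, c.block j = groupIndex (packGroup P.item P.budget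
    ((colorGroups P.item P.budget (P.stopOf l) L).getD (c.color j) [])) j

namespace Follows

theorem mem_getD_iff (hf : c.Follows P l L) (h : P.Lists l L) {j : Fin n} {a : ℕ} :
    j ∈ (colorGroups P.item P.budget (P.stopOf l) L).getD a [] ↔
      j ∈ P.segment l ∧ c.color j = a := by
  rw [h.mem_colorGroups]
  exact and_congr_right fun hj => by rw [hf.color_eq j hj]

/-- The colours on `ext` are the indices of the matching groups, of which there are exactly `z`; the
remaining deliveries are inserted by first fit on top of them. -/
theorem colorsSegment (hf : c.Follows P k.castSucc L) (h : P.Lists k.castSucc L)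
    (hm : c.matching k = P.pairing k L) : c.ColorsSegment P k := by
  have hseg : ∀ {j}, j ∈ P.ext k → j ∈ P.segment k.castSucc := fun hj => P.ext_subset_segment k hj
  have hcol : ∀ j ∈ P.ext k, c.color j =
      groupIndex (matchGroups P.item P.budget (P.stopOf k.castSucc) L) j := fun j hj => by
    rw [hf.color_eq j (hseg hj), h.groupIndex_ext hj]
  refine ⟨fun j hj => ?_, fun e he => ?_, fun i hi j hj he => ?_, fun i hi j hj he => ?_,
    fun i hi j hj hlt => ?_, fun v hv hex => ?_⟩
  · refine lt_max_of_lt_right ?_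
    rw [z, hm, ← h.length_matchGroups, hcol j hj]
    exact h.groupIndex_lt hj
  · rw [hm] at he
    obtain ⟨⟨h1, h2⟩, h3⟩ := Inst.mem_pairing.mp he
    rw [hcol _ (P.mem_ext.mpr (Or.inl h1)), hcol _ (P.mem_ext.mpr (Or.inr h2)), h3]
  · rw [hcol i hi, hcol j hj] at he
    rw [hm]
    exact h.pair_of_groupIndex_eq hi hj he
  · have hi' : i ∈ P.segment k.castSucc ∧ i ∉ P.ext k := by simpa using hi
    have hj' : j ∈ P.segment k.castSucc ∧ j ∉ P.ext k := by simpa using hj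
    rw [hf.colorRank_eq i hi'.1, hf.colorRank_eq j hj'.1] at he
    exact rankIn_injOn (h.mem_restList.mpr hi') (h.mem_restList.mpr hj') he
  · have hi' := Finset.mem_sdiff.mp hi
    have hj' := Finset.mem_sdiff.mp hj
    rw [hf.colorRank_eq i hi'.1, hf.colorRank_eq j hj'.1]
    have hnd := h.nodup_restList
    have hs : (restList P.item (P.stopOf k.castSucc) L).Pairwise fun i j =>
      P.rendezvous i ≤ P.rendezvous j := h.sorted.sublist List.filter_sublist
    have him := h.mem_restList.mpr hi'
    obtain ⟨l₁, l₂, e⟩ := List.append_of_mem (h.mem_restList.mpr hj')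
    rw [e] at hnd hs him ⊢
    rw [rankIn_lt_iff hnd]
    rw [List.pairwise_append] at hs
    rw [List.mem_append, List.mem_cons] at him
    rcases him with him | him | him
    · exact absurd (hs.2.2 i him j (by simp)) (not_le.mpr hlt)
    · rw [him] at hlt
      exact absurd hlt (lt_irrefl _)
    · exact him
  · have hv' := Finset.mem_sdiff.mp hv
    obtain ⟨l₁, l₂, e⟩ := List.append_of_mem (h.mem_restList.mpr hv')
    have hnd := h.nodup_restList
    have hall := h.nodup_all
    have hcolor : ∀ j ∈ P.segment k.castSucc, c.color j = groupIndex (firstFitAll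
        (fun j g => okColor (P.item j) (g.map P.item))
        (matchGroups P.item P.budget (P.stopOf k.castSucc) L) (l₁ ++ v :: l₂)) j := by
      intro j hj
      rw [hf.color_eq j hj, colorGroups, e]
    rw [e] at hnd hall
    obtain ⟨h1, h2, h3, h4⟩ := firstFitAll_spec hall rfl rfl (S := firstFitAll
      (fun j g => okColor (P.item j) (g.map P.item))
      (matchGroups P.item P.budget (P.stopOf k.castSucc) L) l₂)
    rw [← hcolor v hv'.1] at h1 h2 h3
    set S := firstFitAll (fun j g => okColor (P.item j) (g.map P.item))
      (matchGroups P.item P.budget (P.stopOf k.castSucc) L) l₂ with hS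
    have hearly : ∀ u ∈ P.segment k.castSucc,
        (u ∈ l₂ ∨ u ∈ (matchGroups P.item P.budget (P.stopOf k.castSucc) L).flatten) ↔
          (u ∈ P.ext k ∨ c.colorRank u < c.colorRank v) := by
      intro u hu
      rw [hf.colorRank_eq u hu, hf.colorRank_eq v hv'.1, e, rankIn_lt_iff hnd, h.mem_matchGroups,
        or_comm]
    have hl₂ : ∀ u ∈ l₂, u ∈ P.segment k.castSucc := fun u hu =>
      (h.mem_restList.mp (e ▸ by simp [hu] :
        u ∈ restList P.item (P.stopOf k.castSucc) L)).1
    obtain ⟨a, ha, ha'⟩ := hex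
    -- A group of index below the colour of `v` rejected `v`, so it contains a neighbour coloured
    -- before. Hence no colour smaller than the one chosen is allowed.
    have hle : c.color v ≤ a := by
      by_contra! hlt
      have := h2 a hlt
      rw [Bool.eq_false_iff, Ne, Inst.okColor_item] at this
      push Not at this
      obtain ⟨w, hw, hd⟩ := this
      obtain ⟨hw, hwa⟩ := (h4 a w).mp hw
      have hws : w ∈ P.segment k.castSucc := by
        rcases hw with hw | hw
        exacts [hl₂ w hw, hseg (h.mem_matchGroups.mp hw)]
      have hwv : w ≠ v := by
        rintro rfl
        have := hall
        rw [List.append_assoc, List.cons_append, List.nodup_append, List.nodup_cons,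
          List.mem_append] at this
        exact this.2.1.1 hw
      refine ha' w hws (P.adj_iff.mpr ⟨hwv, fun h => hd h.symm⟩) ((hearly w hws).mp hw) ?_
      rw [hcolor w hws]
      exact hwa
    refine ⟨hle.trans_lt ha, fun u hu huv hr he => ?_⟩
    have hmem := (h4 (c.color v) u).mpr ⟨(hearly u hu).mpr hr, by rw [← hcolor u hu, he]⟩
    have hlt : c.color v < S.length := by
      by_contra hc
      rw [List.getD_eq_default _ _ (not_lt.mp hc)] at hmem
      simp at hmem
    have := h3 hlt
    rw [Inst.okColor_item] at this
    exact (P.adj_iff.mp huv).2 (this u hmem).symm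

/-- All smaller colours occur on neighbours of `v` that were inserted before it and end no earlier,
and there are fewer than `ω` of these. -/
theorem properLast (hf : c.Follows P (Fin.last r) L) (h : P.Lists (Fin.last r) L) :
    ProperLast P c.color := by
  have hK : colorGroups P.item P.budget (P.stopOf (Fin.last r)) L =
      firstFitAll (fun j g => okColor (P.item j) (g.map P.item)) [] L := by
    rw [colorGroups, matchGroups, Inst.Lists.extList_last, Inst.Lists.restList_last]
    rfl
  have hcolor : ∀ j ∈ P.segment (Fin.last r), c.color j = groupIndex (firstFitAll
      (fun j g => okColor (P.item j) (g.map P.item)) [] L) j := by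
    intro j hj
    rw [hf.color_eq j hj, hK]
  refine ⟨fun v hv => ?_, fun i hi j hj hij he => ?_⟩
  · obtain ⟨l₁, l₂, e⟩ := List.append_of_mem ((h.mem_iff v).mpr hv)
    have hnd := h.nodup
    have hs := h.sorted
    have hcol := hcolor
    rw [e] at hnd hs hcol
    obtain ⟨h1, h2, h3, h4⟩ := firstFitAll_spec (init := []) (by simpa using hnd) rfl rfl
      (S := firstFitAll (fun j g => okColor (P.item j) (g.map P.item)) [] l₂)
    rw [← hcol v hv] at h1 h2 h3
    have hl₂ : ∀ u ∈ l₂, u ∈ P.segment (Fin.last r) := fun u hu =>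
      (h.mem_iff u).mp (e ▸ by simp [hu])
    have hv₂ : v ∉ l₂ := (List.nodup_cons.mp (List.nodup_append.mp hnd).2.1).1
    have key : ∀ a < c.color v, ∃ u ∈ l₂, c.color u = a ∧ P.conflictGraph.Adj u v := by
      intro a ha
      have := h2 a ha
      rw [Bool.eq_false_iff, Ne, Inst.okColor_item] at this
      push Not at this
      obtain ⟨w, hw, hd⟩ := this
      obtain ⟨hw, hwa⟩ := (h4 a w).mp hw
      have hw : w ∈ l₂ := by simpa using hw
      exact ⟨w, hw, by rw [hcol w (hl₂ w hw), hwa], P.adj_iff.mpr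
        ⟨by rintro rfl; exact hv₂ hw, fun h => hd h.symm⟩⟩
    have hsub : Finset.range (c.color v) ⊆
        (l₂.toFinset.filter fun u => P.conflictGraph.Adj u v).image c.color := by
      intro a ha
      obtain ⟨u, hu, hua, hadj⟩ := key a (Finset.mem_range.mp ha)
      exact Finset.mem_image.mpr ⟨u, Finset.mem_filter.mpr ⟨by simpa using hu, hadj⟩, hua⟩
    have hcard := (Finset.card_le_card hsub).trans Finset.card_image_le
    rw [Finset.card_range] at hcard
    refine hcard.trans_lt (P.card_lt_omega_of_rendezvous (v := v) fun u hu => ?_)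
    obtain ⟨hu, hadj⟩ := Finset.mem_filter.mp hu
    rw [List.mem_toFinset] at hu
    exact ⟨hadj, (List.pairwise_cons.mp (List.pairwise_append.mp hs).2.1).1 u hu⟩
  · have hi' := (hf.mem_getD_iff h).mpr ⟨hi, he⟩
    have hj' := (hf.mem_getD_iff h).mpr ⟨hj, rfl⟩
    have hQ : ∀ g ∈ colorGroups P.item P.budget (P.stopOf (Fin.last r)) L,
        g.Pairwise fun i j => Disjoint (P.interval i) (P.interval j) := by
      rw [hK]
      refine firstFitAll_forall (by simp) (fun v _ g hok hg => ?_) (by simp)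
      rw [Inst.okColor_item] at hok
      exact List.pairwise_cons.mpr ⟨hok, hg⟩
    have hlt : c.color j < (colorGroups P.item P.budget (P.stopOf (Fin.last r)) L).length := by
      by_contra hc
      rw [List.getD_eq_default _ _ (not_lt.mp hc)] at hj'
      simp at hj'
    rw [List.getD_eq_getElem _ _ hlt] at hi' hj'
    have : Std.Symm fun i j => Disjoint (P.interval i) (P.interval j) := ⟨fun _ _ h => h.symm⟩
    exact (P.adj_iff.mp hij).2 ((hQ _ (List.getElem_mem hlt)).forall hi' hj' hij.ne)

/-- The matching group is a suffix of the final colour group, and packing starts at the end of the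
list. -/
theorem matchedFirst (hf : c.Follows P k.castSucc L) (h : P.Lists k.castSucc L)
    (hm : c.matching k = P.pairing k L) : c.MatchedFirst P k := by
  intro e he j hj hj1 hj2
  rw [hm] at he
  obtain ⟨⟨h1, h2⟩, h3⟩ := Inst.mem_pairing.mp he
  have x1 : e.1 ∈ P.ext k := P.mem_ext.mpr (Or.inl h1)
  have x2 : e.2 ∈ P.ext k := P.mem_ext.mpr (Or.inr h2)
  have s1 := P.ext_subset_segment k x1
  have s2 := P.ext_subset_segment k x2
  obtain ⟨hjs, hjc⟩ := mem_colorClass.mp hj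
  have hcol : ∀ j ∈ P.ext k, c.color j =
      groupIndex (matchGroups P.item P.budget (P.stopOf k.castSucc) L) j := fun j hj => by
    rw [hf.color_eq j (P.ext_subset_segment k hj), h.groupIndex_ext hj]
  have hc2 : c.color e.2 = c.color e.1 := by rw [hcol _ x1, hcol _ x2, h3]
  have g1 := mem_getD_of_mem_flatten (h.mem_matchGroups.mpr x1)
  have g2 := mem_getD_of_mem_flatten (h.mem_matchGroups.mpr x2)
  rw [← hcol _ x1] at g1
  rw [← hcol _ x2, hc2] at g2
  have hjn : j ∉ (matchGroups P.item P.budget (P.stopOf k.castSucc) L).getD (c.color e.1) [] := by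
    intro hjg
    obtain ⟨hjf, hji⟩ := (DDP.mem_getD_iff h.nodup_matchGroups).mp hjg
    have xj := h.mem_matchGroups.mp hjf
    rcases P.mem_ext.mp xj with hjl | hjr
    · exact hj1 (h.left_injOn hjl h1 (by rw [hji, hcol _ x1]))
    · exact hj2 (h.right_injOn hjr h2 (by rw [hji, ← hc2, hcol _ x2]))
  rw [hf.packRank_eq j hjs, hf.packRank_eq _ s1, hf.packRank_eq _ s2, hjc, hc2]
  obtain ⟨t, ht⟩ := getD_suffix_firstFitAll (fun j g => okColor (P.item j) (g.map P.item))
    (matchGroups P.item P.budget (P.stopOf k.castSucc) L)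
    (restList P.item (P.stopOf k.castSucc) L) (c.color e.1)
  rw [colorGroups, ← ht, rankIn_append_right g1, rankIn_append_right g2]
  exact ⟨(rankIn_lt_length g1).trans_le (length_le_rankIn hjn),
    (rankIn_lt_length g2).trans_le (length_le_rankIn hjn)⟩

theorem packsSegment (hf : c.Follows P l L) (h : P.Lists l L) : c.PacksSegment P l := by
  have hcls : ∀ {a j}, j ∈ (colorGroups P.item P.budget (P.stopOf l) L).getD a [] →
      c.packRank j = rankIn ((colorGroups P.item P.budget (P.stopOf l) L).getD a []) j := by
    intro a j hj
    obtain ⟨hjs, hja⟩ := (hf.mem_getD_iff h).mp hj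
    rw [hf.packRank_eq j hjs, hja]
  -- `S` is the list of blocks of the class just before `j` is packed; the abstract quantities of
  -- the packing rule are expressed through it.
  have main : ∀ j ∈ P.segment l, ∃ S : List (List (Fin n)),
      c.openBlocks P l j = Finset.range S.length ∧
      (∀ b, c.capacityLeft P l j b = P.budget - ((S.getD b []).map P.cost).sum) ∧
      c.block j ≤ S.length ∧
      (∀ b < c.block j, P.budget < P.cost j + ((S.getD b []).map P.cost).sum) ∧
      (c.block j < S.length →
        P.cost j + ((S.getD (c.block j) []).map P.cost).sum ≤ P.budget) := by
    intro j hj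
    have hjC := (hf.mem_getD_iff h).mpr ⟨hj, rfl⟩
    have hnd : ((colorGroups P.item P.budget (P.stopOf l) L).getD (c.color j) []).Nodup := by
      rcases lt_or_ge (c.color j) (colorGroups P.item P.budget (P.stopOf l) L).length with hi | hi
      · rw [List.getD_eq_getElem _ _ hi]
        exact (List.nodup_flatten.mp h.nodup_colorGroups).1 _ (List.getElem_mem hi)
      · rw [List.getD_eq_default _ _ hi]
        exact List.nodup_nil
    obtain ⟨l₁, l₂, e⟩ := List.append_of_mem hjC
    have hblk : ∀ i ∈ P.segment l, c.color i = c.color j → c.block i = groupIndex (firstFitAll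
        (fun j b => okPack P.budget (P.item j) (b.map P.item)) [] (l₁ ++ j :: l₂)) i := by
      intro i hi hc
      rw [hf.block_eq i hi, hc, e, packGroup]
    have hl₂ : ∀ i ∈ l₂, i ∈ P.segment l ∧ c.color i = c.color j := fun i hi =>
      (hf.mem_getD_iff h).mp (e ▸ by simp [hi])
    have hearly : ∀ i, i ∈ c.earlier P l j ↔ i ∈ l₂ := by
      intro i
      rw [mem_earlier, ← hf.mem_getD_iff h]
      constructor
      · rintro ⟨h1, h2⟩
        rw [hcls h1, hcls hjC, e] at h2
        exact (rankIn_lt_iff (e ▸ hnd)).mp h2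
      · intro hi
        have him := (hf.mem_getD_iff h).mpr (hl₂ i hi)
        refine ⟨him, ?_⟩
        rw [hcls him, hcls hjC, e]
        exact (rankIn_lt_iff (e ▸ hnd)).mpr hi
    rw [e] at hnd
    obtain ⟨h1, h2, h3, h4⟩ := firstFitAll_spec (init := []) (by simpa using hnd) rfl rfl
      (S := firstFitAll (fun j b => okPack P.budget (P.item j) (b.map P.item)) [] l₂)
    rw [← hblk j hj rfl] at h1 h2 h3
    set S := firstFitAll (fun j b => okPack P.budget (P.item j) (b.map P.item)) [] l₂ with hS
    have hmemS : ∀ b u, u ∈ S.getD b [] ↔ u ∈ l₂ ∧ c.block u = b := by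
      intro b u
      rw [h4 b u]
      simp only [List.flatten_nil, List.not_mem_nil, or_false]
      exact and_congr_right fun hu => by rw [hblk u (hl₂ u hu).1 (hl₂ u hu).2]
    have hSnd : S.flatten.Nodup := (firstFitAll_perm _ _ _).nodup_iff.mpr (by
      simpa using (List.nodup_cons.mp (List.nodup_append.mp hnd).2.1).2)
    refine ⟨S, ?_, fun b => ?_, h1, fun b hb => ?_, fun hlt => ?_⟩
    · ext b
      rw [mem_openBlocks, Finset.mem_range]
      constructor
      · rintro ⟨i, hi, hib⟩
        have := (hmemS b i).mpr ⟨(hearly i).mp hi, hib⟩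
        by_contra hc
        rw [List.getD_eq_default _ _ (not_lt.mp hc)] at this
        simp at this
      · intro hb
        have hne : S[b] ≠ [] := firstFitAll_ne_nil (by simp) l₂ _ (List.getElem_mem hb)
        obtain ⟨i, hi⟩ := List.exists_mem_of_ne_nil _ hne
        rw [← List.getD_eq_getElem S [] hb, hmemS] at hi
        exact ⟨i, (hearly i).mpr hi.1, hi.2⟩
    · rw [capacityLeft]
      congr 1
      have hb : (S.getD b []).Nodup := by
        rcases lt_or_ge b S.length with hi | hi
        · rw [List.getD_eq_getElem _ _ hi]
          exact (List.nodup_flatten.mp hSnd).1 _ (List.getElem_mem hi)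
        · rw [List.getD_eq_default _ _ hi]
          exact List.nodup_nil
      rw [← List.sum_toFinset _ hb]
      refine Finset.sum_congr ?_ fun _ _ => rfl
      ext i
      rw [Finset.mem_filter, hearly, List.mem_toFinset, hmemS]
    · have := h2 b hb
      rw [Bool.eq_false_iff, Ne, Inst.okPack_item] at this
      exact not_le.mp this
    · have := h3 hlt
      rwa [Inst.okPack_item] at this
  refine ⟨fun a i hi j hj he => ?_, fun j hj => ?_, fun j hj => ?_⟩
  · have hi' := (hf.mem_getD_iff h).mpr (mem_colorClass.mp (Finset.mem_coe.mp hi))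
    have hj' := (hf.mem_getD_iff h).mpr (mem_colorClass.mp (Finset.mem_coe.mp hj))
    rw [hcls hi', hcls hj'] at he
    exact rankIn_injOn hi' hj' he
  · rintro ⟨b, hb, hcost⟩
    obtain ⟨S, h1, h2, h3, h4, h5⟩ := main j hj
    rw [h1, Finset.mem_range] at hb
    have hle : c.block j ≤ b := by
      by_contra! hlt
      have := h4 b hlt
      rw [h2] at hcost
      linarith
    have hlt := hle.trans_lt hb
    refine ⟨by rw [h1]; exact Finset.mem_range.mpr hlt, ?_⟩
    rw [h2]
    have := h5 hlt
    linarith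
  · intro hno
    obtain ⟨S, h1, h2, h3, h4, h5⟩ := main j hj
    rw [h1, Finset.card_range]
    refine le_antisymm h3 (not_lt.mp fun hlt => hno ⟨c.block j, ?_, ?_⟩)
    · rw [h1]; exact Finset.mem_range.mpr hlt
    · rw [h2]
      have := h5 hlt
      linarith

end Follows

end Choices

/-! ### Splitting into segments and dealing out drones -/

section Algorithm

variable {α β : Type}

/-- Number the elements of a list downwards. -/
def enumerate : List β → List (ℕ × β)
  | [] => []
  | x :: l => (l.length, x) :: enumerate l

/-- The segments of a list of deliveries, sorted by rendezvous times. -/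
def buckets (ρ : α → Item) : List Stop → List α → List (List α × Stop)
  | [], _ => []
  | s :: ss, L =>
    (sortBy (fun j => (ρ j).2.2.1) (L.filter fun j => inSegment s (ρ j)), s) ::
      buckets ρ ss (L.filter fun j => !inSegment s (ρ j))

/-- Give a drone to each of the blocks; the second component lists the unused drones. -/
def deal : List (List α) → List ℕ → List (α × ℕ) × List ℕ
  | [], ds => ([], ds)
  | b :: bs, ds =>
    match (deal bs ds).2 with
    | [] => ((deal bs ds).1, [])
    | d :: ds' => (b.map (fun j => (j, d)) ++ (deal bs ds).1, ds')

/-- Equality expressed by the only comparison that the machine offers. -/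
def natEq (a b : ℕ) : Bool := decide (a ≤ b) && decide (b ≤ a)

def extList' (ρ : α → Item) (s : Stop) (a : List (α × ℕ)) : List ℕ :=
  (a.filter fun p => isExt s (ρ p.1)).map Prod.snd

/-- The drones that are available for the next segment, the assignment so far, and the lists of the
drones that serve the deliveries of `ext`, the latest station first. -/
abbrev AssignState (α : Type) : Type := List ℕ × List (α × ℕ) × List (List ℕ)

/-- The available drones are recomputed from the full list `U`: only those that serve the current
`ext` are barred from the next segment. -/
def assignStep (ρ : α → Item) (U : List ℕ) (x : List (List α) × Stop) (st : AssignState α) :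
    AssignState α :=
  (U.filter fun d => !(extList' ρ x.2 (deal x.1 st.1).1).any (natEq d),
    (deal x.1 st.1).1 ++ st.2.1, extList' ρ x.2 (deal x.1 st.1).1 :: st.2.2)

/-- The fold begins at the right end, so `xs` must list the segments with the latest first. -/
def assignAll (ρ : α → Item) (U : List ℕ) (xs : List (List (List α) × Stop)) : AssignState α :=
  xs.foldr (assignStep ρ U) (U, [], [])

/-- The drone that is assigned to the delivery with key `k`. -/
def droneOf (ρ : α → Item) (k : ℕ) : List (α × ℕ) → ℕ
  | [] => 0
  | p :: l => bif natEq (ρ p.1).1 k then p.2 else droneOf ρ k l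

theorem natEq_iff {a b : ℕ} : natEq a b = true ↔ a = b := by
  rw [natEq, Bool.and_eq_true, decide_eq_true_iff, decide_eq_true_iff, le_antisymm_iff]

/-! #### Naturality -/

theorem sortBy_map (f : α → β) (key : β → ℝ) (l : List α) :
    sortBy key (l.map f) = (sortBy (fun a => key (f a)) l).map f :=
  (List.map_insertionSort (r := fun a b => key (f a) ≤ key (f b)) (s := fun a b => key a ≤ key b)
    f l fun _ _ _ _ => Iff.rfl).symm

/-- Correctness is proved for labels in `Fin n`, whereas the program handles bare items. The
decisions depend only on the items, so relabelling commutes with every function of the algorithm. -/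
theorem matchGroups_map (ρ : α → Item) (B : ℝ) (s : Stop) (L : List α) :
    matchGroups id B s (L.map ρ) = (matchGroups ρ B s L).map (List.map ρ) := by
  have h : extList id s (L.map ρ) = (extList ρ s L).map ρ := by
    simp only [extList, List.filter_map, List.map_append, sortBy_map, id, Function.comp_def]
  rw [matchGroups, h]
  simpa [matchGroups] using firstFitAll_map ρ (fun j g => okMatch B j g) [] (extList ρ s L)

theorem colorGroups_map (ρ : α → Item) (B : ℝ) (s : Stop) (L : List α) :
    colorGroups id B s (L.map ρ) = (colorGroups ρ B s L).map (List.map ρ) := by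
  have h : restList id s (L.map ρ) = (restList ρ s L).map ρ := by
    simp only [restList, List.filter_map, id, Function.comp_def]
  rw [colorGroups, h, matchGroups_map]
  simpa [colorGroups] using firstFitAll_map ρ (fun j g => okColor j g)
    (matchGroups ρ B s L) (restList ρ s L)

theorem packGroup_map (ρ : α → Item) (B : ℝ) (g : List α) :
    packGroup id B (g.map ρ) = (packGroup ρ B g).map (List.map ρ) := by
  simpa [packGroup] using firstFitAll_map ρ (fun j g => okPack B j g) [] g

theorem segmentBlocks_map (ρ : α → Item) (B : ℝ) (s : Stop) (L : List α) :
    segmentBlocks id B s (L.map ρ) = (segmentBlocks ρ B s L).map (List.map ρ) := by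
  rw [segmentBlocks, segmentBlocks, colorGroups_map, List.flatMap_map, List.map_flatMap]
  simp only [packGroup_map]

theorem buckets_map (ρ : α → Item) (ss : List Stop) (L : List α) :
    buckets id ss (L.map ρ) = (buckets ρ ss L).map (Prod.map (List.map ρ) id) := by
  induction ss generalizing L with
  | nil => rfl
  | cons s ss ih =>
    simp only [buckets, List.filter_map, sortBy_map, List.map_cons, Prod.map, ih, id,
      Function.comp_def]

theorem deal_map (f : α → β) (bs : List (List α)) (ds : List ℕ) :
    deal (bs.map (List.map f)) ds =
      ((deal bs ds).1.map (Prod.map f id), (deal bs ds).2) := by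
  induction bs with
  | nil => rfl
  | cons b bs ih =>
    rw [List.map_cons, deal, deal, ih]
    cases h : (deal bs ds).2 <;> simp [Function.comp_def]

theorem extList'_map (ρ : α → Item) (s : Stop) (a : List (α × ℕ)) :
    extList' id s (a.map (Prod.map ρ id)) = extList' ρ s a := by
  simp [extList', List.filter_map, Function.comp_def]

theorem assignAll_map (ρ : α → Item) (U : List ℕ) (xs : List (List (List α) × Stop)) :
    assignAll id U (xs.map (Prod.map (List.map (List.map ρ)) id)) =
      ((assignAll ρ U xs).1, (assignAll ρ U xs).2.1.map (Prod.map ρ id),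
        (assignAll ρ U xs).2.2) := by
  induction xs with
  | nil => rfl
  | cons x xs ih =>
    have e : ∀ ys, assignAll id U (Prod.map (List.map (List.map ρ)) id x :: ys) =
      assignStep id U (Prod.map (List.map (List.map ρ)) id x) (assignAll id U ys) := fun _ => rfl
    have e' : assignAll ρ U (x :: xs) = assignStep ρ U x (assignAll ρ U xs) := rfl
    rw [List.map_cons, e, e', ih]
    simp only [assignStep, Prod.map_fst, Prod.map_snd, deal_map, id, extList'_map,
      List.map_append]

theorem droneOf_map (ρ : α → Item) (k : ℕ) (l : List (α × ℕ)) :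
    droneOf id k (l.map (Prod.map ρ id)) = droneOf ρ k l := by
  induction l with
  | nil => rfl
  | cons p l ih => simp [droneOf, ih]

/-! #### Blocks -/

theorem flatten_flatMap_packGroup_perm (ρ : α → Item) (B : ℝ) (K : List (List α)) :
    (K.flatMap (packGroup ρ B)).flatten.Perm K.flatten := by
  induction K with
  | nil => rfl
  | cons g K ih =>
    rw [List.flatMap_cons, List.flatten_append, List.flatten_cons]
    refine List.Perm.append ?_ ih
    simpa [packGroup] using firstFitAll_perm (fun j b => okPack B (ρ j) (b.map ρ)) [] g

/-- Lists of nonempty groups have as many groups as a function that separates exactly the groups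
has values. -/
theorem card_image_eq_length {γ : Type} [DecidableEq α] [DecidableEq γ]
    {bs : List (List α)} (hne : ∀ b ∈ bs, b ≠ [])
    (hnd : bs.flatten.Nodup) {f : α → γ}
    (hf : ∀ i ∈ bs.flatten, ∀ j ∈ bs.flatten, f i = f j ↔ ∃ b ∈ bs, i ∈ b ∧ j ∈ b) :
    (bs.flatten.toFinset.image f).card = bs.length := by
  induction bs with
  | nil => simp
  | cons b bs ih =>
    rw [List.flatten_cons, List.nodup_append] at hnd
    have hmem : ∀ {i}, i ∈ bs.flatten → i ∈ (b :: bs).flatten := fun hi => by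
      rw [List.flatten_cons]; exact List.mem_append_right _ hi
    have hmem' : ∀ {i}, i ∈ b → i ∈ (b :: bs).flatten := fun hi => by
      rw [List.flatten_cons]; exact List.mem_append_left _ hi
    have ih := ih (fun b hb => hne b (List.mem_cons_of_mem _ hb)) hnd.2.1 (by
      intro i hi j hj
      rw [hf i (hmem hi) j (hmem hj)]
      simp only [List.mem_cons, exists_eq_or_imp, or_iff_right_iff_imp]
      rintro ⟨hib, -⟩
      exact absurd rfl (hnd.2.2 i hib i hi))
    obtain ⟨j₀, hj₀⟩ := List.exists_mem_of_ne_nil b (hne b List.mem_cons_self)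
    have hset : (b :: bs).flatten.toFinset.image f =
        insert (f j₀) (bs.flatten.toFinset.image f) := by
      ext y
      simp only [Finset.mem_image, Finset.mem_insert, List.mem_toFinset]
      constructor
      · rintro ⟨i, hi, rfl⟩
        rw [List.flatten_cons, List.mem_append] at hi
        rcases hi with hi | hi
        · exact Or.inl ((hf i (hmem' hi) j₀ (hmem' hj₀)).mpr ⟨b, List.mem_cons_self, hi, hj₀⟩)
        · exact Or.inr ⟨i, hi, rfl⟩
      · rintro (rfl | ⟨i, hi, rfl⟩)
        · exact ⟨j₀, hmem' hj₀, rfl⟩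
        · exact ⟨i, hmem hi, rfl⟩
    rw [hset, Finset.card_insert_of_notMem, ih, List.length_cons]
    intro h
    obtain ⟨i, hi, he⟩ := Finset.mem_image.mp h
    rw [List.mem_toFinset] at hi
    obtain ⟨b', hb', hib, hjb⟩ := (hf i (hmem hi) j₀ (hmem' hj₀)).mp he
    rcases List.mem_cons.mp hb' with rfl | hb'
    · exact hnd.2.2 i hib i hi rfl
    · exact hnd.2.2 j₀ hj₀ j₀ (List.mem_flatten.mpr ⟨b', hb', hjb⟩) rfl

theorem deal_snd (bs : List (List α)) (ds : List ℕ) : (deal bs ds).2 = ds.drop bs.length := by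
  induction bs with
  | nil => rfl
  | cons b bs ih =>
    rw [deal, List.length_cons, ← List.drop_drop, ← ih]
    cases (deal bs ds).2 <;> rfl

theorem mem_deal {bs : List (List α)} {ds : List ℕ} {p : α × ℕ} (h : p ∈ (deal bs ds).1) :
    p.1 ∈ bs.flatten ∧ p.2 ∈ ds.take bs.length := by
  induction bs with
  | nil => simp [deal] at h
  | cons b bs ih =>
    have hs := deal_snd bs ds
    rw [deal] at h
    have hmono : ds.take bs.length ⊆ ds.take (b :: bs).length :=
      (List.take_sublist_take_left (by simp)).subset
    cases hd : (deal bs ds).2 with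
    | nil =>
      rw [hd] at h
      obtain ⟨h1, h2⟩ := ih h
      exact ⟨by rw [List.flatten_cons]; exact List.mem_append_right _ h1, hmono h2⟩
    | cons d ds' =>
      rw [hd] at h hs
      rcases List.mem_append.mp h with h | h
      · obtain ⟨j, hj, rfl⟩ := List.mem_map.mp h
        refine ⟨by rw [List.flatten_cons]; exact List.mem_append_left _ hj, ?_⟩
        rw [List.length_cons, List.take_add_one, List.mem_append]
        right
        have : ds[bs.length]? = some d := by
          rw [← List.head?_drop, ← hs]; rfl
        simp [this]
      · obtain ⟨h1, h2⟩ := ih h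
        exact ⟨by rw [List.flatten_cons]; exact List.mem_append_right _ h1, hmono h2⟩

theorem deal_functional {bs : List (List α)} {ds : List ℕ} (hn : bs.flatten.Nodup) {j : α}
    {d d' : ℕ} (h : (j, d) ∈ (deal bs ds).1) (h' : (j, d') ∈ (deal bs ds).1) : d = d' := by
  induction bs with
  | nil => simp [deal] at h
  | cons b bs ih =>
    rw [List.flatten_cons, List.nodup_append] at hn
    rw [deal] at h h'
    cases hd : (deal bs ds).2 with
    | nil =>
      rw [hd] at h h'
      exact ih hn.2.1 h h'
    | cons e ds' =>
      rw [hd] at h h'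
      have hno : ∀ d, (j, d) ∈ (deal bs ds).1 → j ∉ b := fun d hd hj =>
        hn.2.2 j hj j (mem_deal hd).1 rfl
      have hmap : ∀ {d}, (j, d) ∈ b.map (fun j => (j, e)) → j ∈ b ∧ d = e := by
        intro d hm
        obtain ⟨i, hi, he⟩ := List.mem_map.mp hm
        rw [Prod.mk.injEq] at he
        exact ⟨he.1 ▸ hi, he.2.symm⟩
      rcases List.mem_append.mp h with h | h <;> rcases List.mem_append.mp h' with h' | h'
      · rw [(hmap h).2, (hmap h').2]
      · exact absurd (hmap h).1 (hno _ h')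
      · exact absurd (hmap h').1 (hno _ h)
      · exact ih hn.2.1 h h'

theorem exists_mem_deal {bs : List (List α)} {ds : List ℕ} (hlen : bs.length ≤ ds.length)
    {j : α} (hj : j ∈ bs.flatten) : ∃ d, (j, d) ∈ (deal bs ds).1 := by
  induction bs with
  | nil => simp at hj
  | cons b bs ih =>
    have hs := deal_snd bs ds
    rw [deal]
    rw [List.length_cons] at hlen
    cases hd : (deal bs ds).2 with
    | nil =>
      rw [hd] at hs
      have := congrArg List.length hs
      rw [List.length_drop, List.length_nil] at this
      omega
    | cons e ds' =>
      rw [List.flatten_cons, List.mem_append] at hj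
      rcases hj with hj | hj
      · exact ⟨e, List.mem_append_left _ (List.mem_map.mpr ⟨j, hj, rfl⟩)⟩
      · obtain ⟨d, hd⟩ := ih (by omega) hj
        exact ⟨d, List.mem_append_right _ hd⟩

theorem deal_eq_iff {bs : List (List α)} {ds : List ℕ} (hn : bs.flatten.Nodup) (hds : ds.Nodup)
    {i j : α} {d d' : ℕ} (h : (i, d) ∈ (deal bs ds).1) (h' : (j, d') ∈ (deal bs ds).1) :
    d = d' ↔ ∃ b ∈ bs, i ∈ b ∧ j ∈ b := by
  induction bs with
  | nil => simp [deal] at h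
  | cons b bs ih =>
    rw [List.flatten_cons, List.nodup_append] at hn
    have hs := deal_snd bs ds
    rw [deal] at h h'
    have hnot : ∀ {i}, i ∈ bs.flatten → i ∉ b := fun hi hib => hn.2.2 _ hib _ hi rfl
    have hflat : ∀ {b' i}, b' ∈ bs → i ∈ b' → i ∈ bs.flatten := fun hb' hi =>
      List.mem_flatten.mpr ⟨_, hb', hi⟩
    cases hd : (deal bs ds).2 with
    | nil =>
      rw [hd] at h h'
      have hi := (mem_deal h).1
      rw [ih hn.2.1 h h']
      simp [hnot hi]
    | cons e ds' =>
      rw [hd] at h h' hs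
      -- The drone of the block `b` heads the unused part of `ds`, so it differs from those given to
      -- the later blocks.
      have he : e ∉ ds.take bs.length := by
        intro hmem
        have := List.nodup_append.mp ((List.take_append_drop bs.length ds).symm ▸ hds)
        exact this.2.2 e hmem e (by rw [← hs]; simp) rfl
      have hmap : ∀ {i d}, (i, d) ∈ b.map (fun j => (j, e)) → i ∈ b ∧ d = e := by
        intro i d hm
        obtain ⟨i', hi, he⟩ := List.mem_map.mp hm
        rw [Prod.mk.injEq] at he
        exact ⟨he.1 ▸ hi, he.2.symm⟩
      rcases List.mem_append.mp h with h | h <;> rcases List.mem_append.mp h' with h' | h'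
      · exact iff_of_true ((hmap h).2.trans (hmap h').2.symm)
          ⟨b, List.mem_cons_self, (hmap h).1, (hmap h').1⟩
      · obtain ⟨h1, h2⟩ := mem_deal h'
        refine iff_of_false (fun hdd => he ?_) ?_
        · rw [← (hmap h).2, hdd]; exact h2
        · rintro ⟨b', hb', hi, hj⟩
          rcases List.mem_cons.mp hb' with rfl | hb'
          exacts [hnot h1 hj, hnot (hflat hb' hi) (hmap h).1]
      · obtain ⟨h1, h2⟩ := mem_deal h
        refine iff_of_false (fun hdd => he ?_) ?_
        · rw [← (hmap h').2, ← hdd]; exact h2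
        · rintro ⟨b', hb', hi, hj⟩
          rcases List.mem_cons.mp hb' with rfl | hb'
          exacts [hnot h1 hi, hnot (hflat hb' hj) (hmap h').1]
      · have hi := (mem_deal h).1
        rw [ih hn.2.1 h h']
        simp [hnot hi]

theorem droneOf_eq {ρ : α → Item} {l : List (α × ℕ)} {j : α} {d : ℕ} (h : (j, d) ∈ l)
    (hu : ∀ p ∈ l, (ρ p.1).1 = (ρ j).1 → p.2 = d) : droneOf ρ (ρ j).1 l = d := by
  induction l with
  | nil => simp at h
  | cons p l ih =>
    rw [droneOf]
    cases hp : natEq (ρ p.1).1 (ρ j).1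
    · rw [cond_false]
      refine ih ?_ fun q hq => hu q (List.mem_cons_of_mem _ hq)
      rcases List.mem_cons.mp h with rfl | h
      · rw [natEq_iff.mpr rfl] at hp
        exact absurd hp (by simp)
      · exact h
    · rw [cond_true]
      exact hu p List.mem_cons_self (natEq_iff.mp hp)

theorem buckets_spec (ρ : α → Item) {ss : List Stop} {L : List α} (hn : L.Nodup) :
    ∃ h : (buckets ρ ss L).length = ss.length, ∀ i (hi : i < ss.length),
      ((buckets ρ ss L)[i]).2 = ss[i] ∧ ((buckets ρ ss L)[i]).1.Nodup ∧
      ((buckets ρ ss L)[i]).1.Pairwise (fun a b => (ρ a).2.2.1 ≤ (ρ b).2.2.1) ∧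
      ∀ j, j ∈ ((buckets ρ ss L)[i]).1 ↔ j ∈ L ∧ inSegment ss[i] (ρ j) = true ∧
        ∀ i' (hi' : i' < i), inSegment ss[i'] (ρ j) = false := by
  induction ss generalizing L with
  | nil => exact ⟨rfl, fun i hi => absurd hi (by simp)⟩
  | cons s ss ih =>
    obtain ⟨h, ih⟩ := ih (hn.filter fun j => !inSegment s (ρ j))
    refine ⟨by simp [buckets, h], fun i hi => ?_⟩
    cases i with
    | zero =>
      simp only [buckets, List.getElem_cons_zero, Nat.not_lt_zero, IsEmpty.forall_iff,
        implies_true, and_true, true_and]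
      refine ⟨(sortBy_perm _ _).nodup_iff.mpr (hn.filter _), sortBy_pairwise _ _, fun j => ?_⟩
      rw [(sortBy_perm _ _).mem_iff, List.mem_filter]
    | succ i =>
      have hi : i < ss.length := by simpa using hi
      obtain ⟨h1, h2, h3, h4⟩ := ih i hi
      simp only [buckets, List.getElem_cons_succ]
      refine ⟨h1, h2, h3, fun j => ?_⟩
      rw [h4, List.mem_filter, Bool.not_eq_true']
      constructor
      · rintro ⟨⟨h5, h6⟩, h7, h8⟩
        refine ⟨h5, h7, fun i' hi' => ?_⟩
        cases i' with
        | zero => exact h6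
        | succ i' => exact h8 i' (by omega)
      · rintro ⟨h5, h6, h7⟩
        exact ⟨⟨h5, h7 0 (by omega)⟩, h6, fun i' hi' => h7 (i' + 1) (by omega)⟩

end Algorithm

/-! ### The algorithm -/

/-- Only the head is tested first: in a list sorted by launch times, if it lies beyond the stop, so
does everything else. An empty segment thus takes constant time, without which the bound would
contain a product of `n` and `r`. -/
def takeSegment (s : Stop) : List Item → List Item × List Item
  | [] => ([], [])
  | x :: L =>
    bif inSegment s x then
      (sortBy (fun j => j.2.2.1) ((x :: L).filter fun j => inSegment s j),
        (x :: L).filter fun j => !inSegment s j)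
    else ([], x :: L)

/-- The segments of a list of deliveries that is sorted by launch times. -/
def sweep : List Stop → List Item → List (List Item × Stop)
  | [], _ => []
  | s :: ss, L => ((takeSegment s L).1, s) :: sweep ss (takeSegment s L).2

def stopList (l : List (ℝ × ℝ)) : List Stop := l.map (fun y => (true, y)) ++ [(false, 0, 0)]

/-- The value of `z`, the number of blocks, and the blocks of a segment. -/
def segmentResult (B : ℝ) (y : List Item × Stop) : (ℕ × ℕ) × List (List Item) × Stop :=
  (((matchGroups id B y.2 y.1).length, (segmentBlocks id B y.2 y.1).length),
    (segmentBlocks id B y.2 y.1, y.2))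

def listMax (l : List ℕ) : ℕ := l.foldr max 0

def results (x : Input) : List ((ℕ × ℕ) × List (List Item) × Stop) :=
  (sweep (stopList x.2.2) (sortBy (fun j => j.2.1) (enumerate x.2.1))).map (segmentResult x.1)

def droneCount (res : List ((ℕ × ℕ) × List (List Item) × Stop)) : ℕ :=
  listMax (res.map fun y => y.1.2) + listMax (res.map fun y => y.1.1)

/-- Loops only traverse lists, so the numbers below `N` are obtained by filtering those below `2 *
n`; this suffices since neither summand of the number of drones exceeds `n`. -/
def droneList (N : ℕ) (l : List (ℝ × ℝ × ℝ)) : List ℕ :=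
  ((enumerate (l ++ l)).map Prod.fst).filter fun d => decide (d + 1 ≤ N)

def finalState (x : Input) : AssignState Item :=
  assignAll id (droneList (droneCount (results x)) x.2.1) ((results x).map Prod.snd).reverse

/-- The lists for `ext` are collected with the latest segment first. `tail` drops the entry of the
last segment, which has no station, and `reverse` restores the order of the stations. -/
def algorithm (x : Input) : Output :=
  (droneCount (results x),
    (enumerate x.2.1).map (fun i => droneOf id i.1 (finalState x).2.1),
    (finalState x).2.2.tail.reverse)

theorem sweep_eq_buckets {L : List Item} (h : L.Pairwise fun a b => a.2.1 ≤ b.2.1)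
    (ss : List Stop) : sweep ss L = buckets id ss L := by
  induction ss generalizing L with
  | nil => rfl
  | cons s ss ih =>
    have key : takeSegment s L = (sortBy (fun j => j.2.2.1) (L.filter fun j => inSegment s j),
        L.filter fun j => !inSegment s j) := by
      cases L with
      | nil => rfl
      | cons x L =>
        cases hx : inSegment s x
        · have hall : ∀ y ∈ x :: L, inSegment s y = false := by
            intro y hy
            rcases List.mem_cons.mp hy with rfl | hy
            · exact hx
            · have h1 := (List.pairwise_cons.mp h).1 y hy
              rw [Bool.eq_false_iff, Ne, inSegment_iff] at hx ⊢
              exact fun hc => hx fun hs => h1.trans (hc hs)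
          have e1 : (x :: L).filter (fun j => inSegment s j) = [] :=
            List.filter_eq_nil_iff.mpr fun y hy => by simp [hall y hy]
          have e2 : (x :: L).filter (fun j => !inSegment s j) = x :: L :=
            List.filter_eq_self.mpr fun y hy => by simp [hall y hy]
          rw [e1, e2, takeSegment, hx, cond_false]
          rfl
        · rw [takeSegment, hx, cond_true]
    rw [sweep, buckets, key]
    simp only [id]
    rw [ih (h.sublist List.filter_sublist)]

theorem length_enumerate {β : Type} (l : List β) : (enumerate l).length = l.length := by
  induction l with
  | nil => rfl
  | cons x l ih => simp [enumerate, ih]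

theorem getElem_enumerate {β : Type} (l : List β) (i : ℕ) (h : i < l.length) :
    (enumerate l)[i]'(by rwa [length_enumerate]) = (l.length - 1 - i, l[i]) := by
  induction l generalizing i with
  | nil => simp at h
  | cons x l ih =>
    cases i with
    | zero => simp [enumerate]
    | succ i =>
      have := ih i (by simpa using h)
      simp only [enumerate, List.getElem_cons_succ, this, List.length_cons]
      congr 1
      omega

theorem enumerate_ofFn {β : Type} {n : ℕ} (f : Fin n → β) :
    enumerate (List.ofFn f) = List.ofFn fun j => (n - 1 - j, f j) := by
  refine List.ext_getElem (by simp [length_enumerate]) fun i h1 h2 => ?_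
  rw [getElem_enumerate _ _ (by simpa using h2)]
  simp

theorem map_fst_enumerate {β : Type} (l : List β) :
    (enumerate l).map Prod.fst = (List.range l.length).reverse := by
  induction l with
  | nil => rfl
  | cons x l ih => simp [enumerate, ih, List.range_succ]

theorem listMax_ofFn {m : ℕ} (f : Fin m → ℕ) : listMax (List.ofFn f) = Finset.univ.sup f := by
  have h1 : ∀ l : List ℕ, ∀ x ∈ l, x ≤ listMax l := by
    intro l
    induction l with
    | nil => simp
    | cons y l ih =>
      intro x hx
      have e : listMax (y :: l) = max y (listMax l) := rfl
      rcases List.mem_cons.mp hx with rfl | hx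
      · rw [e]; exact le_max_left _ _
      · rw [e]; exact (ih x hx).trans (le_max_right _ _)
  have h2 : ∀ l : List ℕ, ∀ b, (∀ x ∈ l, x ≤ b) → listMax l ≤ b := by
    intro l b
    induction l with
    | nil => exact fun _ => Nat.zero_le b
    | cons y l ih =>
      intro h
      exact max_le (h y List.mem_cons_self) (ih fun x hx => h x (List.mem_cons_of_mem _ hx))
  refine le_antisymm (h2 _ _ fun x hx => ?_) (Finset.sup_le fun j _ => h1 _ _ ?_)
  · obtain ⟨j, rfl⟩ := List.mem_ofFn.mp hx
    exact Finset.le_sup (Finset.mem_univ j)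
  · exact List.mem_ofFn.mpr ⟨j, rfl⟩

theorem stopList_ofFn {n r : ℕ} (P : Inst n r) :
    stopList (List.ofFn fun k => (P.arrival k, P.departure k)) = List.ofFn P.stopOf := by
  rw [List.ofFn_succ', List.concat_eq_append, stopList, List.map_ofFn]
  simp only [Inst.stopOf_castSucc, Inst.stopOf_last]
  rfl

namespace Choices

variable {n r : ℕ} {c : Choices n r} {P : Inst n r} {l : Fin (r + 1)} {L : List (Fin n)}

theorem segmentBlocks_perm (h : P.Lists l L) :
    (segmentBlocks P.item P.budget (P.stopOf l) L).flatten.Perm L :=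
  (flatten_flatMap_packGroup_perm _ _ _).trans h.colorGroups_perm

theorem Follows.sameBlock_iff (hf : c.Follows P l L) (h : P.Lists l L) {i j : Fin n}
    (hi : i ∈ P.segment l) (hj : j ∈ P.segment l) :
    (∃ b ∈ segmentBlocks P.item P.budget (P.stopOf l) L, i ∈ b ∧ j ∈ b) ↔
      c.color i = c.color j ∧ c.block i = c.block j := by
  have hpack : ∀ C : List (Fin n), (packGroup P.item P.budget C).flatten.Perm C := fun C => by
    simpa [packGroup] using
      firstFitAll_perm (fun j b => okPack P.budget (P.item j) (b.map P.item)) [] C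
  have hnd : ∀ C ∈ colorGroups P.item P.budget (P.stopOf l) L,
      (packGroup P.item P.budget C).flatten.Nodup := fun C hC =>
    (hpack C).nodup_iff.mpr ((List.nodup_flatten.mp h.nodup_colorGroups).1 C hC)
  constructor
  · rintro ⟨b, hb, hib, hjb⟩
    obtain ⟨C, hC, hbC⟩ := List.mem_flatMap.mp hb
    obtain ⟨a, ha, haC⟩ := List.getElem_of_mem hC
    obtain ⟨t, ht, htb⟩ := List.getElem_of_mem hbC
    have hmemC : ∀ {u}, u ∈ b → u ∈ (colorGroups P.item P.budget (P.stopOf l) L).getD a [] := by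
      intro u hu
      rw [List.getD_eq_getElem _ _ ha, haC]
      exact (hpack C).mem_iff.mp (List.mem_flatten.mpr ⟨b, hbC, hu⟩)
    have key : ∀ {u}, u ∈ b → c.color u = a ∧ c.block u = t := by
      intro u hu
      obtain ⟨hus, hua⟩ := (hf.mem_getD_iff h).mp (hmemC hu)
      refine ⟨hua, ?_⟩
      rw [hf.block_eq u hus, hua, List.getD_eq_getElem _ _ ha, haC]
      refine groupIndex_eq_of_mem (hnd C hC) ?_
      rw [List.getD_eq_getElem _ _ ht, htb]
      exact hu
    obtain ⟨h1, h2⟩ := key hib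
    obtain ⟨h3, h4⟩ := key hjb
    exact ⟨h1.trans h3.symm, h2.trans h4.symm⟩
  · rintro ⟨hc, hb⟩
    have hiC := (hf.mem_getD_iff h).mpr ⟨hi, hc⟩
    have hjC := (hf.mem_getD_iff h).mpr ⟨hj, rfl⟩
    have hbi := hf.block_eq i hi
    have hbj := hf.block_eq j hj
    rw [hc] at hbi
    have ha : c.color j < (colorGroups P.item P.budget (P.stopOf l) L).length := by
      by_contra hc
      rw [List.getD_eq_default _ _ (not_lt.mp hc)] at hjC
      simp at hjC
    rw [List.getD_eq_getElem _ _ ha] at hiC hjC hbi hbj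
    have hmem := List.getElem_mem ha
    set C := (colorGroups P.item P.budget (P.stopOf l) L)[c.color j]
    have h1 := mem_getD_of_mem_flatten ((hpack C).mem_iff.mpr hiC)
    have h2 := mem_getD_of_mem_flatten ((hpack C).mem_iff.mpr hjC)
    rw [← hbi, hb] at h1
    rw [← hbj] at h2
    have ht : c.block j < (packGroup P.item P.budget C).length := by
      by_contra hc
      rw [List.getD_eq_default _ _ (not_lt.mp hc)] at h2
      simp at h2
    rw [List.getD_eq_getElem _ _ ht] at h1 h2
    exact ⟨_, List.mem_flatMap.mpr ⟨C, hmem, List.getElem_mem ht⟩, h1, h2⟩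

theorem Follows.numBlocks_eq (hf : c.Follows P l L) (h : P.Lists l L) :
    c.numBlocks P l = (segmentBlocks P.item P.budget (P.stopOf l) L).length := by
  have hmem : ∀ j, j ∈ (segmentBlocks P.item P.budget (P.stopOf l) L).flatten ↔
      j ∈ P.segment l := fun j => by rw [(segmentBlocks_perm h).mem_iff, h.mem_iff]
  have hset : (segmentBlocks P.item P.budget (P.stopOf l) L).flatten.toFinset = P.segment l := by
    ext j
    rw [List.mem_toFinset, hmem]
  rw [numBlocks, ← hset]
  refine card_image_eq_length (fun b hb => ?_) ((segmentBlocks_perm h).nodup_iff.mpr h.nodup)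
    fun i hi j hj => ?_
  · obtain ⟨C, -, hbC⟩ := List.mem_flatMap.mp hb
    exact firstFitAll_ne_nil (by simp) C b hbC
  · rw [hf.sameBlock_iff h ((hmem i).mp hi) ((hmem j).mp hj), Prod.mk.injEq]

end Choices

/-! ### The output of the program is the result of a run -/

namespace Inst

variable {n r : ℕ} (P : Inst n r)

theorem item_fst_injective {i j : Fin n} (h : (P.item i).1 = (P.item j).1) : i = j := by
  have hi := i.2
  have hj := j.2
  simp only [item] at h
  exact Fin.ext (by omega)

theorem inSegment_stopOf {l : Fin (r + 1)} {j : Fin n} :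
    inSegment (P.stopOf l) (P.item j) = true ↔
      ∀ k : Fin r, k.castSucc = l → P.launch j ≤ P.departure k := by
  rw [inSegment_iff]
  induction l using Fin.lastCases with
  | last =>
    rw [stopOf_last]
    exact iff_of_true (by simp) fun k hk => absurd hk (Fin.castSucc_lt_last k).ne
  | cast k =>
    rw [stopOf_castSucc]
    simp [item]

/-- Departures increase, so the lower bound on the launch time says exactly that no earlier segment
accepts the delivery. -/
theorem mem_segment_iff_inSegment {l : Fin (r + 1)} {j : Fin n} :
    j ∈ P.segment l ↔ inSegment (P.stopOf l) (P.item j) = true ∧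
      ∀ l' < l, inSegment (P.stopOf l') (P.item j) = false := by
  rw [mem_segment, inSegment_stopOf, and_comm]
  refine and_congr_right fun _ => ⟨fun h l' hl' => ?_, fun h k hk => ?_⟩
  · rw [Bool.eq_false_iff, Ne, inSegment_stopOf]
    push Not
    have h1 : (l' : ℕ) < l := hl'
    have h2 := l.2
    refine ⟨⟨l', by omega⟩, rfl, ?_⟩
    have e : (⟨(l : ℕ) - 1, by omega⟩ : Fin r).succ = l := by
      apply Fin.ext
      simp only [Fin.val_succ]
      omega
    refine lt_of_le_of_lt (P.departure_strictMono.monotone ?_) (h _ e)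
    rw [Fin.mk_le_mk]
    omega
  · have := h k.castSucc (hk ▸ Fin.castSucc_lt_succ)
    rw [Bool.eq_false_iff, Ne, inSegment_stopOf] at this
    push Not at this
    obtain ⟨k', hk', hlt⟩ := this
    rwa [← Fin.castSucc_injective r hk']

theorem exists_lists : ∃ Ls : Fin (r + 1) → List (Fin n), (∀ l, P.Lists l (Ls l)) ∧
    sweep (stopList P.input.2.2) (sortBy (fun j => j.2.1) (enumerate P.input.2.1)) =
      List.ofFn fun l => ((Ls l).map P.item, P.stopOf l) := by
  set L₀ := sortBy (fun j => (P.item j).2.1) (List.finRange n) with hL₀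
  have hnd : L₀.Nodup := (sortBy_perm _ _).nodup_iff.mpr (List.nodup_finRange n)
  have hmem : ∀ j, j ∈ L₀ := fun j => (sortBy_perm _ _).mem_iff.mpr (List.mem_finRange j)
  obtain ⟨hlen, hspec⟩ := buckets_spec P.item (ss := List.ofFn P.stopOf) hnd
  have hlen' : (buckets P.item (List.ofFn P.stopOf) L₀).length = r + 1 :=
    hlen.trans List.length_ofFn
  refine ⟨fun l => ((buckets P.item (List.ofFn P.stopOf) L₀)[(l : ℕ)]'(by rw [hlen']; exact l.2)).1,
    fun l => ?_, ?_⟩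
  · obtain ⟨h1, h2, h3, h4⟩ := hspec l (by rw [List.length_ofFn]; exact l.2)
    refine ⟨h2, fun j => ?_, h3⟩
    rw [h4 j, mem_segment_iff_inSegment]
    simp only [hmem, true_and, List.getElem_ofFn]
    refine and_congr_right fun _ => ⟨fun h l' hl' => h l' hl', fun h i hi => ?_⟩
    exact h ⟨i, hi.trans l.2⟩ hi
  · have e : enumerate P.input.2.1 = (List.finRange n).map P.item := by
      rw [input, enumerate_ofFn, List.ofFn_eq_map]
      rfl
    rw [sweep_eq_buckets (sortBy_pairwise _ _), e, sortBy_map, ← hL₀, buckets_map, input,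
      stopList_ofFn]
    refine List.ext_getElem (by rw [List.length_map, List.length_ofFn]; exact hlen')
      fun i h1 h2 => ?_
    obtain ⟨h3, -⟩ := hspec i (by rw [List.length_ofFn] at h2 ⊢; exact h2)
    rw [List.getElem_map, List.getElem_ofFn, Prod.map, h3, List.getElem_ofFn]
    rfl

theorem assign_take {α : Type} (ρ : α → Item) (U : List ℕ) (xs : List (List (List α) × Stop))
    (i : ℕ) (hi : i < xs.length) :
    assignAll ρ U (xs.take (i + 1)).reverse =
      assignStep ρ U xs[i] (assignAll ρ U (xs.take i).reverse) := by
  rw [List.take_add_one, List.getElem?_eq_getElem hi, List.reverse_append]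
  rfl

/-- The record of choices is assembled segment by segment from the lists the program computes. The
delicate point is the assignment: the count that guards a segment depends on the drones of the
preceding one, so both are obtained in one induction. -/
theorem exists_run : ∃ c : Choices n r, c.IsRun P ∧ c.IsOutput P (algorithm P.input) := by
  obtain ⟨Ls, hLs, hsweep⟩ := P.exists_lists
  choose sg hsg using P.exists_mem_segment
  set bl : Fin (r + 1) → List (List (Fin n)) := fun l =>
    segmentBlocks P.item P.budget (P.stopOf l) (Ls l) with hbl
  have hres : results P.input = List.ofFn fun l =>
      (((matchGroups P.item P.budget (P.stopOf l) (Ls l)).length, (bl l).length),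
        ((bl l).map (List.map P.item), P.stopOf l)) := by
    rw [results, hsweep, List.map_ofFn]
    congr 1
    funext l
    simp only [Function.comp, segmentResult, hbl, input, matchGroups_map, segmentBlocks_map,
      List.length_map]
  set N := droneCount (results P.input) with hN
  set U := droneList N P.input.2.1 with hU
  set xs := List.ofFn fun l => (bl l, P.stopOf l) with hxs
  -- The state after the first `i` segments.
  set St : ℕ → AssignState (Fin n) := fun i => assignAll P.item U (xs.take i).reverse with hSt
  have hSt0 : St 0 = (U, [], []) := rfl
  have hStS : ∀ l : Fin (r + 1), St (l + 1) = assignStep P.item U (bl l, P.stopOf l) (St l) := by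
    intro l
    have hl : (l : ℕ) < xs.length := by rw [hxs, List.length_ofFn]; exact l.2
    have e : xs[(l : ℕ)] = (bl l, P.stopOf l) := by simp only [hxs, List.getElem_ofFn, Fin.eta]
    simp only [hSt]
    rw [assign_take P.item U xs l hl, e]
  have hfin : finalState P.input = ((St (r + 1)).1, (St (r + 1)).2.1.map (Prod.map P.item id),
      (St (r + 1)).2.2) := by
    have e : ((results P.input).map Prod.snd).reverse =
        xs.reverse.map (Prod.map (List.map (List.map P.item)) id) := by
      rw [hres, List.map_reverse, hxs, List.map_ofFn, List.map_ofFn]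
      rfl
    rw [finalState, e, assignAll_map]
    have : xs.take (r + 1) = xs := List.take_of_length_le (by rw [hxs, List.length_ofFn])
    simp only [hSt, this]
    rw [hU, hN]
  set tot := (St (r + 1)).2.1 with htot
  set c : Choices n r :=
    { matching := fun k => P.pairing k (Ls k.castSucc)
      colorRank := fun j => rankIn (restList P.item (P.stopOf (sg j)) (Ls (sg j))) j
      color := fun j => groupIndex (colorGroups P.item P.budget (P.stopOf (sg j)) (Ls (sg j))) j
      packRank := fun j => rankIn ((colorGroups P.item P.budget (P.stopOf (sg j)) (Ls (sg j))).getD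
        (groupIndex (colorGroups P.item P.budget (P.stopOf (sg j)) (Ls (sg j))) j) []) j
      block := fun j => groupIndex (packGroup P.item P.budget
        ((colorGroups P.item P.budget (P.stopOf (sg j)) (Ls (sg j))).getD
        (groupIndex (colorGroups P.item P.budget (P.stopOf (sg j)) (Ls (sg j))) j) [])) j
      drone := fun j => droneOf P.item (P.item j).1 tot } with hc
  have hF : ∀ l, c.Follows P l (Ls l) := by
    intro l
    have hl : ∀ j ∈ P.segment l, sg j = l := fun j hj => P.segment_unique (hsg j) hj
    constructor <;> intro j hj <;> simp only [hc, hl j hj]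
  have hz : ∀ k, c.z P k = (matchGroups P.item P.budget (P.stopOf k.castSucc)
      (Ls k.castSucc)).length := fun k => (hLs k.castSucc).length_matchGroups.symm
  have hnb : ∀ l, c.numBlocks P l = (bl l).length := fun l => (hF l).numBlocks_eq (hLs l)
  have hNd : c.numDrones P = N := by
    have h1 : listMax ((results P.input).map fun y => y.1.2) = Finset.univ.sup (c.numBlocks P) := by
      rw [hres, List.map_ofFn, listMax_ofFn]
      exact Finset.sup_congr rfl fun l _ => (hnb l).symm
    have h2 : listMax ((results P.input).map fun y => y.1.1) = Finset.univ.sup (c.z P) := by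
      rw [hres, List.map_ofFn, listMax_ofFn]
      refine le_antisymm (Finset.sup_le fun l _ => ?_) (Finset.sup_le fun k _ => ?_)
      · induction l using Fin.lastCases with
        | last => simp [matchGroups, Lists.extList_last, firstFitAll]
        | cast k =>
          have := Finset.le_sup (f := c.z P) (Finset.mem_univ k)
          rwa [hz k] at this
      · rw [hz k]
        exact Finset.le_sup (f := fun l => (matchGroups P.item P.budget (P.stopOf l)
          (Ls l)).length) (Finset.mem_univ k.castSucc)
    rw [hN, droneCount, h1, h2, Choices.numDrones]
  -- Ensures that `droneList` really contains all numbers below `N`.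
  have hN2 : N ≤ n + n := by
    rw [← hNd, Choices.numDrones]
    have hcard : ∀ s : Finset (Fin n), s.card ≤ n := fun s => by simpa using s.card_le_univ
    refine add_le_add (Finset.sup_le fun l _ => ?_) (Finset.sup_le fun k _ => ?_)
    · exact Finset.card_image_le.trans (hcard _)
    · exact (Nat.sub_le _ _).trans (hcard _)
  have hUnd : U.Nodup := by
    rw [hU, droneList, map_fst_enumerate]
    exact (List.nodup_reverse.mpr List.nodup_range).filter _
  have hUmem : ∀ d, d ∈ U ↔ d ∈ Finset.range N := by
    intro d
    rw [hU, droneList, map_fst_enumerate, List.mem_filter, Finset.mem_range]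
    simp only [input, List.length_append, List.length_ofFn, List.mem_reverse, List.mem_range,
      decide_eq_true_eq]
    omega
  set a : Fin (r + 1) → List (Fin n × ℕ) := fun l => (deal (bl l) (St l).1).1 with ha
  set E : Fin (r + 1) → List ℕ := fun l => extList' P.item (P.stopOf l) (a l) with hE
  have hblnd : ∀ l, (bl l).flatten.Nodup := fun l =>
    (Choices.segmentBlocks_perm (hLs l)).nodup_iff.mpr (hLs l).nodup
  have hblmem : ∀ l j, j ∈ (bl l).flatten ↔ j ∈ P.segment l := fun l j => by
    rw [(Choices.segmentBlocks_perm (hLs l)).mem_iff, (hLs l).mem_iff]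
  have htotmem : ∀ i ≤ r + 1, ∀ p, p ∈ (St i).2.1 ↔ ∃ l : Fin (r + 1), (l : ℕ) < i ∧ p ∈ a l := by
    intro i
    induction i with
    | zero => simp [hSt0]
    | succ i ih =>
      intro hi p
      have := hStS ⟨i, hi⟩
      simp only at this
      rw [this, assignStep]
      simp only [List.mem_append]
      rw [ih (by omega)]
      constructor
      · rintro (h | ⟨l, hl, hp⟩)
        · exact ⟨⟨i, hi⟩, Nat.lt_succ_self i, h⟩
        · exact ⟨l, by omega, hp⟩
      · rintro ⟨l, hl, hp⟩
        rcases Nat.lt_succ_iff_lt_or_eq.mp hl with hl | hl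
        · exact Or.inr ⟨l, hl, hp⟩
        · obtain rfl : l = ⟨i, hi⟩ := Fin.ext hl
          exact Or.inl hp
  have houts : ∀ i ≤ r + 1, (St i).2.2 = ((List.ofFn E).take i).reverse := by
    intro i
    induction i with
    | zero => simp [hSt0]
    | succ i ih =>
      intro hi
      have := hStS ⟨i, hi⟩
      simp only at this
      rw [this, assignStep]
      simp only
      rw [ih (by omega), List.take_add_one,
        List.getElem?_eq_getElem (by rw [List.length_ofFn]; exact hi),
        List.reverse_append, List.getElem_ofFn]
      rfl
  -- The look-up in the total assignment is unambiguous: keys determine deliveries, each delivery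
  -- has one segment, and each is dealt at most one drone there.
  have hdrone : ∀ l j d, (j, d) ∈ a l → c.drone j = d := by
    intro l j d h
    refine droneOf_eq ((htotmem (r + 1) le_rfl _).mpr ⟨l, l.2, h⟩) fun p hp hk => ?_
    obtain ⟨l', -, hp⟩ := (htotmem (r + 1) le_rfl _).mp hp
    obtain ⟨j', d'⟩ := p
    obtain rfl : j' = j := P.item_fst_injective hk
    obtain rfl : l' = l := P.segment_unique ((hblmem _ _).mp (mem_deal hp).1)
      ((hblmem _ _).mp (mem_deal h).1)
    exact deal_functional (hblnd l') hp h
  have hstep : ∀ l : Fin (r + 1), (St l).1.Nodup → (St l).1.toFinset = c.available P l →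
      c.numBlocks P l ≤ (c.available P l).card → c.Assigned P l ∧
        ∀ k : Fin r, k.castSucc = l → (E l).toFinset = c.extDrones P k := by
    intro l hn hav hle
    have hlen : (bl l).length ≤ (St l).1.length := by
      rw [← hnb l, ← List.toFinset_card_of_nodup hn, hav]
      exact hle
    have hex : ∀ j ∈ P.segment l, (j, c.drone j) ∈ a l := by
      intro j hj
      obtain ⟨d, hd⟩ := exists_mem_deal hlen ((hblmem l j).mpr hj)
      rw [hdrone l j d hd]
      exact hd
    refine ⟨⟨fun j hj => ?_, fun i hi j hj => ?_⟩, ?_⟩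
    · rw [← hav, List.mem_toFinset]
      exact List.mem_of_mem_take (mem_deal (hex j hj)).2
    · rw [deal_eq_iff (hblnd l) hn (hex i hi) (hex j hj)]
      exact (hF l).sameBlock_iff (hLs l) hi hj
    · rintro k rfl
      ext d
      rw [List.mem_toFinset, Choices.extDrones, Finset.mem_image, hE]
      simp only [extList', List.mem_map, List.mem_filter]
      constructor
      · rintro ⟨⟨j, d'⟩, ⟨h1, h2⟩, rfl⟩
        have hj := (hblmem _ _).mp (mem_deal h1).1
        exact ⟨j, ((hLs _).isExt_iff (((hLs _).mem_iff j).mpr hj)).mp h2, hdrone _ _ _ h1⟩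
      · rintro ⟨j, hj, rfl⟩
        have hjs := P.ext_subset_segment k hj
        exact ⟨(j, c.drone j), ⟨hex j hjs,
          ((hLs _).isExt_iff (((hLs _).mem_iff j).mpr hjs)).mpr hj⟩, rfl⟩
  have hcolors : ∀ k, c.ColorsSegment P k := fun k => (hF _).colorsSegment (hLs _) rfl
  have hfirst : ∀ k, c.MatchedFirst P k := fun k => (hF _).matchedFirst (hLs _) rfl
  have hpacks : ∀ l, c.PacksSegment P l := fun l => (hF _).packsSegment (hLs _)
  -- The equality of the computed and the abstract drone sets of `ext` is carried along, because it
  -- identifies the list of available drones in the next segment.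
  have hassign : ∀ l, c.Assigned P l ∧
      ∀ k : Fin r, k.castSucc = l → (E l).toFinset = c.extDrones P k := by
    intro l
    induction l using Fin.induction with
    | zero =>
      refine hstep 0 hUnd ?_ (Choices.numBlocks_le_card_available_zero c P)
      ext d
      rw [Choices.available_zero, hNd, ← hUmem, List.mem_toFinset]
      rfl
    | succ k ih =>
      have hEk := ih.2 k rfl
      have hS := hStS k.castSucc
      refine hstep k.succ ?_ ?_ (Choices.numBlocks_le_card_available_succ
        (Choices.card_extDrones_le (hLs _).isMatching_pairing (hcolors k) (hpacks _) (hfirst k)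
          ih.1))
      · rw [Fin.val_succ, ← Fin.val_castSucc, hS]
        exact hUnd.filter _
      · rw [Fin.val_succ, ← Fin.val_castSucc, hS]
        ext d
        rw [Choices.available_succ, Finset.mem_sdiff, ← hEk, hNd, ← hUmem, List.mem_toFinset,
          List.mem_toFinset, assignStep, List.mem_filter]
        refine and_congr_right fun _ => ?_
        rw [Bool.not_eq_true', Bool.eq_false_iff, Ne, List.any_eq_true]
        simp only [natEq_iff, exists_eq_right']
        rfl
  refine ⟨c, ⟨fun k => (hLs _).isMaximumMatching, hcolors, fun _ => (hF _).properLast (hLs _),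
    hfirst, hpacks, fun l _ => (hassign l).1⟩, hNd.symm, ?_, ?_⟩
  · have e : enumerate P.input.2.1 = (List.finRange n).map P.item := by
      rw [input, enumerate_ofFn, List.ofFn_eq_map]
      rfl
    simp only [algorithm]
    rw [e, List.map_map, List.ofFn_eq_map, hfin]
    simp only [droneOf_map]
    rfl
  · simp only [algorithm]
    rw [hfin]
    simp only
    rw [houts (r + 1) le_rfl, List.take_of_length_le (by simp), List.ofFn_succ',
      List.concat_eq_append, List.reverse_append]
    simp only [List.reverse_cons, List.reverse_nil, List.nil_append, List.singleton_append,
      List.tail_cons, List.reverse_reverse]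
    rw [List.map_ofFn]
    congr 1
    funext k
    exact (hassign k.castSucc).2 k rfl

end Inst

/-! ### Running times -/

/-- `f` can be computed in `O(T + 1)` steps. -/
def Comp {α β : Type} (f : α → β) (T : α → ℕ) : Prop :=
  ∃ (p : Prog α β) (C : ℕ), ∀ x, (p.exec x).1 = f x ∧ (p.exec x).2 ≤ C * (T x + 1)

/-- `f` can be computed in constant time. -/
@[fun_prop]
def ConstTime {α β : Type} (f : α → β) : Prop := Comp f fun _ => 0

section Calculus

variable {α β γ δ : Type} {f : α → β} {T T' : α → ℕ}

/-- Absorbs multiplicative and additive constants. -/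
theorem Comp.mono (k : ℕ) (h : Comp f T) (hT : ∀ x, T x ≤ k * (T' x + 1)) : Comp f T' := by
  obtain ⟨p, C, hp⟩ := h
  refine ⟨p, C * (k + 1), fun x => ⟨(hp x).1, (hp x).2.trans ?_⟩⟩
  rw [mul_assoc]
  refine Nat.mul_le_mul_left C ?_
  have := hT x
  nlinarith

theorem Comp.congr {g : α → β} (h : Comp f T) (hfg : ∀ x, f x = g x) : Comp g T :=
  (funext hfg : f = g) ▸ h

theorem Comp.of_exec (p : Prog α β) (C : ℕ) (hp : ∀ x, (p.exec x).1 = f x)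
    (hC : ∀ x, (p.exec x).2 ≤ C) : ConstTime f :=
  ⟨p, C, fun x => ⟨hp x, by simpa using hC x⟩⟩

theorem Comp.comp {g : β → γ} {S : β → ℕ} (hg : Comp g S) (hf : Comp f T) :
    Comp (fun x => g (f x)) fun x => T x + S (f x) := by
  obtain ⟨p, C, hp⟩ := hf
  obtain ⟨q, D, hq⟩ := hg
  refine ⟨.comp q p, C + D + 1, fun x => ?_⟩
  simp only [Prog.exec]
  rw [(hp x).1]
  refine ⟨(hq _).1, ?_⟩
  have h1 := (hp x).2
  have h2 := (hq (f x)).2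
  nlinarith

theorem Comp.pair {g : α → γ} {S : α → ℕ} (hf : Comp f T) (hg : Comp g S) :
    Comp (fun x => (f x, g x)) fun x => T x + S x := by
  obtain ⟨p, C, hp⟩ := hf
  obtain ⟨q, D, hq⟩ := hg
  refine ⟨.pair p q, C + D + 1, fun x => ?_⟩
  simp only [Prog.exec]
  refine ⟨by rw [(hp x).1, (hq x).1], ?_⟩
  have h1 := (hp x).2
  have h2 := (hq x).2
  nlinarith

theorem Prog.exec_cond (p q : Prog α β) (x : Bool × α) : (Prog.cond p q).exec x =
    bif x.1 then ((p.exec x.2).1, (p.exec x.2).2 + 1)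
    else ((q.exec x.2).1, (q.exec x.2).2 + 1) := by
  cases h : x.1 <;> simp [Prog.exec, h]

theorem Comp.cond {c : α → Bool} {g : α → β} {Tc S : α → ℕ} (hc : Comp c Tc) (hf : Comp f T)
    (hg : Comp g S) :
    Comp (fun x => bif c x then f x else g x)
      fun x => Tc x + bif c x then T x else S x := by
  obtain ⟨p, C, hp⟩ := hf
  obtain ⟨q, D, hq⟩ := hg
  obtain ⟨o, E, ho⟩ := hc
  refine ⟨.comp (.cond p q) (.pair o .id), C + D + E + 4, fun x => ?_⟩
  have h1 := (hp x).2
  have h2 := (hq x).2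
  have h3 := (ho x).2
  have e : (Prog.comp (.cond p q) (.pair o .id)).exec x =
      (((Prog.cond p q).exec ((o.exec x).1, x)).1,
        (o.exec x).2 + 1 + 1 + ((Prog.cond p q).exec ((o.exec x).1, x)).2 + 1) := rfl
  rw [e, (ho x).1, Prog.exec_cond]
  cases h : c x
  · simp only [h, cond_false]
    exact ⟨(hq x).1, by nlinarith⟩
  · simp only [h, cond_true]
    exact ⟨(hp x).1, by nlinarith⟩

theorem Comp.caseList {l : α → List γ} {g : α × γ × List γ → β} {F : α → β} {Tl : α → ℕ}
    {S : α × γ × List γ → ℕ} {U : α → ℕ} (hl : Comp l Tl) (hf : Comp f T) (hg : Comp g S)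
    (h0 : ∀ x, l x = [] → F x = f x ∧ T x ≤ U x)
    (h1 : ∀ x y ys, l x = y :: ys → F x = g (x, y, ys) ∧ S (x, y, ys) ≤ U x) :
    Comp F fun x => Tl x + U x := by
  obtain ⟨p, C, hp⟩ := hf
  obtain ⟨q, D, hq⟩ := hg
  obtain ⟨o, E, ho⟩ := hl
  refine ⟨.comp (.caseList p q) (.pair .id o), C + D + E + 4, fun x => ?_⟩
  simp only [Prog.exec]
  rw [(ho x).1]
  have h4 := (ho x).2
  cases hx : l x with
  | nil =>
    obtain ⟨h2, h3⟩ := h0 x hx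
    simp only [h2]
    refine ⟨(hp x).1, ?_⟩
    have := (hp x).2.trans (Nat.mul_le_mul_left C (Nat.add_le_add_right h3 1))
    nlinarith
  | cons y ys =>
    obtain ⟨h2, h3⟩ := h1 x y ys hx
    simp only [h2]
    refine ⟨(hq _).1, ?_⟩
    have := (hq _).2.trans (Nat.mul_le_mul_left D (Nat.add_le_add_right h3 1))
    nlinarith

/-! #### Constant time -/

@[fun_prop]
theorem ConstTime.id' : ConstTime fun x : α => x :=
  Comp.of_exec .id 1 (fun _ => rfl) fun _ => le_rfl

@[fun_prop]
theorem ConstTime.comp' {g : β → γ} (hg : ConstTime g) (hf : ConstTime f) :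
    ConstTime fun x => g (f x) := Comp.comp hg hf

@[fun_prop]
theorem ConstTime.fst {f : α → β × γ} (hf : ConstTime f) : ConstTime fun x => (f x).1 :=
  Comp.comp (Comp.of_exec .fst 1 (fun _ => rfl) fun _ => le_rfl) hf

@[fun_prop]
theorem ConstTime.snd {f : α → β × γ} (hf : ConstTime f) : ConstTime fun x => (f x).2 :=
  Comp.comp (Comp.of_exec .snd 1 (fun _ => rfl) fun _ => le_rfl) hf

@[fun_prop]
theorem ConstTime.pair {g : α → γ} (hf : ConstTime f) (hg : ConstTime g) :
    ConstTime fun x => (f x, g x) := Comp.pair hf hg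

@[fun_prop]
theorem ConstTime.nil : ConstTime fun _ : α => ([] : List β) :=
  Comp.of_exec .nil 1 (fun _ => rfl) fun _ => le_rfl

@[fun_prop]
theorem ConstTime.cons {g : α → List β} (hf : ConstTime f) (hg : ConstTime g) :
    ConstTime fun x => f x :: g x :=
  Comp.comp (g := fun y : β × List β => y.1 :: y.2)
    (Comp.of_exec .cons 1 (fun _ => rfl) fun _ => le_rfl) (hf.pair hg)

@[fun_prop]
theorem ConstTime.zero : ConstTime fun _ : α => (0 : ℕ) :=
  Comp.of_exec .natZero 1 (fun _ => rfl) fun _ => le_rfl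

@[fun_prop]
theorem ConstTime.succ {f : α → ℕ} (hf : ConstTime f) : ConstTime fun x => f x + 1 :=
  Comp.comp (Comp.of_exec .natSucc 1 (fun _ => rfl) fun _ => le_rfl) hf

@[fun_prop]
theorem ConstTime.natAdd {f g : α → ℕ} (hf : ConstTime f) (hg : ConstTime g) :
    ConstTime fun x => f x + g x :=
  Comp.comp (g := fun y : ℕ × ℕ => y.1 + y.2)
    (Comp.of_exec .natAdd 1 (fun _ => rfl) fun _ => le_rfl) (hf.pair hg)

/-- The decidability instance is arbitrary, so that the lemma applies to whichever one a definition
has picked up. -/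
theorem ConstTime.natLe {f g : α → ℕ} {d : ∀ x, Decidable (f x ≤ g x)} (hf : ConstTime f)
    (hg : ConstTime g) : ConstTime fun x => @decide (f x ≤ g x) (d x) := by
  exact Comp.congr (Comp.comp
    (Comp.of_exec .natLe 1 (fun _ => rfl) fun _ => le_rfl) (hf.pair hg))
    fun x => by simp [Prog.exec]

@[fun_prop]
theorem ConstTime.realZero : ConstTime fun _ : α => (0 : ℝ) :=
  Comp.of_exec .realZero 1 (fun _ => rfl) fun _ => le_rfl

@[fun_prop]
theorem ConstTime.realAdd {f g : α → ℝ} (hf : ConstTime f) (hg : ConstTime g) :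
    ConstTime fun x => f x + g x :=
  Comp.comp (g := fun y : ℝ × ℝ => y.1 + y.2)
    (Comp.of_exec .realAdd 1 (fun _ => rfl) fun _ => le_rfl) (hf.pair hg)

theorem ConstTime.realLe {f g : α → ℝ} {d : ∀ x, Decidable (f x ≤ g x)} (hf : ConstTime f)
    (hg : ConstTime g) : ConstTime fun x => @decide (f x ≤ g x) (d x) := by
  exact Comp.congr (Comp.comp
    (Comp.of_exec .realLe 1 (fun _ => rfl) fun _ => le_rfl) (hf.pair hg))
    fun x => by simp [Prog.exec]

@[fun_prop]
theorem ConstTime.true : ConstTime fun _ : α => Bool.true := by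
  have : ConstTime fun _ : α => decide (0 ≤ 0) := .natLe (by fun_prop) (by fun_prop)
  simpa using this

@[fun_prop]
theorem ConstTime.false : ConstTime fun _ : α => Bool.false := by
  have : ConstTime fun _ : α => decide (0 + 1 ≤ 0) := .natLe (by fun_prop) (by fun_prop)
  simpa using this

@[fun_prop]
theorem ConstTime.cond {c : α → Bool} {g : α → β} (hc : ConstTime c) (hf : ConstTime f)
    (hg : ConstTime g) : ConstTime fun x => bif c x then f x else g x :=
  Comp.mono 0 (Comp.cond hc hf hg) fun x => by cases c x <;> simp

@[fun_prop]
theorem ConstTime.not {f : α → Bool} (hf : ConstTime f) : ConstTime fun x => !f x := by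
  have : ConstTime fun x => bif f x then Bool.false else Bool.true := by fun_prop
  convert this using 2 with x
  cases f x <;> rfl

@[fun_prop]
theorem ConstTime.and {f g : α → Bool} (hf : ConstTime f) (hg : ConstTime g) :
    ConstTime fun x => f x && g x := by
  have : ConstTime fun x => bif f x then g x else Bool.false := by fun_prop
  convert this using 2 with x
  cases f x <;> rfl

@[fun_prop]
theorem ConstTime.or {f g : α → Bool} (hf : ConstTime f) (hg : ConstTime g) :
    ConstTime fun x => f x || g x := by
  have : ConstTime fun x => bif f x then Bool.true else g x := by fun_prop
  convert this using 2 with x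
  cases f x <;> rfl

/-! #### Traversals of lists -/

/-- `U` is a potential: it pays for the step at hand and for the rest of the list. It need only
decrease along states that satisfy `Inv`. -/
theorem foldl_steps_le {p : Prog (α × β) α} {g : α × β → α} {S : α × β → ℕ} {C : ℕ}
    (hp : ∀ x, (p.exec x).1 = g x ∧ (p.exec x).2 ≤ C * (S x + 1)) (Inv : α → Prop)
    (hInv : ∀ s y, Inv s → Inv (g (s, y))) {U : α → List β → ℕ}
    (hU : ∀ s y l, Inv s → S (s, y) + 1 + U (g (s, y)) l ≤ U s (y :: l)) (l : List β) (s : α)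
    (hs : Inv s) (t : ℕ) :
    (l.foldl (fun s y => ((p.exec (s.1, y)).1, s.2 + (p.exec (s.1, y)).2 + 1)) (s, t)).1 =
      l.foldl (fun s y => g (s, y)) s ∧
    (l.foldl (fun s y => ((p.exec (s.1, y)).1, s.2 + (p.exec (s.1, y)).2 + 1)) (s, t)).2 ≤
      t + (C + 1) * U s l := by
  induction l generalizing s t with
  | nil => simp
  | cons y l ih =>
    rw [List.foldl_cons, List.foldl_cons]
    simp only
    rw [(hp (s, y)).1]
    obtain ⟨h1, h2⟩ := ih (g (s, y)) (hInv s y hs) (t + (p.exec (s, y)).2 + 1)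
    refine ⟨h1, h2.trans ?_⟩
    have h3 := Nat.mul_le_mul_left (C + 1) (hU s y l hs)
    have h4 := (hp (s, y)).2
    nlinarith

theorem Comp.foldl {l : α → List γ} {g : β × γ → β} {S : β × γ → ℕ} {Tl : α → ℕ}
    {U : β → List γ → ℕ} (hl : Comp l Tl) (hf : Comp f T) (hg : Comp g S) (Inv : β → Prop)
    (hInv₀ : ∀ x, Inv (f x)) (hInv : ∀ s y, Inv s → Inv (g (s, y)))
    (hU : ∀ s y l, Inv s → S (s, y) + 1 + U (g (s, y)) l ≤ U s (y :: l)) :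
    Comp (fun x => (l x).foldl (fun s y => g (s, y)) (f x))
      fun x => T x + Tl x + U (f x) (l x) := by
  obtain ⟨p, C, hp⟩ := hg
  obtain ⟨q, D, hq⟩ := hf.pair hl
  refine ⟨.comp (.fold p) q, C + D + 3, fun x => ?_⟩
  simp only [Prog.exec]
  rw [(hq x).1]
  obtain ⟨h1, h2⟩ := foldl_steps_le hp Inv hInv hU (l x) (f x) (hInv₀ x) 1
  have h3 := (hq x).2
  exact ⟨h1, by nlinarith⟩

theorem Comp.reverse {l : α → List γ} (hl : Comp l T) :
    Comp (fun x => (l x).reverse) fun x => T x + (l x).length := by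
  have h : ConstTime fun y : List γ × γ => y.2 :: y.1 := by fun_prop
  have := Comp.foldl (f := fun _ => []) (U := fun _ l => l.length) hl ConstTime.nil h
    (fun _ => True) (fun _ => trivial) (fun _ _ _ => trivial) fun s y l _ => by simp [add_comm]
  refine (this.congr fun x => ?_).mono 1 fun x => by omega
  rw [List.foldl_eq_foldr_reverse]
  simp

/-- Recursion along a list. -/
theorem Comp.listRec {l : α → List γ} {F : α → List γ → β} {Tl : α → ℕ}
    {g : α × γ × List γ × β → β} {S : α × γ × List γ × β → ℕ} {U : α → List γ → ℕ}
    (hl : Comp l Tl) (hf : Comp f T) (hg : Comp g S) (h0 : ∀ x, F x [] = f x)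
    (h1 : ∀ x y l, F x (y :: l) = g (x, y, l, F x l))
    (hU : ∀ x y l, S (x, y, l, F x l) + 1 + U x l ≤ U x (y :: l)) :
    Comp (fun x => F x (l x)) fun x => T x + Tl x + U x (l x) := by
  have hmono : ∀ x l l', U x l' + l.length ≤ U x (l ++ l') := by
    intro x l l'
    induction l with
    | nil => simp
    | cons y l ih =>
      have := hU x y (l ++ l')
      rw [List.cons_append, List.length_cons]
      omega
  -- Folding over the reversed list rebuilds the suffixes of `l` one by one; the state carries the
  -- current suffix and the value of `F` on it.
  set G : (α × List γ × β) × γ → α × List γ × β := fun s =>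
    (s.1.1, s.2 :: s.1.2.1, g (s.1.1, s.2, s.1.2.1, s.1.2.2)) with hG
  have hGc : Comp G fun s => S (s.1.1, s.2, s.1.2.1, s.1.2.2) := by
    have e1 : ConstTime fun s : (α × List γ × β) × γ => s.1.1 := by fun_prop
    have e2 : ConstTime fun s : (α × List γ × β) × γ => s.2 :: s.1.2.1 := by fun_prop
    have e3 : ConstTime fun s : (α × List γ × β) × γ => (s.1.1, s.2, s.1.2.1, s.1.2.2) := by
      fun_prop
    exact (Comp.pair e1 (Comp.pair e2 (hg.comp e3))).mono 1 fun s => by omega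
  have hinit : Comp (fun x => (x, ([] : List γ), f x)) fun x => 0 + (0 + T x) :=
    Comp.pair (f := fun x => x) ConstTime.id' (Comp.pair (f := fun _ => []) ConstTime.nil hf)
  -- The invariant identifies the stored value. The potential is the cost still to come, the cost of
  -- the full list minus that of the suffix done; `hmono` keeps the subtraction from being
  -- truncated.
  have key := Comp.foldl hl.reverse hinit hGc (fun s => s.2.2 = F s.1 s.2.1)
    (U := fun s l => U s.1 (l.reverse ++ s.2.1) - U s.1 s.2.1) (fun x => (h0 x).symm)
    (fun s y hs => by
      simp only [hG]
      rw [h1, ← hs])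
    (fun s y l hs => by
      simp only [hG, List.reverse_cons, List.append_assoc, List.singleton_append]
      rw [hs]
      have := hU s.1 y s.2.1
      have := hmono s.1 l.reverse (y :: s.2.1)
      omega)
  have hval : ∀ x (m l : List γ), m.foldl (fun s y => G (s, y)) (x, l, F x l) =
      (x, m.reverse ++ l, F x (m.reverse ++ l)) := by
    intro x m
    induction m with
    | nil => simp
    | cons y m ih =>
      intro l
      have e : G ((x, l, F x l), y) = (x, y :: l, F x (y :: l)) := by rw [hG, h1]
      rw [List.foldl_cons, e, ih]
      simp
  have e : ConstTime fun s : α × List γ × β => s.2.2 := by fun_prop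
  refine ((Comp.comp e key).congr fun x => ?_).mono 3 fun x => ?_
  · rw [← h0, hval]
    simp
  · have := hmono x (l x) []
    simp only [List.reverse_reverse, List.append_nil, add_zero] at this ⊢
    omega

end Calculus

/-! ### Running times of list operations -/

section Calculus

variable {α β γ δ : Type} {T : α → ℕ}

theorem Comp.append {l l' : α → List β} {T' : α → ℕ} (hl : Comp l T) (hl' : Comp l' T') :
    Comp (fun x => l x ++ l' x) fun x => T x + T' x + (l x).length := by
  have hs : ConstTime fun p : α × β × List β × List β => p.2.1 :: p.2.2.2 := by fun_prop
  exact (Comp.listRec (F := fun x m => m ++ l' x) (U := fun _ m => m.length) hl hl' hs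
    (fun _ => rfl) (fun _ _ _ => rfl) fun _ _ _ => by simp [add_comm]).mono 1 fun x => by omega

theorem Comp.map {l : α → List β} {f : α → β → γ} {S : α × β → ℕ} (hl : Comp l T)
    (hf : Comp (fun p : α × β => f p.1 p.2) S) :
    Comp (fun x => (l x).map (f x))
      fun x => T x + ((l x).map fun y => S (x, y) + 1).sum := by
  have e : ConstTime fun p : α × β × List β × List γ => (p.1, p.2.1) := by fun_prop
  have e' : ConstTime fun p : α × β × List β × List γ => p.2.2.2 := by fun_prop
  have ec : ConstTime fun p : γ × List γ => p.1 :: p.2 := by fun_prop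
  have hs := Comp.comp ec (Comp.pair (hf.comp e) e')
  exact (Comp.listRec (F := fun x m => m.map (f x))
    (U := fun x m => (m.map fun y => S (x, y) + 1).sum)
    hl ConstTime.nil hs (fun _ => rfl) (fun _ _ _ => rfl) fun _ _ _ => by simp).mono 1
    fun x => by omega

theorem Comp.filter {l : α → List β} {f : α → β → Bool} {S : α × β → ℕ} (hl : Comp l T)
    (hf : Comp (fun p : α × β => f p.1 p.2) S) :
    Comp (fun x => (l x).filter (f x))
      fun x => T x + ((l x).map fun y => S (x, y) + 1).sum := by
  have e : ConstTime fun p : α × β × List β × List β => (p.1, p.2.1) := by fun_prop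
  have e' : ConstTime fun p : α × β × List β × List β => p.2.1 :: p.2.2.2 := by fun_prop
  have e'' : ConstTime fun p : α × β × List β × List β => p.2.2.2 := by fun_prop
  have hs := Comp.cond (hf.comp e) e' e''
  exact (Comp.listRec (F := fun x m => m.filter (f x))
    (U := fun x m => (m.map fun y => S (x, y) + 1).sum) hl ConstTime.nil hs (fun _ => rfl)
    (fun x y m => by cases h : f x y <;> simp [h]) fun x y m => by
      cases f x y <;> simp).mono 1 fun x => by omega

theorem sum_map_zero_add_one (l : List β) : (l.map fun _ => 0 + 1).sum = l.length := by
  induction l with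
  | nil => rfl
  | cons y l ih => simp [add_comm]

theorem Comp.filter_const {l : α → List β} {f : α → β → Bool} (hl : Comp l T)
    (hf : ConstTime fun p : α × β => f p.1 p.2) :
    Comp (fun x => (l x).filter (f x)) fun x => T x + (l x).length :=
  (Comp.filter hl hf).mono 1 fun x => by rw [sum_map_zero_add_one]; omega

theorem Comp.map_const {l : α → List β} {f : α → β → γ} (hl : Comp l T)
    (hf : ConstTime fun p : α × β => f p.1 p.2) :
    Comp (fun x => (l x).map (f x)) fun x => T x + (l x).length :=
  (Comp.map hl hf).mono 1 fun x => by rw [sum_map_zero_add_one]; omega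

theorem Comp.length {l : α → List β} (hl : Comp l T) :
    Comp (fun x => (l x).length) fun x => T x + (l x).length := by
  have hs : ConstTime fun p : α × β × List β × ℕ => p.2.2.2 + 1 := by fun_prop
  exact (Comp.listRec (F := fun _ m => m.length) (U := fun _ m => m.length) hl ConstTime.zero hs
    (fun _ => rfl) (fun _ _ _ => rfl) fun _ _ _ => by simp [add_comm]).mono 1 fun x => by omega

theorem Comp.all {l : α → List β} {f : α → β → Bool} (hl : Comp l T)
    (hf : ConstTime fun p : α × β => f p.1 p.2) :
    Comp (fun x => (l x).all (f x)) fun x => T x + (l x).length := by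
  have e : ConstTime fun p : α × β × List β × Bool => (p.1, p.2.1) := by fun_prop
  have e' : ConstTime fun p : α × β × List β × Bool => p.2.2.2 := by fun_prop
  have hs := (hf.comp' e).and e'
  exact (Comp.listRec (F := fun x m => m.all (f x)) (U := fun _ m => m.length) hl ConstTime.true hs
    (fun _ => rfl) (fun _ _ _ => by simp) fun _ _ _ => by simp [add_comm]).mono 1
    fun x => by omega

theorem Comp.flatMap {l : α → List β} {f : α → β → List γ} {S : α × β → ℕ} (hl : Comp l T)
    (hf : Comp (fun p : α × β => f p.1 p.2) S) :
    Comp (fun x => (l x).flatMap (f x))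
      fun x => T x + ((l x).map fun y => S (x, y) + (f x y).length + 1).sum := by
  have e : ConstTime fun p : α × β × List β × List γ => (p.1, p.2.1) := by fun_prop
  have e' : ConstTime fun p : α × β × List β × List γ => p.2.2.2 := by fun_prop
  have hs := Comp.append (hf.comp e) e'
  exact (Comp.listRec (F := fun x m => m.flatMap (f x))
    (U := fun x m => (m.map fun y => S (x, y) + (f x y).length + 1).sum) hl ConstTime.nil hs
    (fun _ => rfl) (fun _ _ _ => by simp) fun _ _ _ => by simp).mono 1
    fun x => by omega

theorem length_sortBy (key : β → ℝ) (l : List β) : (sortBy key l).length = l.length :=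
  (sortBy_perm key l).length_eq

theorem Comp.orderedInsert {y : α → β} {l : α → List β} {T' : α → ℕ} {key : β → ℝ}
    (hk : ConstTime key) (hy : Comp y T') (hl : Comp l T) :
    Comp (fun x => (l x).orderedInsert (fun a b => key a ≤ key b) (y x))
      fun x => T x + T' x + (l x).length := by
  have hs : ConstTime fun p : (β × List β) × β × List β × List β =>
      bif decide (key p.1.1 ≤ key p.2.1) then p.1.1 :: p.2.1 :: p.2.2.1 else p.2.1 :: p.2.2.2 := by
    refine ConstTime.cond (ConstTime.realLe ?_ ?_) ?_ ?_ <;> fun_prop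
  have h1 : ConstTime fun p : β × List β => [p.1] := by fun_prop
  have h2 : ConstTime fun p : β × List β => p.2 := by fun_prop
  have h := Comp.listRec (F := fun p m => m.orderedInsert (fun a b => key a ≤ key b) p.1)
    (U := fun _ m => m.length) h2 h1 hs (fun _ => rfl) (fun p y m => by
      rw [List.orderedInsert_cons]
      by_cases h : key p.1 ≤ key y <;> simp [h]) fun _ _ _ => by simp [add_comm]
  exact (h.comp (hy.pair hl)).mono 1 fun x => by simp only; omega

theorem Comp.sortBy {l : α → List β} {key : β → ℝ} (hk : ConstTime key) (hl : Comp l T) :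
    Comp (fun x => sortBy key (l x)) fun x => T x + (l x).length ^ 2 := by
  have e : ConstTime fun p : α × β × List β × List β => p.2.1 := by fun_prop
  have e' : ConstTime fun p : α × β × List β × List β => p.2.2.2 := by fun_prop
  have hs := Comp.orderedInsert hk e e'
  exact (Comp.listRec (F := fun _ m => DDP.sortBy key m)
    (U := fun _ m => m.length ^ 2) hl ConstTime.nil hs
    (fun _ => rfl) (fun _ _ _ => rfl) fun _ _ m => by
      simp only [length_sortBy, List.length_cons]
      nlinarith).mono 1
    fun x => by omega

/-! #### First fit -/

/-- The total length of the groups plus their number. -/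
def weight (gs : List (List β)) : ℕ := (gs.map fun g => g.length + 1).sum

theorem weight_eq (gs : List (List β)) : weight gs = gs.flatten.length + gs.length := by
  induction gs with
  | nil => rfl
  | cons g gs ih =>
    have : weight (g :: gs) = g.length + 1 + weight gs := by simp [weight]
    rw [this, ih, List.flatten_cons, List.length_append, List.length_cons]
    omega

/-- An insertion adds one element and at most one group. The weight also bounds the time of one
insertion when the test is linear in the group. -/
theorem weight_firstFitAll_le (ok : β → List β → Bool) (init : List (List β)) (l : List β) :
    weight (firstFitAll ok init l) ≤ weight init + 2 * l.length := by
  have h1 := (firstFitAll_perm ok init l).length_eq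
  have h2 := length_firstFitAll_le ok init l
  rw [List.length_append] at h1
  rw [weight_eq, weight_eq]
  omega

theorem Comp.firstFit {ok : α → β → List β → Bool} {v : α → β} {gs : α → List (List β)}
    {T' : α → ℕ} (hok : Comp (fun p : α × β × List β => ok p.1 p.2.1 p.2.2) fun p => p.2.2.length)
    (hv : Comp v T) (hgs : Comp gs T') :
    Comp (fun x => firstFit (ok x) (v x) (gs x)) fun x => T x + T' x + weight (gs x) := by
  have e : ConstTime fun p : (α × β × List (List β)) × List β × List (List β) × List (List β) =>
      (p.1.1, p.1.2.1, p.2.1) := by fun_prop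
  have e' : ConstTime fun p : (α × β × List (List β)) × List β × List (List β) × List (List β) =>
      (p.1.2.1 :: p.2.1) :: p.2.2.1 := by fun_prop
  have e'' : ConstTime fun p : (α × β × List (List β)) × List β × List (List β) × List (List β) =>
      p.2.1 :: p.2.2.2 := by fun_prop
  have hs := Comp.cond (hok.comp e) e' e''
  have h0 : ConstTime fun p : α × β × List (List β) => [[p.2.1]] := by fun_prop
  have h2 : ConstTime fun p : α × β × List (List β) => p.2.2 := by fun_prop
  have h := Comp.listRec (F := fun p m => DDP.firstFit (ok p.1) p.2.1 m)
    (U := fun _ m => weight m) h2 h0 hs (fun _ => rfl) (fun _ _ _ => rfl) fun p y m => by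
      cases ok p.1 p.2.1 y <;> simp [weight]
  have hid : ConstTime fun x : α => x := by fun_prop
  exact (h.comp (Comp.pair hid (hv.pair hgs))).mono 1 fun x => by simp only; omega

theorem Comp.firstFitAll {ok : α → β → List β → Bool} {init : α → List (List β)} {l : α → List β}
    {T' : α → ℕ} (hok : Comp (fun p : α × β × List β => ok p.1 p.2.1 p.2.2) fun p => p.2.2.length)
    (hi : Comp init T) (hl : Comp l T') :
    Comp (fun x => firstFitAll (ok x) (init x) (l x))
      fun x => T x + T' x + (l x).length * (weight (init x) + 2 * (l x).length) := by
  have e : ConstTime fun p : (α × List (List β) × List β) × β × List β × List (List β) =>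
      p.2.1 := by fun_prop
  have e' : ConstTime fun p : (α × List (List β) × List β) × β × List β × List (List β) =>
      p.2.2.2 := by fun_prop
  have e'' : ConstTime fun p : ((α × List (List β) × List β) × β × List β × List (List β)) ×
      β × List β => (p.1.1.1, p.2.1, p.2.2) := by fun_prop
  have hs := Comp.firstFit (ok := fun p => ok p.1.1)
    ((hok.comp e'').mono 1 fun x => by simp only; omega) e e'
  have h0 : ConstTime fun p : α × List (List β) × List β => p.2.1 := by fun_prop
  have h2 : ConstTime fun p : α × List (List β) × List β => p.2.2 := by fun_prop
  have h := Comp.listRec (F := fun p m => DDP.firstFitAll (ok p.1) p.2.1 m)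
    (U := fun p m => m.length * (weight p.2.1 + 2 * m.length)) h2 h0 hs (fun _ => rfl)
    (fun _ _ _ => rfl) fun p y m => by
      have := weight_firstFitAll_le (ok p.1) p.2.1 m
      simp only [List.length_cons]
      nlinarith
  have hid : ConstTime fun x : α => x := by fun_prop
  exact (h.comp (Comp.pair hid (hi.pair hl))).mono 1 fun x => by simp only; omega

end Calculus

/-! ### The running time of the algorithm -/

section Segment

variable {α β : Type}

@[fun_prop]
theorem ConstTime.apart {x y : α → Item} (hx : ConstTime x) (hy : ConstTime y) :
    ConstTime fun a => apart (x a) (y a) := by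
  refine ConstTime.or (ConstTime.not (.realLe ?_ ?_)) (ConstTime.not (.realLe ?_ ?_)) <;> fun_prop

theorem comp_okColor : Comp (fun p : Item × List Item => okColor p.1 p.2) fun p => p.2.length := by
  have h : ConstTime fun p : Item × List Item => p.2 := by fun_prop
  have h' : ConstTime fun p : (Item × List Item) × Item => DDP.apart p.1.1 p.2 := by fun_prop
  exact (Comp.all h h').mono 1 fun x => by omega

theorem comp_load : Comp load List.length := by
  have h : ConstTime fun l : List Item => l := by fun_prop
  have hs : ConstTime fun p : List Item × Item × List Item × ℝ => p.2.1.2.2.2 + p.2.2.2 := by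
    fun_prop
  exact (Comp.listRec (F := fun _ m => load m) (U := fun _ m => m.length) h ConstTime.realZero hs
    (fun _ => rfl) (fun _ _ _ => by simp [load]) fun _ _ _ => by simp [add_comm]).mono 1
    fun x => by omega

theorem comp_okPack :
    Comp (fun p : ℝ × Item × List Item => okPack p.1 p.2.1 p.2.2) fun p => p.2.2.length := by
  have h1 : ConstTime fun p : ℝ × Item × List Item => p.2.2 := by fun_prop
  have h2 : ConstTime fun p : ℝ × Item × List Item => (p.1, p.2.1.2.2.2) := by fun_prop
  have h3 : ConstTime fun q : (ℝ × ℝ) × ℝ => decide (q.1.2 + q.2 ≤ q.1.1) := by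
    refine ConstTime.realLe ?_ ?_ <;> fun_prop
  exact (Comp.comp h3 (Comp.pair h2 (comp_load.comp h1))).mono 1 fun x => by omega

theorem comp_okMatch :
    Comp (fun p : ℝ × Item × List Item => okMatch p.1 p.2.1 p.2.2) fun p => p.2.2.length := by
  have h1 : ConstTime fun p : ℝ × Item × List Item => p.2 := by fun_prop
  have h2 : ConstTime fun q : Bool × Bool => q.1 && q.2 := by fun_prop
  exact (Comp.comp h2 (Comp.pair (comp_okColor.comp h1) comp_okPack)).mono 2
    fun x => by omega

@[fun_prop]
theorem ConstTime.isLeft {s : α → Stop} {x : α → Item} (hs : ConstTime s) (hx : ConstTime x) :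
    ConstTime fun a => isLeft (s a) (x a) := by
  refine ConstTime.and ?_ (ConstTime.and (.realLe ?_ ?_) (.realLe ?_ ?_)) <;> fun_prop

@[fun_prop]
theorem ConstTime.isRight {s : α → Stop} {x : α → Item} (hs : ConstTime s) (hx : ConstTime x) :
    ConstTime fun a => isRight (s a) (x a) := by
  refine ConstTime.and ?_ (ConstTime.and (ConstTime.not (.realLe ?_ ?_)) (.realLe ?_ ?_)) <;>
    fun_prop

@[fun_prop]
theorem ConstTime.isExt {s : α → Stop} {x : α → Item} (hs : ConstTime s) (hx : ConstTime x) :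
    ConstTime fun a => isExt (s a) (x a) := (hs.isLeft hx).or (hs.isRight hx)

@[fun_prop]
theorem ConstTime.inSegment {s : α → Stop} {x : α → Item} (hs : ConstTime s) (hx : ConstTime x) :
    ConstTime fun a => inSegment (s a) (x a) := by
  refine ConstTime.or ?_ (.realLe ?_ ?_) <;> fun_prop

theorem length_extList_le (s : Stop) (L : List Item) : (extList id s L).length ≤ 2 * L.length := by
  rw [extList, List.length_append, length_sortBy]
  have h1 := List.length_filter_le (fun j => isLeft s (id j)) L
  have h2 := List.length_filter_le (fun j => isRight s (id j)) L
  omega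

theorem comp_extList :
    Comp (fun p : Stop × List Item => extList id p.1 p.2) fun p => p.2.length ^ 2 := by
  have h : ConstTime fun p : Stop × List Item => p.2 := by fun_prop
  have h1 : ConstTime fun q : (Stop × List Item) × Item => DDP.isLeft q.1.1 q.2 := by fun_prop
  have h2 : ConstTime fun q : (Stop × List Item) × Item => DDP.isRight q.1.1 q.2 := by fun_prop
  have hk : ConstTime fun j : Item => j.2.2.2 := by fun_prop
  refine (Comp.append (h.filter_const h1) ((h.filter_const h2).sortBy hk)).mono 4 fun p => ?_
  have h3 := List.length_filter_le (fun j => DDP.isLeft p.1 j) p.2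
  have h4 := List.length_filter_le (fun j => DDP.isRight p.1 j) p.2
  have h5 := Nat.pow_le_pow_left h4 2
  simp only [id] at h3 h4 h5 ⊢
  nlinarith

theorem weight_matchGroups_le (B : ℝ) (s : Stop) (L : List Item) :
    weight (matchGroups id B s L) ≤ 4 * L.length := by
  have h1 := weight_firstFitAll_le (fun j g => okMatch B (id j) (g.map id)) [] (extList id s L)
  have h2 := length_extList_le s L
  rw [matchGroups]
  simp only [weight, List.map_nil, List.sum_nil] at h1 ⊢
  omega

theorem comp_matchGroups : Comp (fun p : ℝ × Stop × List Item => matchGroups id p.1 p.2.1 p.2.2)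
    fun p => p.2.2.length ^ 2 := by
  have h1 : ConstTime fun p : (ℝ × Stop × List Item) × Item × List Item => (p.1.1, p.2) := by
    fun_prop
  have h2 : ConstTime fun p : ℝ × Stop × List Item => p.2 := by fun_prop
  refine ((Comp.firstFitAll (ok := fun (p : ℝ × Stop × List Item) x g => okMatch p.1 x g)
    ((comp_okMatch.comp h1).mono 1 fun p => by simp only; omega)
    ConstTime.nil (comp_extList.comp h2)).congr fun p => ?_).mono 9 fun p => ?_
  · simp [matchGroups]
  · have := length_extList_le p.2.1 p.2.2
    simp only [weight, List.map_nil, List.sum_nil]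
    nlinarith

theorem length_restList_le (s : Stop) (L : List Item) : (restList id s L).length ≤ L.length :=
  List.length_filter_le _ _

theorem weight_colorGroups_le (B : ℝ) (s : Stop) (L : List Item) :
    weight (colorGroups id B s L) ≤ 6 * L.length := by
  have h1 := weight_firstFitAll_le (fun j g => okColor (id j) (g.map id)) (matchGroups id B s L)
    (restList id s L)
  have h2 := length_restList_le s L
  have h3 := weight_matchGroups_le B s L
  rw [colorGroups]
  omega

theorem comp_colorGroups : Comp (fun p : ℝ × Stop × List Item => colorGroups id p.1 p.2.1 p.2.2)
    fun p => p.2.2.length ^ 2 := by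
  have h1 : ConstTime fun p : (ℝ × Stop × List Item) × Item × List Item => p.2 := by fun_prop
  have h2 : ConstTime fun p : ℝ × Stop × List Item => p.2.2 := by fun_prop
  have h3 : ConstTime fun p : (ℝ × Stop × List Item) × Item => !DDP.isExt p.1.2.1 p.2 := by
    fun_prop
  refine ((Comp.firstFitAll (ok := fun (_ : ℝ × Stop × List Item) x g => okColor x g)
    ((comp_okColor.comp h1).mono 1 fun p => by omega)
    comp_matchGroups (h2.filter_const (f := fun p x => !DDP.isExt p.2.1 x) h3)).congr
    fun p => ?_).mono 9 fun p => ?_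
  · simp [colorGroups, restList]
  · have h4 := length_restList_le p.2.1 p.2.2
    have h5 := weight_matchGroups_le p.1 p.2.1 p.2.2
    rw [restList] at h4
    have h6 := Nat.mul_le_mul h4 (Nat.add_le_add h5 (Nat.mul_le_mul_left 2 h4))
    simp only [id] at h4 h6 ⊢
    nlinarith

theorem comp_packGroup : Comp (fun p : ℝ × List Item => packGroup id p.1 p.2)
    fun p => p.2.length ^ 2 := by
  have h1 : ConstTime fun p : (ℝ × List Item) × Item × List Item => (p.1.1, p.2) := by fun_prop
  have h2 : ConstTime fun p : ℝ × List Item => p.2 := by fun_prop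
  refine ((Comp.firstFitAll (ok := fun (p : ℝ × List Item) x g => okPack p.1 x g)
    ((comp_okPack.comp h1).mono 1 fun p => by simp only; omega)
    ConstTime.nil h2).congr fun p => ?_).mono 2 fun p => ?_
  · simp [packGroup]
  · simp only [weight, List.map_nil, List.sum_nil]
    nlinarith

theorem weight_packGroup_le (B : ℝ) (g : List Item) : weight (packGroup id B g) ≤ 2 * g.length := by
  have h1 := weight_firstFitAll_le (fun j b => okPack B (id j) (b.map id)) [] g
  rw [packGroup]
  simp only [weight, List.map_nil, List.sum_nil] at h1 ⊢
  omega

theorem length_le_weight (gs : List (List β)) : gs.length ≤ weight gs := by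
  rw [weight_eq]; omega

theorem weight_flatMap_packGroup_le (B : ℝ) (K : List (List Item)) :
    weight (K.flatMap (packGroup id B)) ≤ 2 * weight K := by
  induction K with
  | nil => simp [weight]
  | cons g K ih =>
    have := weight_packGroup_le B g
    simp only [weight, List.flatMap_cons, List.map_append, List.sum_append, List.map_cons,
      List.sum_cons] at ih this ⊢
    omega

theorem weight_segmentBlocks_le (B : ℝ) (s : Stop) (L : List Item) :
    weight (segmentBlocks id B s L) ≤ 12 * L.length := by
  have h1 := weight_flatMap_packGroup_le B (colorGroups id B s L)
  have h2 := weight_colorGroups_le B s L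
  rw [segmentBlocks]
  omega

theorem sum_sq_le_weight_sq (K : List (List β)) :
    (K.map fun g => (g.length + 1) ^ 2).sum ≤ weight K ^ 2 := by
  induction K with
  | nil => simp
  | cons g K ih =>
    simp only [weight, List.map_cons, List.sum_cons] at ih ⊢
    have := add_sq (g.length + 1) ((K.map fun g => g.length + 1).sum)
    have := Nat.zero_le (2 * (g.length + 1) * (K.map fun g => g.length + 1).sum)
    linarith

theorem comp_segmentBlocks : Comp (fun p : ℝ × Stop × List Item => segmentBlocks id p.1 p.2.1 p.2.2)
    fun p => p.2.2.length ^ 2 := by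
  have h1 : ConstTime fun p : (ℝ × Stop × List Item) × List Item => (p.1.1, p.2) := by fun_prop
  refine (Comp.flatMap (f := fun (p : ℝ × Stop × List Item) g => packGroup id p.1 g)
    -- With `L` the length of the segment list, packing costs at most twice the square of a colour
    -- group's length plus one, in total `2 * (6 * L) ^ 2 = 72 * L ^ 2`; the colouring adds one more
    -- square.
    comp_colorGroups (comp_packGroup.comp h1)).mono 73 fun p => ?_
  have h2 : ((colorGroups id p.1 p.2.1 p.2.2).map fun y =>
      0 + y.length ^ 2 + (packGroup id p.1 y).length + 1).sum ≤
      ((colorGroups id p.1 p.2.1 p.2.2).map fun y => 2 * (y.length + 1) ^ 2).sum := by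
    refine List.sum_le_sum fun y _ => ?_
    have h3 := weight_packGroup_le p.1 y
    have h4 := length_le_weight (packGroup id p.1 y)
    nlinarith
  rw [List.sum_map_mul_left] at h2
  have h3 := sum_sq_le_weight_sq (colorGroups id p.1 p.2.1 p.2.2)
  have h4 := Nat.pow_le_pow_left (weight_colorGroups_le p.1 p.2.1 p.2.2) 2
  simp only at h2 ⊢
  nlinarith

theorem comp_segmentResult :
    Comp (fun p : ℝ × List Item × Stop => segmentResult p.1 p.2) fun p => p.2.1.length ^ 2 := by
  have h : ConstTime fun p : ℝ × List Item × Stop => (p.1, p.2.2, p.2.1) := by fun_prop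
  have h' : ConstTime fun p : ℝ × List Item × Stop => p.2.2 := by fun_prop
  have h1 := comp_segmentBlocks.comp h
  refine (Comp.pair (Comp.pair (comp_matchGroups.comp h).length h1.length)
    (Comp.pair h1 h')).mono 20 fun p => ?_
  have h2 := (length_le_weight _).trans (weight_matchGroups_le p.1 p.2.2 p.2.1)
  have h3 := (length_le_weight _).trans (weight_segmentBlocks_le p.1 p.2.2 p.2.1)
  simp only at h2 h3 ⊢
  nlinarith

theorem length_takeSegment (s : Stop) (L : List Item) :
    (takeSegment s L).1.length + (takeSegment s L).2.length = L.length := by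
  cases L with
  | nil => rfl
  | cons x L =>
    rw [takeSegment]
    cases inSegment s x
    · simp
    · simp only [cond_true, length_sortBy]
      exact (List.length_eq_length_filter_add _).symm

/-- Two filters and a sort are run only when the segment is nonempty, so each of the three is
covered by the product of the two lengths. -/
theorem comp_takeSegment : Comp (fun p : Stop × List Item => takeSegment p.1 p.2)
    fun p => (takeSegment p.1 p.2).1.length * p.2.length := by
  have h : ConstTime fun p : Stop × List Item => p.2 := by fun_prop
  have h1 : ConstTime fun q : (Stop × List Item) × Item => DDP.inSegment q.1.1 q.2 := by fun_prop
  have h2 : ConstTime fun q : (Stop × List Item) × Item => !DDP.inSegment q.1.1 q.2 := by fun_prop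
  have hk : ConstTime fun j : Item => j.2.2.1 := by fun_prop
  have h3 := Comp.pair ((h.filter_const (f := fun p x => DDP.inSegment p.1 x) h1).sortBy hk)
    (h.filter_const (f := fun p x => !DDP.inSegment p.1 x) h2)
  have h4 : ConstTime fun p : (Stop × List Item) × Item × List Item => p.1 := by fun_prop
  have h5 : ConstTime fun p : (Stop × List Item) × Item × List Item =>
    (([] : List Item), p.1.2) := by fun_prop
  have h6 : ConstTime fun p : (Stop × List Item) × Item × List Item =>
    DDP.inSegment p.1.1 p.2.1 := by fun_prop
  have h7 : ConstTime fun p : Stop × List Item => (([] : List Item), ([] : List Item)) := by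
    fun_prop
  refine (Comp.caseList h h7 (Comp.cond h6 (h3.comp h4) h5)
    (F := fun p : Stop × List Item => takeSegment p.1 p.2)
    (U := fun p => 3 * ((takeSegment p.1 p.2).1.length * p.2.length)) (fun p hp => ?_)
    fun p y ys hp => ?_).mono 3 fun p => by omega
  · simp [hp, takeSegment]
  · obtain ⟨s, L⟩ := p
    subst hp
    simp only
    rw [takeSegment]
    cases hs : DDP.inSegment s y
    · simp
    · refine ⟨rfl, ?_⟩
      have h8 := List.length_filter_le (fun j => DDP.inSegment s j) (y :: ys)
      have h9 : 1 ≤ ((y :: ys).filter fun j => DDP.inSegment s j).length := by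
        rw [List.filter_cons_of_pos hs, List.length_cons]; omega
      simp only [cond_true, length_sortBy]
      nlinarith

end Segment

/-! ### Time to split the input and treat all segments -/

section Sweep

variable {α β : Type} {T : α → ℕ}

theorem foldl_takeSegment (ss : List Stop) (L : List Item) (acc : List (List Item × Stop)) :
    (ss.foldl (fun st s => ((takeSegment s st.1).2, ((takeSegment s st.1).1, s) :: st.2))
      (L, acc)).2.reverse = acc.reverse ++ sweep ss L := by
  induction ss generalizing L acc with
  | nil => simp [sweep]
  | cons s ss ih => simp [sweep, ih]

theorem length_sweep (ss : List Stop) (L : List Item) : (sweep ss L).length = ss.length := by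
  induction ss generalizing L with
  | nil => rfl
  | cons s ss ih => simp [sweep, ih]

theorem sum_length_sweep_le (ss : List Stop) (L : List Item) :
    ((sweep ss L).map fun y => y.1.length).sum ≤ L.length := by
  induction ss generalizing L with
  | nil => simp [sweep]
  | cons s ss ih =>
    have h1 := length_takeSegment s L
    have h2 := ih (takeSegment s L).2
    simp only [sweep, List.map_cons, List.sum_cons]
    omega

theorem sum_sq_le {l : List β} (f : β → ℕ) : (l.map fun y => f y ^ 2).sum ≤ (l.map f).sum ^ 2 := by
  induction l with
  | nil => simp
  | cons y l ih =>
    have := add_sq (f y) (l.map f).sum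
    have := Nat.zero_le (2 * f y * (l.map f).sum)
    simp only [List.map_cons, List.sum_cons]
    linarith

theorem comp_sweep : Comp (fun p : List Stop × List Item => sweep p.1 p.2)
    fun p => p.2.length ^ 2 + p.1.length := by
  have h0 : ConstTime fun p : List Stop × List Item => p.1 := by fun_prop
  have h1 : ConstTime fun p : List Stop × List Item => (p.2, ([] : List (List Item × Stop))) := by
    fun_prop
  have h2 : ConstTime fun q : (List Item × List (List Item × Stop)) × Stop => (q.2, q.1.1) := by
    fun_prop
  have h3 : ConstTime fun q : (List Item × List Item) × Stop × List (List Item × Stop) =>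
    (q.1.2, (q.1.1, q.2.1) :: q.2.2) := by fun_prop
  have h4 : ConstTime fun q : (List Item × List (List Item × Stop)) × Stop => (q.2, q.1.2) := by
    fun_prop
  have hs : Comp (fun q : (List Item × List (List Item × Stop)) × Stop =>
      ((takeSegment q.2 q.1.1).2, ((takeSegment q.2 q.1.1).1, q.2) :: q.1.2))
      fun q => (takeSegment q.2 q.1.1).1.length * q.1.1.length :=
    (Comp.comp h3 (Comp.pair (comp_takeSegment.comp h2) h4)).mono 1 fun q => by simp only; omega
  -- Removing `a` of `b` remaining deliveries lowers the square by at least `a * b`, which pays for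
  -- that stop; the number of stops enters only linearly.
  have h5 := Comp.foldl (U := fun s l => s.1.length ^ 2 + l.length) h0 h1 hs (fun _ => True)
    (fun _ => trivial) (fun _ _ _ => trivial) fun st s l _ => by
      have := length_takeSegment s st.1
      simp only [List.length_cons]
      nlinarith [Nat.zero_le ((takeSegment s st.1).1.length * (takeSegment s st.1).2.length)]
  have h6 : ConstTime fun q : List Item × List (List Item × Stop) => q.2 := by fun_prop
  refine ((h6.comp h5).reverse.congr fun p => ?_).mono 2 fun p => ?_
  · simpa using foldl_takeSegment p.1 p.2 []
  · have h7 := congrArg List.length (foldl_takeSegment p.1 p.2 [])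
    simp only [List.length_reverse, List.length_append, List.length_nil, length_sweep] at h7 ⊢
    omega

theorem Comp.enumerate {l : α → List β} (hl : Comp l T) :
    Comp (fun x => enumerate (l x)) fun x => T x + (l x).length ^ 2 := by
  have h1 : ConstTime fun p : α × β × List β × List (ℕ × β) => p.2.2.1 := by fun_prop
  have h2 : ConstTime fun p : α × β × List β × List (ℕ × β) => (p.2.1, p.2.2.2) := by fun_prop
  have h3 : ConstTime fun q : ℕ × β × List (ℕ × β) => (q.1, q.2.1) :: q.2.2 := by fun_prop
  have hs := Comp.comp h3 (Comp.pair (Comp.length h1) h2)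
  exact (Comp.listRec (F := fun _ m => DDP.enumerate m) (U := fun _ m => m.length ^ 2) hl
    ConstTime.nil hs (fun _ => rfl) (fun _ _ _ => rfl) fun _ _ m => by
      simp only [List.length_cons]
      nlinarith).mono 1 fun x => by omega

/-- Each segment takes quadratic time in its own size, and the squares of the sizes add up to at
most `n ^ 2`. -/
theorem comp_results : Comp results fun x => x.2.1.length ^ 2 + x.2.2.length := by
  have h1 : ConstTime fun x : Input => x.2.2 := by fun_prop
  have h2 : ConstTime fun x : Input => x.2.1 := by fun_prop
  have h3 : ConstTime fun q : Input × ℝ × ℝ => (Bool.true, q.2) := by fun_prop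
  have h4 : ConstTime fun x : Input => [(Bool.false, (0 : ℝ), (0 : ℝ))] := by fun_prop
  have h5 : ConstTime fun j : Item => j.2.1 := by fun_prop
  have h6 : ConstTime fun q : Input × List Item × Stop => (q.1.1, q.2) := by fun_prop
  have h7 : Comp (fun x : Input => stopList x.2.2) fun x => x.2.2.length :=
    (Comp.append (h1.map_const (f := fun _ y => (Bool.true, y)) h3) h4).mono 2 fun x => by
      simp only [List.length_map]; omega
  have h8 := comp_sweep.comp (h7.pair (Comp.sortBy h5 (Comp.enumerate h2)))
  refine (Comp.map (f := fun (x : Input) y => segmentResult x.1 y) h8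
    (comp_segmentResult.comp h6)).mono 8 fun x => ?_
  set ss := stopList x.2.2 with hss
  set L := sortBy (fun j => j.2.1) (enumerate x.2.1) with hL
  have e1 : L.length = x.2.1.length := by rw [hL, length_sortBy, length_enumerate]
  have e2 : ss.length = x.2.2.length + 1 := by simp [hss, stopList]
  have e3 := length_sweep ss L
  have e4 := (sum_sq_le (l := sweep ss L) fun y => y.1.length).trans
    (Nat.pow_le_pow_left (sum_length_sweep_le ss L) 2)
  have e5 : ((sweep ss L).map fun y => 0 + y.1.length ^ 2 + 1).sum =
      ((sweep ss L).map fun y => y.1.length ^ 2).sum + (sweep ss L).length := by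
    simp [List.sum_map_add]
  simp only [length_enumerate, e1, e2] at e4 ⊢
  rw [e5]
  omega

theorem length_results (x : Input) : (results x).length = x.2.2.length + 1 := by
  simp [results, length_sweep, stopList]

theorem sum_weight_results_le (x : Input) :
    ((results x).map fun y => weight y.2.1).sum ≤ 12 * x.2.1.length := by
  rw [results, List.map_map]
  set ss := stopList x.2.2
  have h1 := sum_length_sweep_le ss (sortBy (fun j => j.2.1) (enumerate x.2.1))
  rw [length_sortBy, length_enumerate] at h1
  refine le_trans (List.sum_le_sum fun y _ => ?_) ((List.sum_map_mul_left ..).le.trans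
    (Nat.mul_le_mul_left 12 h1))
  exact weight_segmentBlocks_le _ _ _

theorem Comp.listMax {l : α → List ℕ} (hl : Comp l T) :
    Comp (fun x => listMax (l x)) fun x => T x + (l x).length := by
  have hs : ConstTime fun p : α × ℕ × List ℕ × ℕ =>
      bif decide (p.2.1 ≤ p.2.2.2) then p.2.2.2 else p.2.1 := by
    refine ConstTime.cond (.natLe ?_ ?_) ?_ ?_ <;> fun_prop
  exact (Comp.listRec (F := fun _ m => DDP.listMax m) (U := fun _ m => m.length) hl
    ConstTime.zero hs (fun _ => rfl) (fun _ y m => by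
      have e : DDP.listMax (y :: m) = max y (DDP.listMax m) := rfl
      rw [e, max_def]
      by_cases h : y ≤ DDP.listMax m <;> simp [h]) fun _ _ m => by
      simp only [List.length_cons]
      omega).mono 1 fun x => by omega

theorem comp_droneCount : Comp droneCount List.length := by
  have h : ConstTime fun l : List ((ℕ × ℕ) × List (List Item) × Stop) => l := by fun_prop
  have h1 : ConstTime fun q : List ((ℕ × ℕ) × List (List Item) × Stop) ×
    (ℕ × ℕ) × List (List Item) × Stop => q.2.1.1 := by fun_prop
  have h2 : ConstTime fun q : List ((ℕ × ℕ) × List (List Item) × Stop) ×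
    (ℕ × ℕ) × List (List Item) × Stop => q.2.1.2 := by fun_prop
  have h3 : ConstTime fun q : ℕ × ℕ => q.1 + q.2 := by fun_prop
  have h4 := (Comp.map_const (f := fun _ y => y.1.1) h h1).listMax
  have h5 := (Comp.map_const (f := fun _ y => y.1.2) h h2).listMax
  refine ((Comp.comp h3 (Comp.pair h5 h4)).congr fun _ => rfl).mono 4 fun x => ?_
  simp only [List.length_map]
  omega

theorem length_droneList_le (N : ℕ) (l : List (ℝ × ℝ × ℝ)) :
    (droneList N l).length ≤ 2 * l.length := by
  refine (List.length_filter_le _ _).trans ?_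
  rw [List.length_map, length_enumerate, List.length_append]
  omega

theorem comp_droneList : Comp (fun p : ℕ × List (ℝ × ℝ × ℝ) => droneList p.1 p.2)
    fun p => p.2.length ^ 2 := by
  have h : ConstTime fun p : ℕ × List (ℝ × ℝ × ℝ) => p.2 := by fun_prop
  have h1 : ConstTime fun q : (ℕ × List (ℝ × ℝ × ℝ)) × ℕ × ℝ × ℝ × ℝ => q.2.1 := by fun_prop
  have h2 : ConstTime fun q : (ℕ × List (ℝ × ℝ × ℝ)) × ℕ => decide (q.2 + 1 ≤ q.1.1) := by
    refine .natLe ?_ ?_ <;> fun_prop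
  have h3 := Comp.map_const (f := fun _ y => y.1) (Comp.append h h).enumerate h1
  have h4 := Comp.filter_const
    (f := fun (p : ℕ × List (ℝ × ℝ × ℝ)) (d : ℕ) => decide (d + 1 ≤ p.1)) h3 h2
  refine (h4.congr fun _ => rfl).mono 10 fun p => ?_
  simp only [List.length_map, length_enumerate, List.length_append]
  nlinarith

end Sweep

/-! ### Time to assign the drones and produce the output -/

section Assignment

variable {α β : Type} {T : α → ℕ}

@[fun_prop]
theorem ConstTime.natEq {f g : α → ℕ} (hf : ConstTime f) (hg : ConstTime g) :
    ConstTime fun x => natEq (f x) (g x) := by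
  refine ConstTime.and (.natLe ?_ ?_) (.natLe ?_ ?_) <;> fun_prop

theorem comp_deal : Comp (fun p : List (List β) × List ℕ => deal p.1 p.2) fun p => weight p.1 := by
  have h1 : ConstTime fun p : List (List β) × List ℕ => p.1 := by fun_prop
  have h2 : ConstTime fun p : List (List β) × List ℕ => (([] : List (β × ℕ)), p.2) := by fun_prop
  have h3 : ConstTime fun q : (List (List β) × List ℕ) × List β × List (List β) ×
    List (β × ℕ) × List ℕ => q.2.2.2.2 := by fun_prop
  have h4 : ConstTime fun q : (List (List β) × List ℕ) × List β × List (List β) ×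
    List (β × ℕ) × List ℕ => (q.2.2.2.1, ([] : List ℕ)) := by fun_prop
  have h5 : ConstTime fun q : ((List (List β) × List ℕ) × List β × List (List β) ×
    List (β × ℕ) × List ℕ) × ℕ × List ℕ => q.1.2.1 := by fun_prop
  have h6 : ConstTime fun q : ((List (List β) × List ℕ) × List β × List (List β) ×
    List (β × ℕ) × List ℕ) × ℕ × List ℕ => q.1.2.2.2.1 := by fun_prop
  have h7 : ConstTime fun q : ((List (List β) × List ℕ) × List β × List (List β) ×
    List (β × ℕ) × List ℕ) × ℕ × List ℕ => q.2.2 := by fun_prop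
  have h8 : ConstTime fun q : (((List (List β) × List ℕ) × List β × List (List β) ×
    List (β × ℕ) × List ℕ) × ℕ × List ℕ) × β => (q.2, q.1.2.1) := by fun_prop
  have h9 := Comp.pair (Comp.append (Comp.map_const (f := fun (q : ((List (List β) × List ℕ) ×
    List β × List (List β) × List (β × ℕ) × List ℕ) × ℕ × List ℕ) (j : β) => (j, q.2.1)) h5 h8)
    h6) h7
  have hs := Comp.caseList (F := fun q : (List (List β) × List ℕ) × List β × List (List β) ×
      List (β × ℕ) × List ℕ => (match q.2.2.2.2 with
        | [] => (q.2.2.2.1, [])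
        | d :: ds' => (q.2.1.map (fun j => (j, d)) ++ q.2.2.2.1, ds') : List (β × ℕ) × List ℕ))
    (U := fun q => 2 * q.2.1.length) h3 h4 h9 (fun q hq => by simp [hq]) fun q d ds hq => by
      simp only [hq, List.length_map, true_and]
      omega
  exact ((Comp.listRec (F := fun p m => deal m p.2) (U := fun _ m => 2 * weight m) h1 h2 hs
    (fun _ => rfl) (fun _ _ _ => rfl) fun p y m => by
      simp only [weight, List.map_cons, List.sum_cons]
      omega)).mono 2 fun p => by omega

theorem length_deal_le (bs : List (List β)) (ds : List ℕ) : (deal bs ds).1.length ≤ weight bs := by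
  induction bs with
  | nil => simp [deal]
  | cons b bs ih =>
    rw [deal]
    simp only [weight, List.map_cons, List.sum_cons] at ih ⊢
    cases (deal bs ds).2
    · simp only
      omega
    · simp only [List.length_append, List.length_map]
      omega

theorem comp_extList' : Comp (fun p : Stop × List (Item × ℕ) => extList' id p.1 p.2)
    fun p => p.2.length := by
  have h1 : ConstTime fun p : Stop × List (Item × ℕ) => p.2 := by fun_prop
  have h2 : ConstTime fun q : (Stop × List (Item × ℕ)) × Item × ℕ => DDP.isExt q.1.1 q.2.1 := by
    fun_prop
  have h3 : ConstTime fun q : (Stop × List (Item × ℕ)) × Item × ℕ => q.2.2 := by fun_prop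
  have h4 := Comp.filter_const
    (f := fun (p : Stop × List (Item × ℕ)) (y : Item × ℕ) => DDP.isExt p.1 y.1) h1 h2
  refine ((Comp.map_const (f := fun _ (y : Item × ℕ) => y.2) h4 h3).congr fun _ => rfl).mono 2
    fun p => ?_
  have := List.length_filter_le (fun y : Item × ℕ => DDP.isExt p.1 y.1) p.2
  omega

theorem length_extList'_le (s : Stop) (a : List (Item × ℕ)) :
    (extList' id s a).length ≤ a.length := by
  rw [extList', List.length_map]
  exact List.length_filter_le _ _

/-- The shortcut for a segment without blocks: the filter over all drones is skipped, so empty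
segments take constant time. -/
theorem assignStep_nil (U : List ℕ) (s : Stop) (st : AssignState Item) :
    assignStep id U ([], s) st = (U, st.2.1, [] :: st.2.2) := by
  simp [assignStep, deal, extList']

abbrev StepInput : Type := List ℕ × (List (List Item) × Stop) × AssignState Item

theorem comp_assignStep : Comp (fun p : StepInput => assignStep id p.1 p.2.1 p.2.2)
    fun p => weight p.2.1.1 * (p.1.length + 1) := by
  have h1 : ConstTime fun p : StepInput => p.2.1.1 := by fun_prop
  have h2 : ConstTime fun p : StepInput => (p.1, p.2.2.2.1, ([] : List ℕ) :: p.2.2.2.2) := by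
    fun_prop
  have h3 : ConstTime fun p : StepInput => (p.2.1.1, p.2.2.1) := by fun_prop
  have h4 : ConstTime fun q : List (Item × ℕ) × List ℕ => q.1 := by fun_prop
  have h5 : ConstTime fun p : StepInput => p.2.1.2 := by fun_prop
  have h6 : ConstTime fun q : StepInput × ℕ => q.1 := by fun_prop
  have h7 : ConstTime fun q : (StepInput × ℕ) × ℕ => !DDP.natEq q.1.2 q.2 := by fun_prop
  have h8 : ConstTime fun p : StepInput => p.1 := by fun_prop
  have h9 : ConstTime fun p : StepInput => p.2.2.2.1 := by fun_prop
  have h10 : ConstTime fun p : StepInput => p.2.2.2.2 := by fun_prop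
  have h11 : ConstTime fun q : List ℕ × List (List ℕ) => q.1 :: q.2 := by fun_prop
  have h12 : ConstTime fun q : StepInput × List (List Item) × List (List (List Item)) => q.1 := by
    fun_prop
  have h13 : ConstTime fun q : StepInput × List Item × List (List Item) => q.1 := by fun_prop
  have hlen : ∀ p : StepInput,
      (extList' id p.2.1.2 (deal p.2.1.1 p.2.2.1).1).length ≤ weight p.2.1.1 := fun p =>
    (length_extList'_le _ _).trans (length_deal_le _ _)
  have hd : Comp (fun p : StepInput => (deal p.2.1.1 p.2.2.1).1) fun p => weight p.2.1.1 :=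
    (Comp.comp h4 (comp_deal.comp h3)).mono 1 fun p => by simp only; omega
  have he : Comp (fun p : StepInput => extList' id p.2.1.2 (deal p.2.1.1 p.2.2.1).1)
      fun p => weight p.2.1.1 :=
    (comp_extList'.comp (Comp.pair h5 hd)).mono 2 fun p => by
      have := length_deal_le p.2.1.1 p.2.2.1
      simp only
      omega
  have hf : Comp (fun q : StepInput × ℕ =>
      !(extList' id q.1.2.1.2 (deal q.1.2.1.1 q.1.2.2.1).1).any (DDP.natEq q.2))
      fun q => weight q.1.2.1.1 :=
    ((Comp.all (f := fun (q : StepInput × ℕ) d => !DDP.natEq q.2 d) (he.comp h6) h7).congr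
      fun q => by simp [List.all_eq_not_any_not]).mono 2 fun q => by
        have := hlen q.1
        omega
  have hU := Comp.filter (f := fun (p : StepInput) d =>
    !(extList' id p.2.1.2 (deal p.2.1.1 p.2.2.1).1).any (DDP.natEq d)) h8 hf
  have hfull := Comp.pair hU (Comp.pair (Comp.append hd h9) (Comp.comp h11 (Comp.pair he h10)))
  refine (Comp.caseList (F := fun p : StepInput => assignStep id p.1 p.2.1 p.2.2)
    (U := fun p => 5 * (weight p.2.1.1 * (p.1.length + 1))) h1 h2 (hfull.comp h13)
    (fun p hp => ?_) fun p b bs hp => ?_).mono 5 fun p => by omega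
  · obtain ⟨U, ⟨bs, s⟩, st⟩ := p
    simp only at hp
    subst hp
    exact ⟨assignStep_nil U s st, Nat.zero_le _⟩
  · refine ⟨rfl, ?_⟩
    have h14 := length_deal_le p.2.1.1 p.2.2.1
    have h15 : 1 ≤ weight p.2.1.1 := by
      rw [hp]
      simp only [weight, List.map_cons, List.sum_cons]
      omega
    simp only [List.map_const', List.sum_replicate, smul_eq_mul]
    nlinarith

/-! #### The whole algorithm -/

theorem comp_assignAll :
    Comp (fun p : List ℕ × List (List (List Item) × Stop) => assignAll id p.1 p.2)
      fun p => (p.2.map fun x => weight x.1 * (p.1.length + 1) + 1).sum := by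
  have h1 : ConstTime fun p : List ℕ × List (List (List Item) × Stop) => p.2 := by fun_prop
  have h2 : ConstTime fun p : List ℕ × List (List (List Item) × Stop) =>
    ((p.1, [], []) : AssignState Item) := by fun_prop
  have h3 : ConstTime fun q : (List ℕ × List (List (List Item) × Stop)) ×
    (List (List Item) × Stop) × List (List (List Item) × Stop) × AssignState Item =>
      ((q.1.1, q.2.1, q.2.2.2) : StepInput) := by fun_prop
  exact (Comp.listRec (F := fun p m => assignAll id p.1 m)
    (U := fun p m => (m.map fun x => weight x.1 * (p.1.length + 1) + 1).sum) h1 h2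
    (comp_assignStep.comp h3) (fun _ => rfl) (fun _ _ _ => rfl) fun p y m => by simp).mono 1
    fun p => by omega

theorem length_assignAll_le (U : List ℕ) (xs : List (List (List Item) × Stop)) :
    (assignAll id U xs).2.1.length ≤ (xs.map fun x => weight x.1).sum ∧
      (assignAll id U xs).2.2.length = xs.length := by
  induction xs with
  | nil => exact ⟨Nat.zero_le _, rfl⟩
  | cons x xs ih =>
    have e : assignAll id U (x :: xs) = assignStep id U x (assignAll id U xs) := rfl
    have := length_deal_le x.1 (assignAll id U xs).1
    rw [e, assignStep, List.map_cons, List.sum_cons, List.length_append, List.length_cons,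
      List.length_cons]
    omega

theorem Comp.droneOf {k : α → ℕ} {l : α → List (Item × ℕ)} {T' : α → ℕ} (hk : Comp k T)
    (hl : Comp l T') :
    Comp (fun x => droneOf id (k x) (l x)) fun x => T x + T' x + (l x).length := by
  have h1 : ConstTime fun p : ℕ × List (Item × ℕ) => p.2 := by fun_prop
  have hs : ConstTime fun q : (ℕ × List (Item × ℕ)) × (Item × ℕ) × List (Item × ℕ) × ℕ =>
    bif DDP.natEq q.2.1.1.1 q.1.1 then q.2.1.2 else q.2.2.2 := by fun_prop
  have h := Comp.listRec (F := fun p m => DDP.droneOf id p.1 m) (U := fun _ m => m.length) h1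
    ConstTime.zero hs (fun _ => rfl) (fun _ _ _ => rfl) fun _ _ _ => by simp [add_comm]
  exact (h.comp (hk.pair hl)).mono 1 fun x => by simp only; omega

theorem Comp.tail {l : α → List β} (hl : Comp l T) : Comp (fun x => (l x).tail) T := by
  have h : ConstTime fun q : α × β × List β => q.2.2 := by fun_prop
  exact (Comp.caseList (F := fun x => (l x).tail) (U := fun _ => 0) hl ConstTime.nil h
    (fun x hx => by simp [hx]) fun x y ys hx => by simp [hx]).mono 1 fun x => by omega

theorem sum_weight_finalState (x : Input) :
    (((results x).map Prod.snd).reverse.map fun y => weight y.1).sum ≤ 12 * x.2.1.length := by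
  rw [List.map_reverse, List.sum_reverse, List.map_map]
  exact sum_weight_results_le x

theorem comp_finalState : Comp finalState fun x => x.2.1.length ^ 2 + x.2.2.length := by
  have h1 : ConstTime fun x : Input => x.2.1 := by fun_prop
  have h2 : ConstTime fun q : Input × (ℕ × ℕ) × List (List Item) × Stop => q.2.2 := by fun_prop
  have h3 := comp_droneList.comp (Comp.pair (comp_droneCount.comp comp_results) h1)
  have h4 := (Comp.map_const (f := fun _ (y : (ℕ × ℕ) × List (List Item) × Stop) => y.2)
    comp_results h2).reverse
  refine ((comp_assignAll.comp (Comp.pair h3 h4)).congr fun _ => rfl).mono 60 fun x => ?_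
  have h5 := sum_weight_finalState x
  have h6 := length_droneList_le (droneCount (results x)) x.2.1
  have h7 := length_results x
  simp only [List.sum_map_add, List.sum_map_mul_right, List.length_map] at h5 ⊢
  have h8 := Nat.mul_le_mul h5 (Nat.add_le_add_right h6 1)
  simp only [h7, List.map_const', List.sum_replicate, smul_eq_mul, List.length_reverse,
    List.length_map]
  nlinarith

theorem comp_algorithm : Comp algorithm fun x => x.2.1.length ^ 2 + x.2.2.length := by
  have h1 : ConstTime fun x : Input => x.2.1 := by fun_prop
  have h2 : ConstTime fun q : AssignState Item => q.2.1 := by fun_prop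
  have h3 : ConstTime fun q : AssignState Item => q.2.2 := by fun_prop
  have h4 := comp_droneCount.comp comp_results
  have h5 := (Comp.comp h3 comp_finalState).tail.reverse
  have h6 : ConstTime fun q : List (Item × ℕ) × List (ℕ × ℝ × ℝ × ℝ) => q.2 := by fun_prop
  have h7 : ConstTime fun q : (List (Item × ℕ) × List (ℕ × ℝ × ℝ × ℝ)) × ℕ × ℝ × ℝ × ℝ =>
    q.2.1 := by fun_prop
  have h8 : ConstTime fun q : (List (Item × ℕ) × List (ℕ × ℝ × ℝ × ℝ)) × ℕ × ℝ × ℝ × ℝ =>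
    q.1.1 := by fun_prop
  have h9 := Comp.map (f := fun (q : List (Item × ℕ) × List (ℕ × ℝ × ℝ × ℝ))
    (i : ℕ × ℝ × ℝ × ℝ) => droneOf id i.1 q.1) h6 (Comp.droneOf (T := fun _ => 0)
    (T' := fun _ => 0) h7 h8)
  have h10 := h9.comp (Comp.pair (Comp.comp h2 comp_finalState) (Comp.enumerate h1))
  refine ((Comp.pair h4 (Comp.pair h10 h5)).congr fun _ => rfl).mono 30 fun x => ?_
  obtain ⟨h11, h12⟩ := length_assignAll_le (droneList (droneCount (results x)) x.2.1)
    ((results x).map Prod.snd).reverse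
  have h13 := h11.trans (sum_weight_finalState x)
  have h14 := length_results x
  rw [List.length_reverse, List.length_map] at h12
  simp only [finalState, List.length_tail, List.map_const', List.sum_replicate, smul_eq_mul,
    length_enumerate, h12, h14, Nat.add_sub_cancel]
  have h15 := Nat.mul_le_mul_left x.2.1.length h13
  nlinarith

end Assignment

end

end DDP

/-! ### The main theorem -/

theorem mainTheorem5 :
    (∀ (n r : ℕ) (_hn : 0 < n) (P : DDP.Inst n r) (c : DDP.Choices n r) (_hc : c.IsRun P),
      P.FeasibleSolution (c.numDrones P) c.drone (c.swaps P) ∧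
        (c.numDrones P : ℝ) ≤ (3 + P.psi) * P.opt) ∧
    ∃ (p : DDP.Prog DDP.Input DDP.Output) (C : ℝ),
      ∀ (n r : ℕ) (_hn : 0 < n) (P : DDP.Inst n r),
        (∃ c : DDP.Choices n r, c.IsRun P ∧ c.IsOutput P (p.exec P.input).1) ∧
          ((p.exec P.input).2 : ℝ) ≤ C * ((n : ℝ) ^ (2.273 : ℝ) + r) := by
  refine ⟨fun n r hn P c hc => ⟨hc.feasible, hc.numDrones_le hn⟩, ?_⟩
  obtain ⟨p, C, hp⟩ := DDP.comp_algorithm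
  -- The factor `2` absorbs the additive `1` of the step count, since `1 ≤ n ^ 2`.
  refine ⟨p, 2 * C, fun n r hn P => ⟨?_, ?_⟩⟩
  · rw [(hp P.input).1]
    exact P.exists_run
  · have h1 : ((p.exec P.input).2 : ℝ) ≤ C * ((n : ℝ) ^ 2 + r + 1) := by
      have := (hp P.input).2
      simp only [DDP.Inst.input, List.length_ofFn] at this
      exact_mod_cast this
    have hn' : (1 : ℝ) ≤ n := by exact_mod_cast hn
    have h2 : (n : ℝ) ^ 2 ≤ (n : ℝ) ^ (2.273 : ℝ) := by
      rw [← Real.rpow_natCast]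
      exact Real.rpow_le_rpow_of_exponent_le hn' (by norm_num)
    have h3 : (1 : ℝ) ≤ (n : ℝ) ^ 2 := one_le_pow₀ hn'
    have h4 : (0 : ℝ) ≤ r := Nat.cast_nonneg r
    refine h1.trans ?_
    rw [mul_comm 2 (C : ℝ), mul_assoc]
    refine mul_le_mul_of_nonneg_left ?_ (Nat.cast_nonneg C)
    linarith
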